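/- A $2$-$(v,k,1)$ design consists of a set of $v$ points and a collection of $k$-subsets of it, called blocks, such that any two distinct points lie together in exactly one block. Two designs are isomorphic if there is a bijection between their point sets that carries the blocks of one exactly onto the blocks of the other. A unital in a projective plane of order $q^2$ is a set $U$ of $q^3+1$ points that meets every line of the plane in either $1$ or $q+1$ points. The unital design associated with $U$ has point set $U$, and its blocks are the intersections of $U$ with the lines that meet $U$ in exactly $q+1$ points. **Theorem.** The number of pairwise non-isomorphic unital designs embedded in projective planes of order $16$ is at least $168$. That is, there exist $168$ pairwise non-isomorphic $2$-$(65,5,1)$ designs, each of which is isomorphic to the unital design associated with a unital in some projective plane of order $16$ (the plane may differ from design to design). -/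

import Mathlib

/-- A `t`-`(v, k, lam)` design with point set `X`, given by its collection `B` of blocks:
there are exactly `v` points, every block has size `k`, and every `t` points appear together
in exactly `lam` blocks. -/
structure IsDesign {X : Type*} (t v k lam : ℕ) (B : Set (Set X)) : Prop where
  finite_points : Finite X
  card_points : Nat.card X = v
  card_block : ∀ b ∈ B, b.ncard = k
  balanced : ∀ T : Set X, T.ncard = t → {b ∈ B | T ⊆ b}.ncard = lam

/-- Two designs, given by their block collections, are isomorphic: some bijection between the
point sets carries the blocks of the first exactly onto the blocks of the second. -/
def AreIsomorphic {X Y : Type*} (B : Set (Set X)) (B' : Set (Set Y)) : Prop :=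
  ∃ e : X ≃ Y, ∀ b : Set X, b ∈ B ↔ e '' b ∈ B'

/-- A unital in a finite projective plane of order `q ^ 2` (points `P`, lines `L`): a set of
`q ^ 3 + 1` points that meets every line in either one or `q + 1` points. -/
structure IsUnital {P : Type*} (L : Type*) [Membership P L] [Configuration.ProjectivePlane P L]
    (q : ℕ) (U : Set P) : Prop where
  finite_points : Finite P
  finite_lines : Finite L
  order_eq : Configuration.ProjectivePlane.order P L = q ^ 2
  card_eq : U.ncard = q ^ 3 + 1
  meets_line : ∀ l : L, (U ∩ {p | p ∈ l}).ncard = 1 ∨ (U ∩ {p | p ∈ l}).ncard = q + 1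

/-- The blocks of the design associated with a unital `U`: its point set is `U`, and its blocks
are the intersections of `U` with those lines that meet `U` in `q + 1` points. -/
def unitalBlocks {P : Type*} (L : Type*) [Membership P L] (q : ℕ) (U : Set P) : Set (Set U) :=
  {b | ∃ l : L, (U ∩ {p | p ∈ l}).ncard = q + 1 ∧ b = {x : U | (x : P) ∈ l}}

/-- The design with block collection `B` is (isomorphic to) the unital design associated with a
unital in some projective plane of order `q ^ 2`. -/
def IsEmbeddedUnitalDesign {X : Type*} (q : ℕ) (B : Set (Set X)) : Prop :=
  ∃ (P L : Type) (_ : Membership P L) (_ : Configuration.ProjectivePlane P L) (U : Set P),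
    IsUnital L q U ∧ AreIsomorphic B (unitalBlocks L q U)

/-! ### Kernel-friendly arithmetic -/

/-- Application after evaluation of the argument. The recursor makes the kernel reduce `n` to a
numeral first, so that the resulting application is syntactically canonical and can be cached. -/
noncomputable def strict {α : Type} (n : ℕ) (f : ℕ → α) : α :=
  Nat.rec (f 0) (fun m _ => f (Nat.succ m)) n

theorem strict_eq {α : Type} (n : ℕ) (f : ℕ → α) : strict n f = f n := by
  cases n <;> rfl

/-- The sum of `f` over a list. -/
noncomputable def sumOver (f : ℕ → ℕ) : List ℕ → ℕ :=
  List.rec 0 (fun x _ ih => strict x (fun i => Nat.add (f i) ih))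

theorem sumOver_eq (f : ℕ → ℕ) (L : List ℕ) : sumOver f L = (L.map f).sum := by
  induction L with
  | nil => rfl
  | cons x L ih =>
    change strict x (fun i => Nat.add (f i) (sumOver f L)) = _
    rw [strict_eq, ih]
    simp

theorem sumOver_eq_sum_range (f : ℕ → ℕ) {L : List ℕ} (hL : L.Nodup) {N : ℕ}
    (hN : ∀ x ∈ L, x < N) :
    sumOver f L = ∑ x ∈ Finset.range N, (if x ∈ L then 1 else 0) * f x := by
  rw [sumOver_eq, ← List.sum_toFinset f hL]
  have : L.toFinset = (Finset.range N).filter (· ∈ L) := by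
    ext x
    simp only [List.mem_toFinset, Finset.mem_filter, Finset.mem_range]
    exact ⟨fun h => ⟨hN x h, h⟩, fun h => h.2⟩
  rw [this, Finset.sum_filter]
  simp

/-- The sum of the values of `f` below `n`. -/
noncomputable def sumTo (f : ℕ → ℕ) (n : ℕ) : ℕ :=
  Nat.rec 0 (fun m ih => strict m (fun i => Nat.add (f i) ih)) n

theorem sumTo_eq (f : ℕ → ℕ) (n : ℕ) : sumTo f n = ∑ i ∈ Finset.range n, f i := by
  induction n with
  | zero => rfl
  | succ n ih =>
    change strict n (fun i => Nat.add (f i) (sumTo f n)) = _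
    rw [strict_eq, ih, Finset.sum_range_succ, add_comm]
    rfl

/-- Whether `p` holds below `n`. -/
noncomputable def allTo (p : ℕ → Bool) (n : ℕ) : Bool :=
  Nat.rec true (fun m ih => strict m (fun i => Bool.rec false ih (p i))) n

theorem allTo_iff (p : ℕ → Bool) (n : ℕ) : allTo p n = true ↔ ∀ i < n, p i = true := by
  induction n with
  | zero => simp [allTo]
  | succ n ih =>
    change strict n (fun i => Bool.rec false (allTo p n) (p i)) = true ↔ _
    rw [strict_eq]
    constructor
    · intro h i hi
      cases hp : p n with
      | false => simp [hp] at h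
      | true =>
        rcases Nat.lt_succ_iff_lt_or_eq.1 hi with hi | rfl
        · exact ih.1 (by simpa [hp] using h) i hi
        · exact hp
    · intro h
      rw [h n n.lt_succ_self]
      exact ih.2 fun i hi => h i (hi.trans n.lt_succ_self)

/-- Whether `p` holds on a list. -/
noncomputable def allOver (p : ℕ → Bool) : List ℕ → Bool :=
  List.rec true (fun x _ ih => strict x (fun i => Bool.rec false ih (p i)))

theorem allOver_iff (p : ℕ → Bool) (L : List ℕ) : allOver p L = true ↔ ∀ i ∈ L, p i = true := by
  induction L with
  | nil => simp [allOver]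
  | cons x L ih =>
    change strict x (fun i => Bool.rec false (allOver p L) (p i)) = true ↔ _
    rw [strict_eq, List.forall_mem_cons, ← ih]
    cases p x <;> simp

/-- The sublist on which `p` holds. -/
noncomputable def filterBy (p : ℕ → Bool) : List ℕ → List ℕ :=
  List.rec [] (fun x _ ih => Bool.rec ih (List.cons x ih) (p x))

theorem filterBy_eq (p : ℕ → Bool) (L : List ℕ) : filterBy p L = L.filter p := by
  induction L with
  | nil => rfl
  | cons x L ih =>
    rw [List.filter_cons, ← ih, filterBy]
    dsimp only
    cases p x <;> rfl

/-- The bit of `n` at position `i`. -/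
def bitAt (n i : ℕ) : Bool := Nat.beq (Nat.land (Nat.shiftRight n i) 1) 1

theorem bitAt_eq (n i : ℕ) : bitAt n i = n.testBit i := by
  change Nat.beq ((n >>> i) &&& 1) 1 = _
  rw [Nat.testBit_eq_decide_div_mod_eq, Nat.shiftRight_eq_div_pow, Nat.and_one_is_mod]
  rcases Nat.mod_two_eq_zero_or_one (n / 2 ^ i) with h | h <;> rw [h] <;> rfl

/-- The number with set bits at the positions in a list. -/
noncomputable def maskOf : List ℕ → ℕ := List.rec 0 (fun x _ ih => Nat.lor (Nat.pow 2 x) ih)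

theorem bitAt_maskOf (L : List ℕ) (i : ℕ) : bitAt (maskOf L) i = true ↔ i ∈ L := by
  rw [bitAt_eq]
  induction L with
  | nil => simp [maskOf]
  | cons x L ih =>
    change Nat.testBit (2 ^ x ||| maskOf L) i = true ↔ _
    rw [Nat.testBit_or, Bool.or_eq_true, ih, Nat.testBit_two_pow]
    simp [eq_comm]

/-- Whether a list is strictly increasing with entries in `[lo, N)`. -/
noncomputable def increasingIn (N : ℕ) : List ℕ → ℕ → Bool :=
  List.rec (fun _ => true) (fun x _ ih lo =>
    Bool.rec false (Bool.rec false (ih (Nat.succ x)) (Nat.ble (Nat.succ x) N)) (Nat.ble lo x))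

theorem increasingIn_cons (N x : ℕ) (L : List ℕ) (lo : ℕ) :
    increasingIn N (x :: L) lo = true ↔ lo ≤ x ∧ x < N ∧ increasingIn N L (x + 1) = true := by
  change Bool.rec false (Bool.rec false (increasingIn N L (x + 1)) (Nat.ble (x + 1) N))
    (Nat.ble lo x) = true ↔ _
  rw [← Nat.ble_eq, ← Nat.succ_le_iff, ← Nat.ble_eq]
  cases Nat.ble lo x <;> cases Nat.ble (x + 1) N <;> simp

theorem increasingIn.bounds {N : ℕ} {L : List ℕ} {lo : ℕ} (h : increasingIn N L lo = true) :
    ∀ x ∈ L, lo ≤ x ∧ x < N := by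
  induction L generalizing lo with
  | nil => simp
  | cons x L ih =>
    rw [increasingIn_cons] at h
    rw [List.forall_mem_cons]
    exact ⟨⟨h.1, h.2.1⟩, fun y hy => ⟨by have := (ih h.2.2 y hy).1; omega, (ih h.2.2 y hy).2⟩⟩

theorem increasingIn.nodup {N : ℕ} {L : List ℕ} {lo : ℕ} (h : increasingIn N L lo = true) :
    L.Nodup := by
  induction L generalizing lo with
  | nil => simp
  | cons x L ih =>
    rw [increasingIn_cons] at h
    exact List.nodup_cons.2 ⟨fun hx => by have := (increasingIn.bounds h.2.2 x hx).1; omega,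
      ih h.2.2⟩

/-! ### Digit sums -/

theorem sum_digits_lt {w N : ℕ} {f : ℕ → ℕ} (hf : ∀ i < N, f i < 2 ^ w) :
    ∑ i ∈ Finset.range N, f i * 2 ^ (w * i) < 2 ^ (w * N) := by
  induction N with
  | zero => simp
  | succ N ih =>
    rw [Finset.sum_range_succ]
    have h1 := ih fun i hi => hf i (hi.trans N.lt_succ_self)
    have h2 := Nat.mul_le_mul_right (2 ^ (w * N)) (Nat.succ_le_of_lt (hf N N.lt_succ_self))
    rw [Nat.succ_mul, ← pow_add] at h2
    rw [mul_add, mul_one, add_comm (w * N)]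
    omega

theorem land_add_two_pow_mul {k a b c d : ℕ} (ha : a < 2 ^ k) (hc : c < 2 ^ k) :
    (a + b * 2 ^ k) &&& (c + d * 2 ^ k) = (a &&& c) + (b &&& d) * 2 ^ k := by
  have hac : a &&& c < 2 ^ k := Nat.and_lt_two_pow _ hc
  apply Nat.eq_of_testBit_eq
  intro i
  rw [add_comm a, add_comm c, add_comm (a &&& c), mul_comm b, mul_comm d, mul_comm (b &&& d),
    Nat.testBit_and, Nat.testBit_two_pow_mul_add _ ha, Nat.testBit_two_pow_mul_add _ hc,
    Nat.testBit_two_pow_mul_add _ hac]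
  split_ifs <;> simp

theorem land_sum_digits {w N : ℕ} {f g : ℕ → ℕ} (hf : ∀ i < N, f i < 2 ^ w)
    (hg : ∀ i < N, g i < 2 ^ w) :
    (∑ i ∈ Finset.range N, f i * 2 ^ (w * i)) &&& (∑ i ∈ Finset.range N, g i * 2 ^ (w * i)) =
      ∑ i ∈ Finset.range N, (f i &&& g i) * 2 ^ (w * i) := by
  induction N with
  | zero => simp
  | succ N ih =>
    have hf' : ∀ i < N, f i < 2 ^ w := fun i hi => hf i (hi.trans N.lt_succ_self)
    have hg' : ∀ i < N, g i < 2 ^ w := fun i hi => hg i (hi.trans N.lt_succ_self)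
    simp only [Finset.sum_range_succ]
    rw [land_add_two_pow_mul (sum_digits_lt hf') (sum_digits_lt hg'), ih hf' hg']

theorem sum_digits_inj {w N : ℕ} {f g : ℕ → ℕ} (hf : ∀ i < N, f i < 2 ^ w)
    (hg : ∀ i < N, g i < 2 ^ w)
    (h : ∑ i ∈ Finset.range N, f i * 2 ^ (w * i) = ∑ i ∈ Finset.range N, g i * 2 ^ (w * i)) :
    ∀ i < N, f i = g i := by
  induction N with
  | zero => simp
  | succ N ih =>
    have hf' : ∀ i < N, f i < 2 ^ w := fun i hi => hf i (hi.trans N.lt_succ_self)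
    have hg' : ∀ i < N, g i < 2 ^ w := fun i hi => hg i (hi.trans N.lt_succ_self)
    simp only [Finset.sum_range_succ] at h
    have h1 := congrArg (· % 2 ^ (w * N)) h
    have h2 := congrArg (· / 2 ^ (w * N)) h
    simp only [Nat.add_mul_mod_self_right, Nat.mod_eq_of_lt (sum_digits_lt hf'),
      Nat.mod_eq_of_lt (sum_digits_lt hg')] at h1
    simp only [Nat.add_mul_div_right _ _ (Nat.two_pow_pos (w * N)),
      Nat.div_eq_of_lt (sum_digits_lt hf'), Nat.div_eq_of_lt (sum_digits_lt hg'), zero_add] at h2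
    intro i hi
    rcases Nat.lt_succ_iff_lt_or_eq.1 hi with hi | rfl
    · exact ih hf' hg' h1 i hi
    · exact h2

theorem two_pow_mul_modEq (w i : ℕ) : 2 ^ (w * i) ≡ 1 [MOD 2 ^ w - 1] := by
  have : 2 ^ w ≡ 1 [MOD 2 ^ w - 1] := by
    have h := Nat.one_le_two_pow (n := w)
    exact ((Nat.modEq_iff_dvd' h).2 dvd_rfl).symm
  simpa [pow_mul] using this.pow i

theorem land_two (x : ℕ) : x &&& 2 = 2 * if x.testBit 1 then 1 else 0 := by
  apply Nat.eq_of_testBit_eq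
  intro i
  have h2 : Nat.testBit 2 i = decide (1 = i) := Nat.testBit_two_pow (n := 1)
  rw [Nat.testBit_and, h2]
  by_cases hi : 1 = i
  · subst hi
    cases h : x.testBit 1
    · simp
    · simp
      rfl
  · split_ifs <;> simp [h2, hi]

/-! ### Incidence tables of planes of order sixteen -/

/-- The number with the entries of a list of rows as its digits in base `10 ^ 51`. -/
noncomputable def packRows : List ℕ → ℕ :=
  List.rec 0 (fun x _ ih => Nat.add (Nat.mul ih (Nat.pow 10 51)) x)

/-- The seventeen digits in base `1000`, from left to right, of a row of at most `51` decimals. -/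
noncomputable def splitRow (row : ℕ) : List ℕ :=
  Nat.rec [] (fun j ih => List.cons (Nat.mod (Nat.div row (Nat.pow 10 (Nat.mul 3 j))) 1000) ih) 17

/-- An incidence table of a plane of order sixteen, with points and lines labelled by the numbers
below `273`. There is a row for each line, in which the three-digit labels of its points are
concatenated, and a row for each point, in which those of the lines through it are. -/
structure IncidenceTable where
  lineRows : List ℕ
  pointRows : List ℕ

namespace IncidenceTable

/-- The entry of a list of rows at position `i`, split into labels. -/
noncomputable def rowAt (rows : List ℕ) (i : ℕ) : List ℕ :=
  splitRow (Nat.mod (Nat.div (packRows rows) (Nat.pow 10 (Nat.mul 51 i))) (Nat.pow 10 51))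

theorem length_rowAt (rows : List ℕ) (i : ℕ) : (rowAt rows i).length = 17 := rfl

/-- The points on the line `l`. -/
noncomputable def line (t : IncidenceTable) (l : ℕ) : List ℕ := rowAt t.lineRows l

/-- The lines through the point `p`. -/
noncomputable def pencil (t : IncidenceTable) (p : ℕ) : List ℕ := rowAt t.pointRows p

/-- The table with the roles of points and lines exchanged. -/
def dual (t : IncidenceTable) : IncidenceTable := ⟨t.pointRows, t.lineRows⟩

/-- The lines through the point `p`, as a number with digits zero and one in base `2 ^ 13`. -/
noncomputable def pencilCode (t : IncidenceTable) (p : ℕ) : ℕ :=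
  sumOver (fun l => Nat.pow 2 (Nat.mul 13 l)) (t.pencil p)

/-- The lines through the point `p`, as a bit mask. -/
noncomputable def pencilMask (t : IncidenceTable) (p : ℕ) : ℕ := maskOf (t.pencil p)

/-- The number all of whose `273` digits in base `2 ^ 13` are one. -/
noncomputable def repunit : ℕ := sumTo (fun l => Nat.pow 2 (Nat.mul 13 l)) 273

/-- The points on each line are listed in increasing order, and the table of pencils lists
all incidences in the table of lines. -/
noncomputable def isConsistent (t : IncidenceTable) : Bool :=
  allTo (fun l => Bool.rec false (allOver (fun p => bitAt (t.pencilMask p) l) (t.line l))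
    (increasingIn 273 (t.line l) 0)) 273

/-- Each line meets each other line in exactly one point. -/
noncomputable def linesMeetOnce (t : IncidenceTable) : Bool :=
  allTo (fun l => Nat.beq (sumOver t.pencilCode (t.line l))
    (Nat.add repunit (Nat.mul 16 (Nat.pow 2 (Nat.mul 13 l))))) 273

/-- The table describes a projective plane. -/
structure IsPlane (t : IncidenceTable) : Prop where
  consistent : t.isConsistent = true
  consistent_dual : t.dual.isConsistent = true
  linesMeetOnce : t.linesMeetOnce = true
  linesMeetOnce_dual : t.dual.linesMeetOnce = true

variable {t : IncidenceTable}

theorem IsPlane.dual (h : t.IsPlane) : t.dual.IsPlane :=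
  ⟨h.2, h.1, h.4, h.3⟩

theorem IsPlane.increasing (h : t.IsPlane) {l : ℕ} (hl : l < 273) :
    increasingIn 273 (t.line l) 0 = true := by
  have := (allTo_iff _ _).1 h.consistent l hl
  cases hi : increasingIn 273 (t.line l) 0 with
  | false => simp [hi] at this
  | true => rfl

theorem IsPlane.nodup_line (h : t.IsPlane) {l : ℕ} (hl : l < 273) : (t.line l).Nodup :=
  increasingIn.nodup (h.increasing hl)

theorem IsPlane.nodup_pencil (h : t.IsPlane) {p : ℕ} (hp : p < 273) : (t.pencil p).Nodup :=
  h.dual.nodup_line hp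

theorem IsPlane.lt_of_mem_line (h : t.IsPlane) {l p : ℕ} (hl : l < 273) (hp : p ∈ t.line l) :
    p < 273 :=
  (increasingIn.bounds (h.increasing hl) p hp).2

theorem IsPlane.lt_of_mem_pencil (h : t.IsPlane) {l p : ℕ} (hp : p < 273) (hl : l ∈ t.pencil p) :
    l < 273 :=
  h.dual.lt_of_mem_line hp hl

theorem IsPlane.mem_pencil_of_mem_line (h : t.IsPlane) {l p : ℕ} (hl : l < 273)
    (hp : p ∈ t.line l) : l ∈ t.pencil p := by
  have := (allTo_iff _ _).1 h.consistent l hl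
  rw [h.increasing hl] at this
  exact (bitAt_maskOf _ _).1 ((allOver_iff _ _).1 this p hp)

theorem IsPlane.mem_pencil_iff (h : t.IsPlane) {l p : ℕ} (hl : l < 273) (hp : p < 273) :
    l ∈ t.pencil p ↔ p ∈ t.line l :=
  ⟨h.dual.mem_pencil_of_mem_line hp, h.mem_pencil_of_mem_line hl⟩

theorem IsPlane.pencilCode_eq (h : t.IsPlane) {p : ℕ} (hp : p < 273) :
    t.pencilCode p = ∑ l ∈ Finset.range 273, (if p ∈ t.line l then 1 else 0) * 2 ^ (13 * l) := by
  rw [pencilCode, sumOver_eq_sum_range _ (h.nodup_pencil hp) fun x hx => h.lt_of_mem_pencil hp hx]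
  refine Finset.sum_congr rfl fun l hl => ?_
  simp only [h.mem_pencil_iff (Finset.mem_range.1 hl) hp]
  rfl

theorem repunit_eq : repunit = ∑ l ∈ Finset.range 273, 1 * 2 ^ (13 * l) := by
  rw [repunit, sumTo_eq]
  exact Finset.sum_congr rfl fun l _ => (one_mul _).symm

theorem IsPlane.card_inter (h : t.IsPlane) {l m : ℕ} (hl : l < 273) (hm : m < 273) (hlm : l ≠ m) :
    ((t.line l).filter (· ∈ t.line m)).length = 1 := by
  have h1 := Nat.eq_of_beq_eq_true ((allTo_iff _ _).1 h.linesMeetOnce l hl)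
  change _ = repunit + 16 * 2 ^ (13 * l) at h1
  have h2 : sumOver t.pencilCode (t.line l) = ∑ m ∈ Finset.range 273,
      ((t.line l).filter (· ∈ t.line m)).length * 2 ^ (13 * m) := by
    have : ∀ L : List ℕ, (∀ p ∈ L, p < 273) → sumOver t.pencilCode L =
        ∑ m ∈ Finset.range 273, (L.filter (· ∈ t.line m)).length * 2 ^ (13 * m) := by
      intro L hL
      induction L with
      | nil => simp [sumOver_eq]
      | cons p L ih =>
        rw [List.forall_mem_cons] at hL
        have := ih hL.2
        rw [sumOver_eq] at this ⊢
        rw [List.map_cons, List.sum_cons, this, h.pencilCode_eq hL.1, ← Finset.sum_add_distrib]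
        refine Finset.sum_congr rfl fun m _ => ?_
        rw [← add_mul, List.filter_cons]
        by_cases hp : p ∈ t.line m <;> simp [hp, add_comm]
    exact this _ fun p hp => h.lt_of_mem_line hl hp
  have h3 : repunit + 16 * 2 ^ (13 * l) = ∑ m ∈ Finset.range 273,
      (1 + if m = l then 16 else 0) * 2 ^ (13 * m) := by
    simp only [add_mul, Finset.sum_add_distrib, ← repunit_eq, ite_mul, zero_mul]
    rw [Finset.sum_ite_eq' (Finset.range 273), if_pos (Finset.mem_range.2 hl)]
  rw [h2, h3] at h1
  have h4 := sum_digits_inj (fun m _ => ?_) (fun m _ => ?_) h1 m hm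
  · simpa [hlm.symm] using h4
  · exact (List.length_filter_le _ _).trans_lt (by rw [line, length_rowAt]; norm_num)
  · split_ifs <;> norm_num

theorem IsPlane.exists_mem_line (h : t.IsPlane) {l m : ℕ} (hl : l < 273) (hm : m < 273)
    (hlm : l ≠ m) : ∃ p < 273, p ∈ t.line l ∧ p ∈ t.line m := by
  obtain ⟨p, hp⟩ := List.length_eq_one_iff.1 (h.card_inter hl hm hlm)
  have : p ∈ (t.line l).filter (· ∈ t.line m) := hp ▸ List.mem_singleton.2 rfl
  simp only [List.mem_filter, decide_eq_true_eq] at this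
  exact ⟨p, h.lt_of_mem_line hl this.1, this⟩

theorem IsPlane.eq_of_mem_line (h : t.IsPlane) {l m p q : ℕ} (hl : l < 273) (hm : m < 273)
    (hlm : l ≠ m) (hpl : p ∈ t.line l) (hpm : p ∈ t.line m) (hql : q ∈ t.line l)
    (hqm : q ∈ t.line m) : p = q := by
  obtain ⟨r, hr⟩ := List.length_eq_one_iff.1 (h.card_inter hl hm hlm)
  have h1 : p ∈ (t.line l).filter (· ∈ t.line m) := by simp [hpl, hpm]
  have h2 : q ∈ (t.line l).filter (· ∈ t.line m) := by simp [hql, hqm]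
  rw [hr, List.mem_singleton] at h1 h2
  rw [h1, h2]

/-- The points of the plane described by a table. -/
def Point (_ : IncidenceTable) : Type := Fin 273

/-- The lines of the plane described by a table. -/
def Line (_ : IncidenceTable) : Type := Fin 273

instance : Membership t.Point t.Line := ⟨fun l p => p.val ∈ t.line l.val⟩

instance : Fintype t.Point := inferInstanceAs (Fintype (Fin 273))

instance : Fintype t.Line := inferInstanceAs (Fintype (Fin 273))

theorem exists_notMem (t : IncidenceTable) (l : ℕ) (s : Finset ℕ) (hs : s.card ≤ 17) :
    ∃ p : Fin 273, p.val ∉ t.line l ∧ p.val ∉ s := by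
  by_contra! hall
  have h1 : Finset.range 273 ⊆ (t.line l).toFinset ∪ s := by
    intro p hp
    rw [Finset.mem_union, List.mem_toFinset]
    exact or_iff_not_imp_left.2 fun hpl => hall ⟨p, Finset.mem_range.1 hp⟩ hpl
  have h2 := Finset.card_le_card h1
  have h3 := Finset.card_union_le (t.line l).toFinset s
  have h4 := (t.line l).toFinset_card_le
  rw [line, length_rowAt] at h4
  rw [Finset.card_range] at h2
  rw [line] at h2 h3
  omega

theorem IsPlane.eq_or_eq (h : t.IsPlane) {p q : t.Point} {l m : t.Line} (hpl : p ∈ l) (hql : q ∈ l)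
    (hpm : p ∈ m) (hqm : q ∈ m) : p = q ∨ l = m := by
  by_cases hlm : l.val = m.val
  · exact Or.inr (Fin.ext hlm)
  · exact Or.inl (Fin.ext (h.eq_of_mem_line l.isLt m.isLt hlm hpl hpm hql hqm))

theorem IsPlane.exists_line_through (h : t.IsPlane) {p q : t.Point} (hpq : p ≠ q) :
    ∃ l : t.Line, p ∈ l ∧ q ∈ l := by
  obtain ⟨l, hl, hp, hq⟩ := h.dual.exists_mem_line p.isLt q.isLt fun e => hpq (Fin.ext e)
  exact ⟨⟨l, hl⟩, (h.mem_pencil_iff hl p.isLt).1 hp, (h.mem_pencil_iff hl q.isLt).1 hq⟩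

theorem IsPlane.exists_common_point (h : t.IsPlane) {l m : t.Line} (hlm : l ≠ m) :
    ∃ p : t.Point, p ∈ l ∧ p ∈ m := by
  obtain ⟨p, hp, hl, hm⟩ := h.exists_mem_line l.isLt m.isLt fun e => hlm (Fin.ext e)
  exact ⟨⟨p, hp⟩, hl, hm⟩

theorem IsPlane.exists_config (h : t.IsPlane) :
    ∃ (p₁ p₂ p₃ : t.Point) (l₁ l₂ l₃ : t.Line),
      p₁ ∉ l₂ ∧ p₁ ∉ l₃ ∧ p₂ ∉ l₁ ∧ p₂ ∈ l₂ ∧ p₂ ∈ l₃ ∧ p₃ ∉ l₁ ∧ p₃ ∈ l₂ ∧ p₃ ∉ l₃ := by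
  obtain ⟨l₂⟩ : Nonempty t.Line := ⟨(0 : Fin 273)⟩
  obtain ⟨a, ha, -⟩ := t.exists_notMem l₂.val ∅ (by simp)
  have hcard : 2 < (t.line l₂.val).toFinset.card := by
    rw [List.toFinset_card_of_nodup (h.nodup_line l₂.isLt), line, length_rowAt]
    norm_num
  obtain ⟨x, y, z, hx, hy, hz, hxy, hxz, hyz⟩ := Finset.two_lt_card_iff.1 hcard
  rw [List.mem_toFinset] at hx hy hz
  let x' : t.Point := ⟨x, h.lt_of_mem_line l₂.isLt hx⟩
  let y' : t.Point := ⟨y, h.lt_of_mem_line l₂.isLt hy⟩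
  let z' : t.Point := ⟨z, h.lt_of_mem_line l₂.isLt hz⟩
  let a' : t.Point := a
  have key : ∀ u : t.Point, u ∈ l₂ → ∃ l : t.Line, u ∈ l ∧ a' ∈ l ∧ l ≠ l₂ := by
    intro u hu
    obtain ⟨l, hl⟩ := h.exists_line_through (p := u) (q := a')
      (by rintro rfl; exact ha hu)
    exact ⟨l, hl.1, hl.2, by rintro rfl; exact ha hl.2⟩
  have off : ∀ (u v : t.Point) (l : t.Line), u ∈ l₂ → v ∈ l₂ → u ≠ v → l ≠ l₂ → u ∈ l → v ∉ l :=
    fun u v l hu hv huv hl hul hvl => (h.eq_or_eq hul hvl hu hv).elim huv hl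
  have hxy' : x' ≠ y' := fun e => hxy (congrArg Fin.val e)
  have hxz' : x' ≠ z' := fun e => hxz (congrArg Fin.val e)
  have hyz' : y' ≠ z' := fun e => hyz (congrArg Fin.val e)
  obtain ⟨l₁, hzl, -, hl₁⟩ := key z' hz
  obtain ⟨l₃, hxl, -, hl₃⟩ := key x' hx
  obtain ⟨p, hp, hp'⟩ := t.exists_notMem l₂.val (t.line l₃.val).toFinset
    ((List.toFinset_card_le _).trans (by rw [line, length_rowAt]))
  rw [List.mem_toFinset] at hp'
  exact ⟨p, x', y', l₁, l₂, l₃, hp, hp', off z' x' l₁ hz hx hxz'.symm hl₁ hzl, hx, hxl,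
    off z' y' l₁ hz hy hyz'.symm hl₁ hzl, hy, off x' y' l₃ hx hy hxy' hl₃ hxl⟩

/-- The projective plane described by a table. -/
@[reducible]
noncomputable def IsPlane.projectivePlane (h : t.IsPlane) :
    Configuration.ProjectivePlane t.Point t.Line where
  exists_point l := (t.exists_notMem l.val ∅ (by simp)).imp fun _ hp => hp.1
  exists_line p := (t.dual.exists_notMem p.val ∅ (by simp)).imp fun l hl hp =>
    hl.1 (h.mem_pencil_of_mem_line l.isLt hp)
  eq_or_eq := h.eq_or_eq
  mkPoint hlm := (h.exists_common_point hlm).choose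
  mkPoint_ax hlm := (h.exists_common_point hlm).choose_spec
  mkLine hpq := (h.exists_line_through hpq).choose
  mkLine_ax hpq := (h.exists_line_through hpq).choose_spec
  exists_config := h.exists_config

theorem IsPlane.order_eq (h : t.IsPlane) :
    let := h.projectivePlane
    Configuration.ProjectivePlane.order t.Point t.Line = 16 := by
  let := h.projectivePlane
  have h1 := Configuration.ProjectivePlane.card_points t.Point t.Line
  have h2 : Fintype.card t.Point = 273 := Fintype.card_fin 273
  rw [h2] at h1
  nlinarith

end IncidenceTable

/-! ### Designs and isomorphisms -/

theorem AreIsomorphic.symm {X Y : Type*} {B : Set (Set X)} {B' : Set (Set Y)}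
    (h : AreIsomorphic B B') : AreIsomorphic B' B := by
  obtain ⟨e, he⟩ := h
  exact ⟨e.symm, fun b => by rw [he, Equiv.image_symm_image]⟩

theorem AreIsomorphic.trans {X Y Z : Type*} {B : Set (Set X)} {B' : Set (Set Y)}
    {B'' : Set (Set Z)} (h : AreIsomorphic B B') (h' : AreIsomorphic B' B'') :
    AreIsomorphic B B'' := by
  obtain ⟨e, he⟩ := h
  obtain ⟨f, hf⟩ := h'
  exact ⟨e.trans f, fun b => by rw [he, hf, Equiv.coe_trans, Set.image_comp]⟩

theorem IsDesign.of_areIsomorphic {X Y : Type*} {t v k lam : ℕ} {B : Set (Set X)}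
    {B' : Set (Set Y)} (h : AreIsomorphic B B') (hB' : IsDesign t v k lam B') :
    IsDesign t v k lam B := by
  obtain ⟨e, he⟩ := h
  have := hB'.finite_points
  refine ⟨Finite.of_equiv _ e.symm, ?_, ?_, ?_⟩
  · rw [Nat.card_congr e, hB'.card_points]
  · intro b hb
    rw [← hB'.card_block _ ((he b).1 hb), Set.ncard_image_of_injective _ e.injective]
  · intro T hT
    rw [← hB'.balanced (e '' T) (by rw [Set.ncard_image_of_injective _ e.injective, hT]),
      ← Set.ncard_image_of_injective _ (Equiv.Set.congr e).injective]
    congr 1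
    ext b
    simp only [Set.mem_image, Set.mem_ofPred_eq, Equiv.Set.congr_apply]
    constructor
    · rintro ⟨c, ⟨hc, hTc⟩, rfl⟩
      exact ⟨(he c).1 hc, Set.image_mono hTc⟩
    · rintro ⟨hb, hTb⟩
      refine ⟨e.symm '' b, ⟨(he _).2 (by rwa [Equiv.image_symm_image] at *), ?_⟩, ?_⟩
      · rintro x hx
        exact ⟨e x, hTb ⟨x, hx, rfl⟩, e.symm_apply_apply x⟩
      · rw [Equiv.image_symm_image]

section Unital

open Configuration

variable {P : Type*} {L : Type*} [Membership P L] {q : ℕ} {U : Set P}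

/-- The points of `U` on a line. -/
def lineTrace (U : Set P) (l : L) : Set U := {x | (x : P) ∈ l}

theorem ncard_lineTrace (l : L) : (lineTrace U l).ncard = (U ∩ {p | p ∈ l}).ncard := by
  rw [← Set.ncard_image_of_injective _ Subtype.val_injective]
  congr 1
  ext p
  simp [lineTrace, and_comm]

theorem mem_unitalBlocks {b : Set U} :
    b ∈ unitalBlocks L q U ↔ ∃ l : L, (lineTrace U l).ncard = q + 1 ∧ b = lineTrace U l := by
  simp only [unitalBlocks, ← ncard_lineTrace, Set.mem_ofPred_eq]
  rfl

variable [ProjectivePlane P L]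

theorem IsUnital.isDesign (h : IsUnital L q U) :
    IsDesign 2 (q ^ 3 + 1) (q + 1) 1 (unitalBlocks L q U) := by
  have := h.finite_points
  refine ⟨inferInstance, h.card_eq, ?_, ?_⟩
  · intro b hb
    obtain ⟨l, hl, rfl⟩ := mem_unitalBlocks.1 hb
    exact hl
  · intro T hT
    obtain ⟨x, y, hxy, rfl⟩ := Set.ncard_eq_two.1 hT
    have hxy' : (x : P) ≠ y := fun e => hxy (Subtype.ext e)
    rw [Set.ncard_eq_one]
    refine ⟨lineTrace U (HasLines.mkLine hxy' : L), ?_⟩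
    obtain ⟨hx, hy⟩ := HasLines.mkLine_ax (L := L) hxy'
    ext b
    rw [Set.mem_singleton_iff, Set.mem_ofPred_eq, Set.pair_subset_iff, mem_unitalBlocks]
    constructor
    · rintro ⟨⟨l, -, rfl⟩, hxl, hyl⟩
      rw [(Nondegenerate.eq_or_eq hx hy hxl hyl).resolve_left hxy']
    · rintro rfl
      refine ⟨⟨_, ?_, rfl⟩, hx, hy⟩
      rw [ncard_lineTrace]
      refine (h.meets_line _).resolve_left fun h1 => hxy' ?_
      obtain ⟨z, hz⟩ := Set.ncard_eq_one.1 h1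
      have hx' := hz.subset ⟨x.2, hx⟩
      have hy' := hz.subset ⟨y.2, hy⟩
      rw [Set.mem_singleton_iff] at hx' hy'
      rw [hx', hy']

/-- Each point of `U` is on exactly one line meeting `U` in one point. -/
def HasUniqueTangents (L : Type*) [Membership P L] (U : Set P) : Prop :=
  ∀ x : U, ∃! l : L, lineTrace U l = {x}

theorem IsUnital.range_lineTrace (h : IsUnital L q U) (ht : HasUniqueTangents L U) (s : Set U) :
    s ∈ Set.range (lineTrace (L := L) U) ↔ s ∈ unitalBlocks L q U ∨ ∃ x, s = {x} := by
  constructor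
  · rintro ⟨l, rfl⟩
    have hl := h.meets_line l
    rw [← ncard_lineTrace] at hl
    rcases hl with hl | hl
    · exact Or.inr (Set.ncard_eq_one.1 hl)
    · exact Or.inl (mem_unitalBlocks.2 ⟨l, hl, rfl⟩)
  · rintro (hs | ⟨x, rfl⟩)
    · obtain ⟨l, -, rfl⟩ := mem_unitalBlocks.1 hs
      exact ⟨l, rfl⟩
    · exact (ht x).exists

theorem IsUnital.injective_lineTrace (h : IsUnital L q U) (ht : HasUniqueTangents L U)
    (hq : 0 < q) : Function.Injective (lineTrace (L := L) U) := by
  intro l m hlm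
  have hl := h.meets_line l
  rw [← ncard_lineTrace] at hl
  rcases hl with hl | hl
  · obtain ⟨x, hx⟩ := Set.ncard_eq_one.1 hl
    exact (ht x).unique hx (hlm ▸ hx)
  · obtain ⟨x, y, hx, hy, hxy⟩ := (Set.one_lt_ncard_iff (Set.finite_of_ncard_ne_zero (by omega))).1
      (show 1 < (lineTrace U l).ncard by omega)
    have hx' : x ∈ lineTrace U m := hlm ▸ hx
    have hy' : y ∈ lineTrace U m := hlm ▸ hy
    exact (Nondegenerate.eq_or_eq (L := L) hx hy hx' hy').resolve_left fun e => hxy (Subtype.ext e)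

theorem AreIsomorphic.exists_line_equiv {P' : Type*} {L' : Type*} [Membership P' L']
    [ProjectivePlane P' L'] {U' : Set P'} (hiso : AreIsomorphic (unitalBlocks L q U)
    (unitalBlocks L' q U')) (h : IsUnital L q U) (ht : HasUniqueTangents L U)
    (h' : IsUnital L' q U') (ht' : HasUniqueTangents L' U') (hq : 0 < q) :
    ∃ (e : U ≃ U') (f : L ≃ L'), ∀ (x : U) (l : L), (x : P) ∈ l ↔ (e x : P') ∈ f l := by
  obtain ⟨e, he⟩ := hiso
  have key : ∀ s : Set U, s ∈ Set.range (lineTrace (L := L) U) ↔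
      Equiv.Set.congr e s ∈ Set.range (lineTrace (L := L') U') := by
    intro s
    rw [h.range_lineTrace ht, h'.range_lineTrace ht', he, Equiv.Set.congr_apply]
    refine or_congr Iff.rfl ⟨?_, ?_⟩
    · rintro ⟨x, rfl⟩
      exact ⟨e x, Set.image_singleton⟩
    · rintro ⟨y, hy⟩
      exact ⟨e.symm y, by rw [← Set.image_singleton, ← hy, Equiv.symm_image_image]⟩
  let f : L ≃ L' := (Equiv.ofInjective _ (h.injective_lineTrace ht hq)).trans
    (((Equiv.Set.congr e).subtypeEquiv key).trans
      (Equiv.ofInjective _ (h'.injective_lineTrace ht' hq)).symm)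
  refine ⟨e, f, fun x l => ?_⟩
  have hf : lineTrace U' (f l) = e '' lineTrace U l := by
    have := Equiv.apply_ofInjective_symm (h'.injective_lineTrace ht' hq)
      ((Equiv.Set.congr e).subtypeEquiv key (Equiv.ofInjective _ (h.injective_lineTrace ht hq) l))
    exact this
  change x ∈ lineTrace U l ↔ e x ∈ lineTrace U' (f l)
  rw [hf, Set.mem_image_equiv, Equiv.symm_apply_apply]

end Unital

/-! ### An isomorphism invariant -/

section Invariant

open Classical in
/-- The number of points common to two lines. -/
noncomputable def meetCount {X L : Type*} [Fintype X] (R : X → L → Prop) (l m : L) : ℕ :=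
  ∑ x, if R x l ∧ R x m then 1 else 0

open Classical in
/-- The number of triples consisting of a line through `p`, a point of it on `b`, and a point
of it on `c`. -/
noncomputable def transversalCount {X L : Type*} [Fintype X] [Fintype L] (R : X → L → Prop) (p : X)
    (b c : L) : ℕ :=
  ∑ l, (if R p l then 1 else 0) * (meetCount R b l * meetCount R l c)

/-- The number of triples `p, b, c` for which `transversalCount R p b c` has its second bit set. -/
noncomputable def transversalInvariant {X L : Type*} [Fintype X] [Fintype L] (R : X → L → Prop) :
    ℕ :=
  ∑ b, ∑ p, ∑ c, if (transversalCount R p b c).testBit 1 then 1 else 0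

variable {X L X' L' : Type*} [Fintype X] [Fintype X'] {R : X → L → Prop} {R' : X' → L' → Prop}
  {e : X ≃ X'} {f : L ≃ L'}

theorem meetCount_congr (h : ∀ x l, R x l ↔ R' (e x) (f l)) (l m : L) :
    meetCount R l m = meetCount R' (f l) (f m) := by
  classical
  rw [meetCount, meetCount, ← e.sum_comp]
  exact Finset.sum_congr rfl fun x _ => if_congr (and_congr (h x l) (h x m)) rfl rfl

variable [Fintype L] [Fintype L']

theorem transversalCount_congr (h : ∀ x l, R x l ↔ R' (e x) (f l)) (p : X) (b c : L) :
    transversalCount R p b c = transversalCount R' (e p) (f b) (f c) := by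
  classical
  rw [transversalCount, transversalCount, ← f.sum_comp]
  refine Finset.sum_congr rfl fun l _ => ?_
  rw [meetCount_congr h, meetCount_congr h]
  exact congrArg₂ _ (if_congr (h p l) rfl rfl) rfl

theorem transversalInvariant_congr (h : ∀ x l, R x l ↔ R' (e x) (f l)) :
    transversalInvariant R = transversalInvariant R' := by
  rw [transversalInvariant, transversalInvariant, ← f.sum_comp]
  refine Finset.sum_congr rfl fun b _ => ?_
  rw [← e.sum_comp]
  refine Finset.sum_congr rfl fun p _ => ?_
  rw [← f.sum_comp]
  refine Finset.sum_congr rfl fun c _ => ?_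
  rw [transversalCount_congr h]

end Invariant

/-! ### Unitals in planes described by tables -/

namespace IncidenceTable

/-- The points on the line `l` in the set with mask `U`. -/
noncomputable def trace (t : IncidenceTable) (U l : ℕ) : List ℕ := filterBy (bitAt U) (t.line l)

/-- The number of points on the line `l` in the set with mask `U`. -/
noncomputable def traceSize (t : IncidenceTable) (U l : ℕ) : ℕ := sumOver (fun _ => 1) (t.trace U l)

/-- Each line contains one or five points of the set with mask `U`, and this set has `65`
elements, each of which is on exactly one line of the former kind. -/
noncomputable def isUnitalMask (t : IncidenceTable) (U : ℕ) : Bool :=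
  Nat.beq (sumTo (fun p => (bitAt U p).toNat) 273) 65 &&
    (allTo (fun l => Nat.beq (t.traceSize U l) 1 || Nat.beq (t.traceSize U l) 5) 273 &&
      allTo (fun p => !bitAt U p ||
        Nat.beq (sumOver (fun l => (Nat.beq (t.traceSize U l) 1).toNat) (t.pencil p)) 1) 273)

/-- The numbers of points of `U` common to the line `l` and each line, as digits in base `2 ^ 13`,
repeated in the row of each point of `U` on `l`. -/
noncomputable def lineCode (t : IncidenceTable) (U l : ℕ) : ℕ :=
  Nat.mul (sumOver t.pencilCode (t.trace U l))
    (sumOver (fun p => Nat.pow 2 (Nat.mul 3549 p)) (t.trace U l))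

/-- The sum of the codes of the lines through `p`. -/
noncomputable def starCode (t : IncidenceTable) (U p : ℕ) : ℕ := sumOver (t.lineCode U) (t.pencil p)

/-- The sum of the star codes of the points of `U` on the line `b`. -/
noncomputable def neighborCode (t : IncidenceTable) (U b : ℕ) : ℕ :=
  sumOver (t.starCode U) (t.trace U b)

/-- The number all of whose `273 ^ 2` digits in base `2 ^ 13` are two. -/
noncomputable def digitMask : ℕ :=
  sumTo (fun p => Nat.mul (Nat.mul 2 repunit) (Nat.pow 2 (Nat.mul 3549 p))) 273

/-- The invariant of a unital, doubled and reduced modulo `2 ^ 13 - 1`. -/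
noncomputable def invariantCode (t : IncidenceTable) (U : ℕ) : ℕ :=
  sumTo (fun b => t.neighborCode U b &&& digitMask) 273 % 8191

variable {t : IncidenceTable} {U : ℕ}

/-- The set of points with mask `U`. -/
def pointSet (t : IncidenceTable) (U : ℕ) : Set t.Point := {p | U.testBit p.val = true}

theorem mem_trace {l p : ℕ} : p ∈ t.trace U l ↔ p ∈ t.line l ∧ U.testBit p = true := by
  rw [trace, filterBy_eq, List.mem_filter, bitAt_eq]

theorem IsPlane.nodup_trace (h : t.IsPlane) {l : ℕ} (hl : l < 273) : (t.trace U l).Nodup := by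
  rw [trace, filterBy_eq]
  exact (h.nodup_line hl).filter _

theorem IsPlane.lt_of_mem_trace (h : t.IsPlane) {l : ℕ} (hl : l < 273) :
    ∀ p ∈ t.trace U l, p < 273 :=
  fun _ hp => h.lt_of_mem_line hl (mem_trace.1 hp).1

theorem traceSize_eq (l : ℕ) : t.traceSize U l = (t.trace U l).length := by
  simp [traceSize, sumOver_eq]

theorem ncard_eq_card {S : Set t.Point} {F : Finset ℕ} (hF : ∀ p ∈ F, p < 273)
    (hS : ∀ x : t.Point, x ∈ S ↔ x.val ∈ F) : S.ncard = F.card := by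
  have hinj : Function.Injective fun x : t.Point => x.val := fun _ _ hxy => Fin.ext hxy
  rw [← Set.ncard_image_of_injective S hinj, ← Set.ncard_coe_finset]
  congr 1
  ext p
  constructor
  · rintro ⟨x, hx, rfl⟩
    exact (hS x).1 hx
  · intro hp
    exact ⟨⟨p, hF p hp⟩, (hS _).2 hp, rfl⟩

theorem IsPlane.ncard_inter (h : t.IsPlane) (l : t.Line) :
    (t.pointSet U ∩ {p | p ∈ l}).ncard = t.traceSize U l.val := by
  rw [traceSize_eq, ← List.toFinset_card_of_nodup (h.nodup_trace l.isLt)]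
  refine ncard_eq_card (fun p hp => h.lt_of_mem_trace l.isLt p (List.mem_toFinset.1 hp))
    fun x => ?_
  rw [List.mem_toFinset, mem_trace, and_comm]
  rfl

theorem isUnitalMask_iff : t.isUnitalMask U = true ↔
    (∑ p ∈ Finset.range 273, (U.testBit p).toNat) = 65 ∧
    (∀ l < 273, t.traceSize U l = 1 ∨ t.traceSize U l = 5) ∧
    ∀ p < 273, U.testBit p = true →
      sumOver (fun l => (Nat.beq (t.traceSize U l) 1).toNat) (t.pencil p) = 1 := by
  simp only [isUnitalMask, Bool.and_eq_true, Bool.or_eq_true, allTo_iff, Nat.beq_eq, sumTo_eq,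
    bitAt_eq, Bool.not_eq_true', ← Bool.not_eq_true, ← imp_iff_not_or]

theorem IsPlane.isUnital (h : t.IsPlane) (hU : t.isUnitalMask U = true) :
    let := h.projectivePlane
    IsUnital t.Line 4 (t.pointSet U) := by
  obtain ⟨h1, h2, -⟩ := isUnitalMask_iff.1 hU
  refine @IsUnital.mk _ _ _ h.projectivePlane _ _ (inferInstanceAs (Finite (Fin 273)))
    (inferInstanceAs (Finite (Fin 273))) h.order_eq ?_ ?_
  · refine Eq.trans ?_ h1
    have h3 : ∀ p, (U.testBit p).toNat = if U.testBit p = true then 1 else 0 := fun p => by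
      cases U.testBit p <;> rfl
    simp only [h3]
    rw [← Finset.card_filter]
    refine ncard_eq_card (fun p hp => Finset.mem_range.1 (Finset.mem_filter.1 hp).1) fun x => ?_
    rw [Finset.mem_filter]
    exact (and_iff_right (Finset.mem_range.2 x.isLt)).symm
  · intro l
    rw [h.ncard_inter]
    exact h2 _ l.isLt

theorem IsPlane.lineTrace_eq_singleton_iff (h : t.IsPlane) (x : t.pointSet U) (l : t.Line) :
    lineTrace (t.pointSet U) l = {x} ↔ l.val ∈ t.pencil x.1.val ∧ t.traceSize U l.val = 1 := by
  rw [h.mem_pencil_iff l.isLt x.1.isLt, ← h.ncard_inter, ← ncard_lineTrace]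
  constructor
  · intro hl
    have hx : x ∈ lineTrace (t.pointSet U) l := hl ▸ Set.mem_singleton x
    exact ⟨hx, by rw [hl, Set.ncard_singleton]⟩
  · rintro ⟨hx, hl⟩
    obtain ⟨y, hy⟩ := Set.ncard_eq_one.1 hl
    have hx' : x ∈ lineTrace (t.pointSet U) l := hx
    rw [hy, Set.mem_singleton_iff] at hx'
    rw [hy, hx']

theorem IsPlane.hasUniqueTangents (h : t.IsPlane) (hU : t.isUnitalMask U = true) :
    HasUniqueTangents t.Line (t.pointSet U) := by
  obtain ⟨-, -, h3⟩ := isUnitalMask_iff.1 hU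
  intro x
  have hx := h3 x.1.val x.1.isLt x.2
  have hfilter : ∀ L : List ℕ, sumOver (fun l => (Nat.beq (t.traceSize U l) 1).toNat) L =
      (L.filter fun l => Nat.beq (t.traceSize U l) 1).length := by
    intro L
    rw [sumOver_eq]
    induction L with
    | nil => rfl
    | cons l L ih =>
      rw [List.map_cons, List.sum_cons, ih, List.filter_cons]
      cases Nat.beq (t.traceSize U l) 1 <;> simp [add_comm]
  rw [hfilter] at hx
  obtain ⟨l, hl⟩ := List.length_eq_one_iff.1 hx
  have hmem : ∀ m, m ∈ t.pencil x.1.val ∧ t.traceSize U m = 1 ↔ m = l := by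
    intro m
    rw [← List.mem_singleton (a := m) (b := l), ← hl, List.mem_filter, Nat.beq_eq]
  have hlt : l < 273 := h.lt_of_mem_pencil x.1.isLt ((hmem l).2 rfl).1
  refine ⟨⟨l, hlt⟩, (h.lineTrace_eq_singleton_iff x _).2 ((hmem l).2 rfl), fun m hm => ?_⟩
  exact Fin.ext ((hmem _).1 ((h.lineTrace_eq_singleton_iff x m).1 hm))

/-! ### Evaluation of the invariant -/

/-- The indicator function of incidence. -/
noncomputable def inc (t : IncidenceTable) (p l : ℕ) : ℕ := if p ∈ t.line l then 1 else 0

/-- The indicator function of incidence with a point in `U`. -/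
noncomputable def incIn (t : IncidenceTable) (U p l : ℕ) : ℕ := if p ∈ t.trace U l then 1 else 0

/-- The number of points of `U` common to two lines. -/
noncomputable def meet (t : IncidenceTable) (U b l : ℕ) : ℕ :=
  ∑ p ∈ Finset.range 273, t.incIn U p b * t.inc p l

/-- The digit of `neighborCode t U b` in the row of `p` at the position `c`. -/
noncomputable def digit (t : IncidenceTable) (U b p c : ℕ) : ℕ :=
  ∑ l ∈ Finset.range 273, t.incIn U p l * (t.meet U b l * t.meet U l c)

theorem IsPlane.sumOver_trace (h : t.IsPlane) (f : ℕ → ℕ) {l : ℕ} (hl : l < 273) :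
    sumOver f (t.trace U l) = ∑ p ∈ Finset.range 273, t.incIn U p l * f p :=
  sumOver_eq_sum_range f (h.nodup_trace hl) (h.lt_of_mem_trace hl)

theorem IsPlane.sumOver_pencil (h : t.IsPlane) (f : ℕ → ℕ) {p : ℕ} (hp : p < 273) :
    sumOver f (t.pencil p) = ∑ l ∈ Finset.range 273, t.inc p l * f l := by
  rw [sumOver_eq_sum_range f (h.nodup_pencil hp) fun x hx => h.lt_of_mem_pencil hp hx]
  refine Finset.sum_congr rfl fun l hl => ?_
  simp only [inc, h.mem_pencil_iff (Finset.mem_range.1 hl) hp]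

theorem IsPlane.lineCode_eq (h : t.IsPlane) {l : ℕ} (hl : l < 273) :
    t.lineCode U l = ∑ p ∈ Finset.range 273, (∑ c ∈ Finset.range 273,
      t.incIn U p l * t.meet U l c * 2 ^ (13 * c)) * 2 ^ (3549 * p) := by
  have h1 : sumOver t.pencilCode (t.trace U l) =
      ∑ c ∈ Finset.range 273, t.meet U l c * 2 ^ (13 * c) := by
    rw [h.sumOver_trace _ hl]
    simp only [meet, Finset.sum_mul]
    rw [Finset.sum_comm]
    refine Finset.sum_congr rfl fun p hp => ?_
    rw [h.pencilCode_eq (Finset.mem_range.1 hp), Finset.mul_sum]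
    exact Finset.sum_congr rfl fun c _ => (mul_assoc _ _ _).symm
  change sumOver t.pencilCode (t.trace U l) * sumOver (fun p => 2 ^ (3549 * p)) (t.trace U l) = _
  rw [h1, h.sumOver_trace _ hl, Finset.mul_sum]
  refine Finset.sum_congr rfl fun p _ => ?_
  rw [Finset.sum_mul, Finset.sum_mul]
  refine Finset.sum_congr rfl fun c _ => ?_
  ring

theorem IsPlane.neighborCode_eq (h : t.IsPlane) {b : ℕ} (hb : b < 273) :
    t.neighborCode U b = ∑ p ∈ Finset.range 273, (∑ c ∈ Finset.range 273,
      t.digit U b p c * 2 ^ (13 * c)) * 2 ^ (3549 * p) := by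
  have h1 : t.neighborCode U b = ∑ l ∈ Finset.range 273, t.meet U b l * t.lineCode U l := by
    rw [neighborCode, h.sumOver_trace _ hb]
    simp only [meet, Finset.sum_mul]
    rw [Finset.sum_comm]
    refine Finset.sum_congr rfl fun p hp => ?_
    rw [starCode, h.sumOver_pencil _ (Finset.mem_range.1 hp), Finset.mul_sum]
    exact Finset.sum_congr rfl fun c _ => (mul_assoc _ _ _).symm
  rw [h1]
  have h2 : ∀ l ∈ Finset.range 273, t.meet U b l * t.lineCode U l =
      ∑ p ∈ Finset.range 273, ∑ c ∈ Finset.range 273,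
        t.incIn U p l * (t.meet U b l * t.meet U l c) * 2 ^ (13 * c) * 2 ^ (3549 * p) := by
    intro l hl
    rw [h.lineCode_eq (Finset.mem_range.1 hl), Finset.mul_sum]
    refine Finset.sum_congr rfl fun p _ => ?_
    rw [Finset.sum_mul, Finset.mul_sum]
    refine Finset.sum_congr rfl fun c _ => ?_
    ring
  rw [Finset.sum_congr rfl h2, Finset.sum_comm]
  refine Finset.sum_congr rfl fun p _ => ?_
  rw [Finset.sum_comm, Finset.sum_mul]
  refine Finset.sum_congr rfl fun c _ => ?_
  rw [digit, Finset.sum_mul, Finset.sum_mul]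

theorem digitMask_eq : digitMask = ∑ p ∈ Finset.range 273, (∑ c ∈ Finset.range 273,
    2 * 2 ^ (13 * c)) * 2 ^ (3549 * p) := by
  rw [digitMask, sumTo_eq]
  refine Finset.sum_congr rfl fun p _ => ?_
  rw [Nat.mul_eq, Nat.mul_eq, Nat.mul_eq, Nat.pow_eq, repunit_eq, Finset.mul_sum]
  simp only [one_mul]

theorem IsPlane.meet_le (h : t.IsPlane) (hU : t.isUnitalMask U = true) {b : ℕ} (hb : b < 273)
    (l : ℕ) : t.meet U b l ≤ 5 := by
  have h1 : t.traceSize U b ≤ 5 := by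
    rcases (isUnitalMask_iff.1 hU).2.1 b hb with h1 | h1 <;> omega
  refine le_trans ?_ h1
  rw [traceSize, h.sumOver_trace _ hb, meet]
  refine Finset.sum_le_sum fun p _ => Nat.mul_le_mul_left _ ?_
  rw [inc]
  split_ifs <;> simp

theorem IsPlane.digit_lt (h : t.IsPlane) (hU : t.isUnitalMask U = true) {b : ℕ} (hb : b < 273)
    (p c : ℕ) : t.digit U b p c < 2 ^ 13 := by
  have : t.digit U b p c ≤ ∑ _l ∈ Finset.range 273, 1 * (5 * 5) := by
    refine Finset.sum_le_sum fun l hl => Nat.mul_le_mul ?_ (Nat.mul_le_mul (h.meet_le hU hb l)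
      (h.meet_le hU (Finset.mem_range.1 hl) c))
    rw [incIn]
    split_ifs <;> simp
  refine this.trans_lt ?_
  simp

theorem IsPlane.land_neighborCode (h : t.IsPlane) (hU : t.isUnitalMask U = true) {b : ℕ}
    (hb : b < 273) : t.neighborCode U b &&& digitMask ≡ 2 * ∑ p ∈ Finset.range 273,
      ∑ c ∈ Finset.range 273, (if (t.digit U b p c).testBit 1 then 1 else 0) [MOD 8191] := by
  have hd : ∀ p, ∀ c < 273, t.digit U b p c < 2 ^ 13 := fun p c _ => h.digit_lt hU hb p c
  have h2 : ∀ c < 273, 2 < 2 ^ 13 := fun c _ => by norm_num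
  have hrow : ∀ {f : ℕ → ℕ}, (∀ c < 273, f c < 2 ^ 13) →
      ∑ c ∈ Finset.range 273, f c * 2 ^ (13 * c) < 2 ^ 3549 := fun hf => by
    rw [show 3549 = 13 * 273 by norm_num]
    exact sum_digits_lt hf
  rw [h.neighborCode_eq hb, digitMask_eq, land_sum_digits (fun p _ => hrow (hd p))
    (fun p _ => hrow h2), Finset.mul_sum]
  refine Nat.ModEq.sum fun p _ => ?_
  rw [land_sum_digits (hd p) h2, Finset.mul_sum, Finset.sum_mul]
  refine Nat.ModEq.sum fun c _ => ?_
  rw [land_two]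
  have e1 : 2 ^ (13 * c) ≡ 1 [MOD 8191] := two_pow_mul_modEq 13 c
  have e2 : 2 ^ (3549 * p) ≡ 1 [MOD 8191] := by
    rw [show 3549 * p = 13 * (273 * p) by ring]
    exact two_pow_mul_modEq 13 _
  have e3 := ((Nat.ModEq.refl (2 * if (t.digit U b p c).testBit 1 then 1 else 0)).mul e1).mul e2
  rwa [mul_one, mul_one] at e3

theorem sum_line (f : ℕ → ℕ) : ∑ l : t.Line, f l.val = ∑ l ∈ Finset.range 273, f l :=
  Fin.sum_univ_eq_sum_range f 273

theorem sum_pointSet [Fintype (t.pointSet U)] (f : ℕ → ℕ) :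
    ∑ p : t.pointSet U, f p.1.val =
      ∑ p ∈ Finset.range 273, if U.testBit p then f p else 0 := by
  rw [← Fin.sum_univ_eq_sum_range (fun p => if U.testBit p then f p else 0) 273,
    ← Finset.sum_filter]
  exact (Finset.sum_subtype _ (fun _ => Finset.mem_filter_univ (p := fun p : Fin 273 =>
    U.testBit p.val = true) _) (fun p : Fin 273 => f p.val)).symm

theorem meetCount_eq [Fintype (t.pointSet U)] (b l : t.Line) :
    meetCount (fun (x : t.pointSet U) (l : t.Line) => x.1 ∈ l) b l = t.meet U b.val l.val := by
  classical
  rw [meetCount, meet]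
  refine Eq.trans ?_ (Eq.trans
    (sum_pointSet (t := t) (U := U) (fun p => if p ∈ t.line b.val ∧ p ∈ t.line l.val then 1 else 0)) ?_)
  · refine Finset.sum_congr rfl fun x _ => if_congr Iff.rfl rfl rfl
  · refine Finset.sum_congr rfl fun p _ => ?_
    rw [incIn, inc]
    by_cases h1 : U.testBit p = true <;> by_cases h2 : p ∈ t.line b.val <;>
      by_cases h3 : p ∈ t.line l.val <;> simp [mem_trace, h1, h2, h3]

theorem transversalCount_eq [Fintype (t.pointSet U)] (b c : t.Line) (p : t.pointSet U) :
    transversalCount (fun (x : t.pointSet U) (l : t.Line) => x.1 ∈ l) p b c =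
      t.digit U b.val p.1.val c.val := by
  classical
  rw [transversalCount, digit, ← sum_line]
  refine Finset.sum_congr rfl fun l _ => ?_
  rw [meetCount_eq, meetCount_eq, incIn]
  refine congrArg₂ _ (if_congr ?_ rfl rfl) rfl
  exact (mem_trace.trans (and_iff_left p.2)).symm

theorem digit_eq_zero {p : ℕ} (hp : U.testBit p = false) (b c : ℕ) : t.digit U b p c = 0 := by
  refine Finset.sum_eq_zero fun l _ => ?_
  simp [incIn, mem_trace, hp]

/-- The number of positions in a row at which `digit` has its second bit set. -/
noncomputable def rowCount (t : IncidenceTable) (U b p : ℕ) : ℕ :=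
  ∑ c ∈ Finset.range 273, if (t.digit U b p c).testBit 1 then 1 else 0

theorem rowCount_eq_zero {p : ℕ} (hp : U.testBit p = false) (b : ℕ) : t.rowCount U b p = 0 := by
  refine Finset.sum_eq_zero fun c _ => ?_
  rw [digit_eq_zero hp, Nat.zero_testBit]
  rfl

theorem sum_transversalCount [Fintype (t.pointSet U)] (b : t.Line) (p : t.pointSet U) :
    (∑ c : t.Line, if (transversalCount (fun (x : t.pointSet U) (l : t.Line) => x.1 ∈ l) p b
      c).testBit 1 then 1 else 0) = t.rowCount U b.val p.1.val := by
  rw [rowCount, ← sum_line (t := t)]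
  exact Finset.sum_congr rfl fun c _ => by rw [transversalCount_eq]

theorem transversalInvariant_eq [Fintype (t.pointSet U)] :
    transversalInvariant (fun (x : t.pointSet U) (l : t.Line) => x.1 ∈ l) =
      ∑ b ∈ Finset.range 273, ∑ p ∈ Finset.range 273, t.rowCount U b p := by
  rw [transversalInvariant, ← sum_line (t := t)]
  refine Finset.sum_congr rfl fun b _ => ?_
  simp only [sum_transversalCount]
  rw [sum_pointSet fun p => t.rowCount U b.val p]
  refine Finset.sum_congr rfl fun p _ => ?_
  cases hp : U.testBit p with
  | true => exact if_pos rfl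
  | false => rw [rowCount_eq_zero hp]; rfl

theorem IsPlane.invariantCode_eq [Fintype (t.pointSet U)] (h : t.IsPlane)
    (hU : t.isUnitalMask U = true) : t.invariantCode U =
      2 * transversalInvariant (fun (x : t.pointSet U) (l : t.Line) => x.1 ∈ l) % 8191 := by
  rw [transversalInvariant_eq, Finset.mul_sum, invariantCode, sumTo_eq]
  exact Nat.ModEq.sum fun b hb => h.land_neighborCode hU (Finset.mem_range.1 hb)

end IncidenceTable

/-! ### Pairwise non-isomorphic unital designs -/

/-- A unital in a plane described by a table, together with the value of its invariant. -/
structure TableUnital where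
  table : IncidenceTable
  isPlane : table.IsPlane
  mask : ℕ
  code : ℕ
  check : (table.isUnitalMask mask && Nat.beq (table.invariantCode mask) code) = true

namespace TableUnital

theorem isUnitalMask (u : TableUnital) : u.table.isUnitalMask u.mask = true :=
  (Bool.and_eq_true _ _ ▸ u.check).1

theorem invariantCode_eq (u : TableUnital) : u.table.invariantCode u.mask = u.code :=
  Nat.eq_of_beq_eq_true (Bool.and_eq_true _ _ ▸ u.check).2

/-- The points of the unital. -/
abbrev points (u : TableUnital) : Set u.table.Point := u.table.pointSet u.mask

theorem isUnital (u : TableUnital) :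
    let := u.isPlane.projectivePlane
    IsUnital u.table.Line 4 u.points :=
  u.isPlane.isUnital u.isUnitalMask

theorem nonempty_equiv (u : TableUnital) : Nonempty (Fin 65 ≃ u.points) := by
  let := u.isPlane.projectivePlane
  have := u.isUnital.finite_points
  exact ⟨(Finite.equivFinOfCardEq u.isUnital.card_eq).symm⟩

/-- The unital design, transferred to the standard set with `65` elements. -/
noncomputable def design (u : TableUnital) : Set (Set (Fin 65)) :=
  {b | u.nonempty_equiv.some '' b ∈ unitalBlocks u.table.Line 4 u.points}

theorem design_areIsomorphic (u : TableUnital) :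
    AreIsomorphic u.design (unitalBlocks u.table.Line 4 u.points) :=
  ⟨u.nonempty_equiv.some, fun _ => Iff.rfl⟩

theorem isDesign (u : TableUnital) : IsDesign 2 65 5 1 u.design := by
  let := u.isPlane.projectivePlane
  exact u.isUnital.isDesign.of_areIsomorphic u.design_areIsomorphic

theorem isEmbeddedUnitalDesign (u : TableUnital) : IsEmbeddedUnitalDesign 4 u.design :=
  ⟨u.table.Point, u.table.Line, inferInstance, u.isPlane.projectivePlane, u.points, u.isUnital,
    u.design_areIsomorphic⟩

theorem code_eq_of_areIsomorphic {u v : TableUnital} (h : AreIsomorphic u.design v.design) :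
    u.code = v.code := by
  classical
  let := u.isPlane.projectivePlane
  let := v.isPlane.projectivePlane
  obtain ⟨e, f, hef⟩ := ((u.design_areIsomorphic.symm.trans h).trans
    v.design_areIsomorphic).exists_line_equiv u.isUnital
    (u.isPlane.hasUniqueTangents u.isUnitalMask) v.isUnital
    (v.isPlane.hasUniqueTangents v.isUnitalMask) four_pos
  have := Fintype.ofFinite u.points
  have := Fintype.ofFinite v.points
  rw [← u.invariantCode_eq, ← v.invariantCode_eq, u.isPlane.invariantCode_eq u.isUnitalMask,
    v.isPlane.invariantCode_eq v.isUnitalMask,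
    transversalInvariant_congr (R' := fun (x : v.points) (l : v.table.Line) => x.1 ∈ l) hef]

end TableUnital

theorem exists_nonisomorphic_unitalDesigns (us : List TableUnital)
    (hus : (us.map TableUnital.code).Nodup) :
    ∃ D : Fin us.length → Set (Set (Fin 65)),
      (∀ i, IsDesign 2 65 5 1 (D i) ∧ IsEmbeddedUnitalDesign 4 (D i)) ∧
      ∀ i j, i ≠ j → ¬ AreIsomorphic (D i) (D j) := by
  refine ⟨fun i => us[i].design, fun i => ⟨us[i].isDesign, us[i].isEmbeddedUnitalDesign⟩,
    fun i j hij h => hij (Fin.ext ?_)⟩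
  have hcode := TableUnital.code_eq_of_areIsomorphic h
  exact (hus.getElem_inj_iff (i := i) (j := j) (hi := by simp) (hj := by simp)).1
    (by simpa using hcode)

/-! ### Tables of planes and their unitals -/

/-- The incidence table of another plane derived from the dual of the Hall plane. -/
def derivedDualHallB : IncidenceTable where
  lineRows := [
  001017033049065081097113129145161177193209225241256,
  002018034050066082098114130146162178194210226242256,
  004020036052068084100116132148164180196212228244256,
  007023039055071087103119135151167183199215231247256,
  008024040056072088104120136152168184200216232248256,
  009025041057073089105121137153169185201217233249256,
  010026042058074090106122138154170186202218234250256,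
  011027043059075091107123139155171187203219235251256,
  012028044060076092108124140156172188204220236252256,
  013029045061077093109125141157173189205221237253256,
  014030046062078094110126142158174190206222238254256,
  015031047063079095111127143159175191207223239255256,
  000017034056073095109115135155174180202214229252257,
  003018033059074092110112132152173183201213230255257,
  005020039061076090104118130158171177207211224249257,
  006023036062079089107117129157168178204208227250257,
  008025042048065087101123143147166188194222237244257,
  009024043049064086100122142146167189195223236245257,
  010027040050067085103121141145164190192220239246257,
  011026041051066084102120140144165191193221238247257,
  012029046052069083097127139151162184198218233240257,
  013028047053068082096126138150163185199219232241257,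
  014031044054071081099125137149160186196216235242257,
  015030045055070080098124136148161187197217234243257,
  000018044062065091106120141148163182207215233245258,
  003017047061066088105123142151160181204212234246258,
  005023041059068094111125136145166179202210236240258,
  006020042056071093108126139146165176201209239243258,
  008026036054073083098112133156171190199223225253258,
  009027037055072082099113132157170191198222224252258,
  010024038052075081096114135158169188197221227255258,
  011025039053074080097115134159168189196220226254258,
  012030032050077087102116129152175186195219229249258,
  013031033051076086103117128153174187194218228248258,
  014028034048079085100118131154173184193217231251258,
  015029035049078084101119130155172185192216230250258,
  001018047055073085102122139158172179196208237248259,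
  002017044052074086101121136157175176199211238251259,
  004023042050076080099127142155169182193213232253259,
  007020041049079083096124141152170181194214235254259,
  008027038062064092111115130151165186205217228241259,
  009026039063065093110114131150164187204216229240259,
  010025036060066094109113128149167184207219230243259,
  011024037061067095108112129148166185206218231242259,
  012031034058068088107119134147161190201221224245259,
  013030035059069089106118135146160191200220225244259,
  014029032056070090105117132145163188203223226247259,
  015028033057071091104116133144162189202222227246259,
  000020038059078085098113137147175189204218232247260,
  003023037056077086097114138144172190207217235244260,
  005017035062075080103116140150170184201223237242260,
  006018032061072083100119143149169187202220238241260,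
  008028046051070093106121129155167181196210224255260,
  009029047050071092107120128154166180197211225254260,
  010030044049068095104123131153165183198208226253260,
  011031045048069094105122130152164182199209227252260,
  012024042055066089110125133159163177192214228251260,
  013025043054067088111124132158162176193215229250260,
  014026040053064091108127135157161179194212230249260,
  015027041052065090109126134156160178195213231248260,
  001020037050070091110115143153160184199221236250261,
  002023038049069088109112140154163187196222239249261,
  004017032055067094107118138156165189194216233255261,
  007018035052064093104117137159166190193219234252261,
  008029044059079082103122134144169177206212229243261,
  009028045058078083102123135145168176207213228242261,
  010031046057077080101120132146171179204214231241261,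
  011030047056076081100121133147170178205215230240261,
  012025040063075086099126130148173181202208225247261,
  013024041062074087098127131149172180203209224246261,
  014027042061073084097124128150175183200210227245261,
  015026043060072085096125129151174182201211226244261,
  001023043052078095105120133150173186194220224243262,
  002020040055077092106123134149174185193223227240262,
  004018046049075090108125128147168191199217229246262,
  007017045050072089111126131144171188196218230245262,
  008030034061071086096113140159164179203213233250262,
  009031035060070087097112141158165178202212232251262,
  010028032063069084098115142157166177201215235248262,
  011029033062068085099114143156167176200214234249262,
  012026038057067082100117136155160183207209237254262,
  013027039056066083101116137154161182206208236255262,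
  014024036059065080102119138153162181205211239252262,
  015025037058064081103118139152163180204210238253262,
  000023040061070081101122131156162191201219228254263,
  003020043062069082102121128159161188202216231253263,
  005018045056067084096127134153167186204222225251263,
  006017046059064087099124133154164185207221226248263,
  008031032053078089109114139148170183193211236246263,
  009030033052079088108115138149171182192210237247263,
  010029034055076091111112137150168181195209238244263,
  011028035054077090110113136151169180194208239245263,
  012027036049074093105118143144174179197215232242263,
  013026037048075092104119142145175178196214233243263,
  014025038051072095107116141146172177199213234240263,
  015024039050073094106117140147173176198212235241263,
  000024047060069093099116134145171183194217238250264,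
  001025046061068092098117135144170182195216239251264,
  002026045062071095097118132147169181192219236248264,
  003027044063070094096119133146168180193218237249264,
  004028043056065089103112130149175179198221234254264,
  005029042057064088102113131148174178199220235255264,
  006030041058067091101114128151173177196223232252264,
  007031040059066090100115129150172176197222233253264,
  009017038053076084106125143152162190203208231243264,
  010018037054079087105126140155161189200211228240264,
  012020035048073081111120138157167187206213226246264,
  015023032051074082108123137158164184205214225245264,
  000025045052076082110119129154165179200223235246265,
  001024044053077083111118128155164178201222234247265,
  002027047054078080108117131152167177202221233244265,
  003026046055079081109116130153166176203220232245265,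
  004029041048072086106115133158161183204219239242265,
  005028040049073087107114132159160182205218238243265,
  006031043050074084104113135156163181206217237240265,
  007030042051075085105112134157162180207216236241265,
  008017037060068090102127137146173187192215227254265,
  011018038063071089101124138145174184195212224253265,
  013020032057065095099122140151168190197210230251265,
  014023035058066092096121143148171189198209229248265,
  000026035050068086105124139149168177205222231255266,
  001027034051069087104125138148169176204223230254266,
  002024033048070084107126137151170179207220229253266,
  003025032049071085106127136150171178206221228252266,
  004030039054064082109120143145172181201218227251266,
  005031038055065083108121142144173180200219226250266,
  006028037052066080111122141147174183203216225249266,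
  007029036053067081110123140146175182202217224248266,
  008018043058076094097116131157160185197214239247266,
  011017040057079093098119128158163186198213236244266,
  013023046063073091100113134152165188192211234242266,
  014020045060074088103114133155166191195208233241266,
  000027033058077089100127140158166181199216226243267,
  001026032059076088101126141159167180198217227242267,
  002025035056079091102125142156164183197218224241267,
  003024034057078090103124143157165182196219225240267,
  004031037062073093096123136154162177195220230247267,
  005030036063072092097122137155163176194221231246267,
  006029039060075095098121138152160179193222228245267,
  007028038061074094099120139153161178192223229244267,
  009018040051068080109118133151175188206209235250267,
  010017043048071083110117134148172191205210232249267,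
  012023045054065085104115128146170185203212238255267,
  015020046053066086107112131145169186200215237252267,
  000028041055075088097117143146164186206211230253268,
  001029040054074089096116142147165187207210231252268,
  002030043053073090099119141144166184204209228255268,
  003031042052072091098118140145167185205208229254268,
  004024045051079092101113139150160190202215226249268,
  005025044050078093100112138151161191203214227248268,
  006026047049077094103115137148162188200213224251268,
  007027046048076095102114136149163189201212225250268,
  008020033063067080105125135154172178198219238245268,
  011023034060064083106126132153175177197216237246268,
  013017036058070085108120130159169183195222235240268,
  014018039057069086111123129156170180192221232243268,
  000029043063066087108118136153170190196213227241269,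
  001028042062067086109119137152171191197212226240269,
  002031041061064085110116138155168188198215225243269,
  003030040060065084111117139154169189199214224242269,
  004025047059070083104114140157174186192209231245269,
  005024046058071082105115141156175187193208230244269,
  006027045057068081106112142159172184194211229247269,
  007026044056069080107113143158173185195210228246269,
  009020034054075094101127129144163183205220234248269,
  010023033053072093102124130147160180206223233251269,
  012017039051078091096122132149166178200217239253269,
  015018036048077088099121135150165177203218236254269,
  000030037057074083107125130150167188193212239248270,
  001031036056075082106124131151166189192213238249270,
  002028039059072081105127128148165190195214237250270,
  003029038058073080104126129149164191194215236251270,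
  004026033061078087111121134146163184197208235252270,
  005027032060079086110120135147162185196209234253270,
  006024035063076085109123132144161186199210233254270,
  007025034062077084108122133145160187198211232255270,
  009023044048067090098116139159174181200221230241270,
  010020047051064089097119136156173182203222229242270,
  012018041053070095103113142154171176205216227244270,
  015017042054069092100114141153168179206219224247270,
  000031039049067092102126133157169184203210234244271,
  001030038048066093103127132156168185202211235245271,
  002029037051065094100124135159171186201208232246271,
  003028036050064095101125134158170187200209233247271,
  004027035053071088098122129153173188207214238240271,
  005026034052070089099123128152172189206215239241271,
  006025033055069090096120131155175190205212236242271,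
  007024032054068091097121130154174191204213237243271,
  008023047057075084110118141149161176195218226252271,
  011020044058072087109117142150162179192217225255271,
  013018042060078081107115136144164181198223231249271,
  014017041063077082104112139147167182197220228250271,
  000001012013016064071072079080084090094112114121123,
  000002009011019032036042046096103104111160161172173,
  000003005006021048051053054192195197198256259261262,
  000004010014022144151152159176178185187224225236237,
  000007008015128132138142208209220221240242249251272,
  001002004007021057058060063200203205206257258260263,
  001003008010019035039041045099100107108162163174175,
  001005011015022146149154157181183188190228229232233,
  001006009014130134136140214215218219244246253255272,
  002003014015016067068075076083087089093113115120122,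
  002005010013129133139143212213216217245247252254272,
  002006008012022145150153158180182189191230231234235,
  003004011012131135137141210211222223241243248250272,
  003007009013022147148155156177179184186226227238239,
  004005008009016066069074077081085091095117119124126,
  004006013015019034038040044097102105110166167170171,
  005007012014019033037043047098101106109164165168169,
  006007010011016065070073078082086088092116118125127,
  008011013014021049050052055201202204207264267269270,
  009010012015021056059061062193194196199265266268271,
  021032033044045064066073075224231232239240244250254,
  022032034041043080081092093192199200207208212218222,
  016032035037038128131133134176179181182256257268269,
  032039040047048052058062112113124125144146153155272,
  016033034036039136139141142185186188191260261264265,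
  022033035040042082083094095195196203204211215217221,
  033038041046050054056060118119122123148150157159272,
  021034035046047065067072074227228235236243247249253,
  034037042045049053059063116117120121149151156158272,
  035036043044051055057061114115126127145147152154272,
  021036037040041069071076078226229234237241245251255,
  022036038045047086087090091193198201206210214216220,
  022037039044046084085088089194197202205209213219223,
  021038039042043068070077079225230233238242246248252,
  016040043045046137138140143177178180183258259270271,
  016041042044047129130132135184187189190262263266267,
  019048049060061080082089091176180186190240247248255,
  016048050057059096097108109208215216223224228234238,
  022048055056063064068074078128129140141160162169171,
  016049051056058098099110111211212219220227231233237,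
  022049054057062066070072076134135138139164166173175,
  019050051062063081083088090179183185189243244251252,
  022050053058061065069075079132133136137165167172174,
  022051052059060067071073077130131142143161163168170,
  019052053056057085087092094177181187191242245250253,
  016052054061063102103106107209214217222226230232236,
  016053055060062100101104105210213218221225229235239,
  019054055058059084086093095178182184188241246249254,
  064065076077096098105107176183184191192196202206272,
  019064067069070144147149150208211213214256258265267,
  019065066068071152155157158217218220223261263268270,
  066067078079097099104106179180187188195199201205272,
  068069072073101103108110178181186189193197203207272,
  070071074075100102109111177182185190194198200204272,
  019072075077078153154156159209210212215257259264266,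
  019073074076079145146148151216219221222260262269271,
  080083085086160163165166224227229230256263264271272,
  021080087088095096100106110128130137139144145156157,
  081082084087168171173174233234236239259260267268272,
  021081086089094098102104108132134141143150151154155,
  021082085090093097101107111133135140142148149152153,
  021083084091092099103105109129131136138146147158159,
  088091093094169170172175225226228231257262265270272,
  089090092095161162164167232235237238258261266269272,
  022096099101102112115117118240243245246256260266270,
  022097098100103120123125126249250252255259263265269,
  022104107109110121122124127241242244247258262264268,
  022105106108111113114116119248251253254257261267271,
  019112116122126128135136143192193204205224226233235,
  021112119120127160164170174176177188189208210217219,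
  019113117123127130133138141196197200201229231236238,
  021113118121126162166168172182183186187212214221223,
  021114117122125161165171175180181184185213215220222,
  019114118120124129134137142198199202203228230237239,
  021115116123124163167169173178179190191209211216218,
  019115119121125131132139140194195206207225227232234,
  016144148154158160167168175192194201203240241252253,
  016145149155159162165170173197199204206244245248249,
  016146150152156161166169174196198205207246247250251,
  016147151153157163164171172193195200202242243254255,
  016017018019020021022023024025026027028029030031272]
  pointRows := [
  012024048084096108120132144156168180192193194195196,
  000036060072097109121133145157169181192197198199200,
  001037061073098110122134146158170182193197201202203,
  013025049085099111123135147159171183194198201204205,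
  002038062074100112124136148160172184195197204206207,
  014026050086101113125137149161173185194199202206208,
  015027051087102114126138150162174186194200203207209,
  003039063075103115127139151163175187196197205208209,
  004016028040052064076088116128152188196198203206210,
  005017029041053065077089104140164176193200205206211,
  006018030042054066078090105141165177195198202209211,
  007019031043055067079091117129153189193199204209210,
  008020032044056068080092106142166178192203204208211,
  009021033045057069081093118130154190192202205207210,
  010022034046058070082094119131155191195200201208210,
  011023035047059071083095107143167179196199201207211,
  192201206209214216226227229231237238268269270271272,
  000012025037050062075087104116129141154166179191272,
  001013024036051063074086105117128140155167178190272,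
  193198207208228233236239241242246247260262265267272,
  002014027039048060073085106118131143152164177189272,
  194197210211212219222225249251252253261263264266272,
  195199203205213217223224230232234235256257258259272,
  003015026038049061072084107119130142153165176188272,
  004017030043056069082095096109122135148161174187272,
  005016031042057068083094097108123134149160175186272,
  006019028041058071080093098111120133150163172185272,
  007018029040059070081092099110121132151162173184272,
  008021034047052065078091100113126139144157170183272,
  009020035046053064079090101112127138145156171182272,
  010023032045054067076089102115124137146159168181272,
  011022033044055066077088103114125136147158169180272,
  032046051062078088107118123133173187193212213214215,
  000013033047079089122132152165172186208212216217218,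
  001012034044076090121135153164175185207213216219220,
  035045050063077091106119120134174184198214217219221,
  002015028042082092127137154167169183193216221222223,
  029043049060083093105116126136168182208214220222224,
  030040048061080094104117125139171181207214218223225,
  003014031041081095124138155166170180198215216224225,
  004018058068073084103113129140145159207215217222226,
  005019026039059069102112144158178191198213218222227,
  006016027038056070101115147157179190193217220225227,
  007017057071072085100114128141146156208213221225226,
  008022024037054064099109149163176189207212221224227,
  009023055065075086098108131142148162198212220223226,
  010020052066074087097111130143151161193218219224226,
  011021025036053067096110150160177188208215219223227,
  016034055093106112122141151167176181194215228229230,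
  000017035039054061074092113123150180210220228231232,
  001018032038053060075095114120149183210218229233234,
  019033052094107115121140148166177182194221231233235,
  002020030037059063072089108126147185210215235236237,
  021031058088104109127143146165178184194220234236238,
  022028057091105110124142145164179187194218232237239,
  003023029036056062073090111125144186210221230238239,
  004012027046049067081086100134163169211218230231236,
  005047066080101118129135155162168188197221229232236,
  006044065083102119128132154161171189197215231234239,
  007013026045048064082087103133160170211220229235239,
  008042071077096116131138153159173190197218228235238,
  009014025043051070076084097139158172211221228234237,
  010015024040050069079085098136157175211215232233238,
  011041068078099117130137152156174191197220230233237,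
  017040058063083087101124153158177183192212230240241,
  000016024041059082100118125142159182209219234240242,
  001019025042056081103119126143156181206212232242243,
  018043057062080086102127152157176180201219235241243,
  002021026044054079097116120140162187201225230242244,
  020045055061078085096121155163179186206222234241244,
  023046052060077084099122154160178185209225232241245,
  003022027047053076098117123141161184192222235242245,
  004029051071075094112137147165170189192219232244246,
  005012028036070095106113130136146171209212235244247,
  006013031037069092107114131139145168206219230245247,
  007030050068074093115138144164169188201212234245246,
  008014033038067090104108128133151174201222232240247,
  009032049066073091109132150167175191206225235240246,
  010035048065072088110135149166172190209222230243246,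
  011015034039064089105111129134148173192225234243247,
  023031038050066082110126140152163171192213228248249,
  000022030067083084106111127162170190206213233250251,
  001021029064080085107108124161169191209217228250252,
  020028039051065081109125141153160168201217233248253,
  002019035070078086104114122159175188192224239250253,
  018034036048071079115123142154158174206224236248252,
  017033037049068076112120143155157173209223239248251,
  003016032069077087105113121156172189201223236249250,
  004025044057061089101131133144167184209224233249254,
  005015045056075088100117132145177185201224228251255,
  006014046059074091103116135146176186192223233252255,
  007024047058060090102130134147166187206223228253254,
  008013040053073093097119137148179180209213236253255,
  009027041052063092096129136149165181201213239252254,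
  010026042055062095099128139150164182192217236251254,
  011012043054072094098118138151178183206217239249255,
  021030039071076086099119136145166186193229240249256,
  000020031049070077098128137144177187207229243252257,
  001023028048069078097129138147176184208231240251257,
  022029038068079087096118139146167185198231243253256,
  002017034051067080103130132149179182198238245249257,
  016035037066081084102117133148164183208238244252256,
  019032036065082085101116134151165180207237245251256,
  003018033050064083100131135150178181193237244253257,
  004014047054063093114121142160171191193238243251258,
  005025046055072092105115120152161170207238240253259,
  006024045052073095104112123153162169208237243249259,
  007015044053062094113122143163168190198237240252258,
  008027043058074089107110125154156175198229244251259,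
  009012042059061088111124140157174189208229245253258,
  010013041056060091108127141158173188207231244249258,
  011026040057075090106109126155159172193231245252259,
  013028043061077090100115143149162191192215256260261,
  000029042048076091101114130148163178201215259262263,
  001030041049079088102113131151160179192221259264265,
  012031040060078089103112142150161190201221256266267,
  002032047050081094096111128145158176209220259260266,
  015033046063080095097110141144159189206220256262264,
  014034045062083092098109140147156188209218256263265,
  003035044051082093099108129146157177206218259261267,
  004019024053066072106124139154173186201220257261265,
  005018037052067085119125138167172187192220258263267,
  006017036055064084118126137166175184201218258260264,
  007016025054065073107127136155174185192218257262266,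
  008023039057070087117120135165169182206215258265266,
  009022026056071074104121134152168183209215257264267,
  010021027059068075105122133153171180206221257260263,
  011020038058069086116123132164170181209221258261262,
  033042053070074085102109129142170185196214230249260,
  000015032043052071103108155164171184202227230253265,
  001014035040055068100111154165168187200227235249262,
  034041054069075084101110128143169186204214235253267,
  002013029046057066098113153166174181196227234251267,
  028047056067072087099112131140175180202214234252262,
  031044059064073086096115130141172183200214232251265,
  003012030045058065097114152167173182204227232252260,
  004023026037080091123136151156177190200216234253260,
  005022048063081090107116122137150157204226234249265,
  006021049062082089106117121138149158196226232253262,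
  007020027036083088120139148159176191202216232249267,
  008019050061076095105118127132147160200226230252267,
  009018024039077094126133146161179188204216230251262,
  010017025038078093125134145162178189196216235252265,
  011016051060079092104119124135144163202226235251260,
  019047049064075092097125146164174190195215241249268,
  000018026046065093096117124143147175203221247249269,
  001017027045066094099116127142144172199215247253270,
  016044048067074095098126145165173191205221241253271,
  002023024043068088101119121141150170205218247252268,
  022042051069073089100120151166171188199220241252269,
  021041050070072090103123148167168189203218241251270,
  003020025040071091102118122140149169195220247251271,
  004013032039055083104110130138157185195221242252270,
  005033054060082086111139153156179184203215246252271,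
  006034053061081087108136152159178187199221246251268,
  007012035038052080105109131137158186205215242251269,
  008028059062079084114134155161177181205220246249270,
  009015029037058078106115128135160180199218242249271,
  010014030036057077107112129132163183203220242253268,
  011031056063076085113133154162176182195218246253269,
  022025045059060080113128138148165175193230248261268,
  000023044058081085105112139149174188193235255264270,
  001020047057082084104115136150173189198230255263269,
  021024046056061083114129137151164172198235248266271,
  002018041055076087107109134144171190208232255261271,
  019027040054062077108130135145167170208234248264269,
  016026043053063078111131132146166169207232248263270,
  003017042052079086106110133147168191207234255266268,
  004015031065074090099118120158179181208235250263268,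
  005030038051064091098121143154159180208230254266270,
  006029039050067088097122142155156183207235254261269,
  007014028066075089096119123157178182207230250264271,
  008035036049069094103124141152162185193234254263271,
  009013034068072095102116125163177184193232250266269,
  010012033071073092101117126160176187198234250261270,
  011032037048070093100127140153161186198232254264268,
  027037057065079095103111121137178188195214228240261,
  000014056064078094102110120136153167205226236245261,
  001015059067077093101109123139152166195226239244266,
  026036058066076092100108122138179189205214233243266,
  002012053069083091099115125133155165203226228243264,
  025039052068082090098114124132176190199214236244264,
  024038055071081089097113127135177191203214239245263,
  003013054070080088096112126134154164199226233240263,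
  004020034042050060107117146162172180205227239240264,
  005021035043073087128142147163173181195216233245264,
  006022032040072086129143144160174182205216228244263,
  007023033041051061106116145161175183195227236243263,
  008016030046075085130140150158168184199216239243261,
  009017031047048062105119151159169185203227233244261,
  010018028044049063104118148156170186199227228245266,
  011019029045074084131141149157171187203216236240266,
  018035056089098116130139155160169189194213240260268,
  000019034038057063073088099138161168211223244260271,
  001016033039058062072091096137162171211224245267268,
  017032059090097117131136154163170188194217243267271,
  002022031036052061075093102135156173211217240262270,
  023030053092103118128134153157172191194224244262269,
  020029054095100119129133152158175190194223245265270,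
  003021028037055060074094101132159174211213243265269,
  004045070079105108125143150166176183197213245262271,
  005013027044050071078084109124151182210223243262268,
  006012026047051068077085110127148181210224240265271,
  007046069076104111126142149167177180197217244265268,
  008015025041048066083086112121146187210217245260269,
  009040067082107113120141147164178186197224243260270,
  010043064081106114123140144165179185197223240267269,
  011014024042049065080087115122145184210213244267270,
  015036054068081091104131147161172182196213229241261,
  000027055069080090119140146160173183196224237246266,
  001026052070083089118141145163174180204223238246261,
  014037053071082088105130144162175181204217231241266,
  002025058064077095117142151157168186202213231246263,
  013038059065076094106129150156169187202224238241264,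
  012039056066079093107128149159170184200223237241263,
  003024057067078092116143148158171185200217229246264,
  004022035041062085097115126132153178202223229247266,
  005023034040049074096114127133166189202217237242261,
  006020033043048075099113124134167188200213238242266,
  007021032042063084098112125135152179200224231247261,
  008018031045051072101111122136164191196223231242264,
  009019030044060087100110123137155176196217238247263,
  010016029047061086103109120138154177204213237247264,
  011017028046050073102108121139165190204224229242263,
  014029044052069072117127134150159179195212229248260,
  000028045053068086107126135151158189195225238254267,
  001031046054071087106125132148157188205222237254260,
  015030047055070073116124133149156178205219231248267,
  002033040056065084105123138146163191199219229254265,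
  012032041057064074119122139147162177199222238248262,
  013035042058067075118121136144161176203225237248265,
  003034043059066085104120137145160190203212231254262,
  004021038048077092102111141155175182199212237255267,
  005020024062076093103110131165174183199225231250260,
  006023025063079094100109130164173180203222229250267,
  007022039049078095101108140154172181203219238255260,
  008017026060081088098115129167171186195219237250262,
  009016036050080089099114143153170187195222231255265,
  010019037051083090096113142152169184205225229255262,
  011018027061082091097112128166168185205212238250265,
  020026041067073094105114135154157184196212228256268,
  000021040051066095115131134156176185204222239258268,
  001022043050065092112130133159177186196225236258271,
  023027042064072093104113132155158187204219233256271,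
  002016045049071090110129139161178180200212233258269,
  017024044070075091107111138152160181202222236256269,
  018025047069074088106108137153163182200225239256270,
  003019046048068089109128136162179183202219228258270,
  004033036059078087098119127149164168204225228259269,
  005014032058061079099126141148169190196219239257269,
  006015035057060076096125140151170191204212236257270,
  007034037056077086097118124150165171196222233259270,
  008012029055063082102123143145172188202225233257268,
  009028038054083085103117122144166173200219236259268,
  010031039053080084100116121147167174202212239259271,
  011013030052062081101120142146175189200222228257271,
  000001002003004005006007008009010011194214241248256,
  012013014015016017018019020021022023197214246254259,
  024025026027028029030031032033034035197226241255258,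
  036037038039040041042043044045046047194226246250257,
  048049050051052053054055056057058059197216247250256,
  060061062063064065066067068069070071194216242255259,
  072073074075076077078079080081082083194227247254258,
  084085086087088089090091092093094095197227242248257,
  096097098099100101102103104105106107210216246248258,
  108109110111112113114115116117118119211216241254257,
  120121122123124125126127128129130131211227246255256,
  132133134135136137138139140141142143210227241250259,
  144145146147148149150151152153154155211214242250258,
  156157158159160161162163164165166167210214247255257,
  168169170171172173174175176177178179210226242254256,
  180181182183184185186187188189190191211226247248259,
  196200202204215218220221240243244245248250254255272]

theorem derivedDualHallB_isPlane : derivedDualHallB.IsPlane := by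
  constructor <;> decide +kernel

/-- Unitals in the plane with table `derivedDualHallB`. -/
noncomputable def derivedDualHallBUnitals : List TableUnital := [
  ⟨derivedDualHallB, derivedDualHallB_isPlane,
    1517716883003412727101854242684447373392427334453748790202914256734121828251336704,
    769, by decide +kernel⟩,
  ⟨derivedDualHallB, derivedDualHallB_isPlane,
    3705573153072851301040591625699538761427815104203027210771296358723082188489869,
    871, by decide +kernel⟩,
  ⟨derivedDualHallB, derivedDualHallB_isPlane,
    4832235582013316830618928147846063936176819025501910607384226776198568381680640130,
    1455, by decide +kernel⟩,
  ⟨derivedDualHallB, derivedDualHallB_isPlane,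
    10713236356049150085538162537350678218959993564296408253310128009999134520739108888,
    1921, by decide +kernel⟩,
  ⟨derivedDualHallB, derivedDualHallB_isPlane,
    1055421501893571045549302010917474007069624125289654798205327546006,
    1955, by decide +kernel⟩,
  ⟨derivedDualHallB, derivedDualHallB_isPlane,
    92362553895911873525158898544597434635901227255003858007188136512614561781398,
    2467, by decide +kernel⟩,
  ⟨derivedDualHallB, derivedDualHallB_isPlane,
    3879563775201775740183901593747058865719017964369916541235535349178799767325771776,
    3011, by decide +kernel⟩,
  ⟨derivedDualHallB, derivedDualHallB_isPlane,
    13391470912384855316959153367726710242236170189748524122126268029812649053420283494,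
    3619, by decide +kernel⟩,
  ⟨derivedDualHallB, derivedDualHallB_isPlane,
    12035039099698698466773811300390531060202696559306711771014982924117822311301185536,
    4848, by decide +kernel⟩,
  ⟨derivedDualHallB, derivedDualHallB_isPlane,
    13391477723580291716073138202498951500817760371538413208771685940116929587114409984,
    5156, by decide +kernel⟩,
  ⟨derivedDualHallB, derivedDualHallB_isPlane,
    16347492647456602455754978827212644104065760163162211853852093935323567357952,
    5313, by decide +kernel⟩,
  ⟨derivedDualHallB, derivedDualHallB_isPlane,
    7588597853830538835858093873656134869677287829446722177999393112234522792891607296,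
    5535, by decide +kernel⟩,
  ⟨derivedDualHallB, derivedDualHallB_isPlane,
    4463877402652435245210486828662400416972779773515488930029835329134109712520839168,
    5793, by decide +kernel⟩,
  ⟨derivedDualHallB, derivedDualHallB_isPlane,
    1517697811656204530372003232129074475241968648742385545630645933299515190816564889,
    6049, by decide +kernel⟩,
  ⟨derivedDualHallB, derivedDualHallB_isPlane,
    3879515378893133720206419898741052886603520506103911725983747895060606563718791463,
    6246, by decide +kernel⟩,
  ⟨derivedDualHallB, derivedDualHallB_isPlane,
    9011766548894465112344392990912620766981374719091181143955716227579478557256649221,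
    6500, by decide +kernel⟩,
  ⟨derivedDualHallB, derivedDualHallB_isPlane,
    4901479137415610392318008770329490612023414887626309531347865204786917378262831088,
    6594, by decide +kernel⟩,
  ⟨derivedDualHallB, derivedDualHallB_isPlane,
    9011758738702937149398545047547792449765799275800470481198497709151180719687009546,
    6656, by decide +kernel⟩,
  ⟨derivedDualHallB, derivedDualHallB_isPlane,
    4463785040098540388758463563334899907338517799146882009906910079552898946276786176,
    6757, by decide +kernel⟩,
  ⟨derivedDualHallB, derivedDualHallB_isPlane,
    7588550626008497328156886714045211041500474741084406728434003735905793864989501696,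
    7877, by decide +kernel⟩,
  ⟨derivedDualHallB, derivedDualHallB_isPlane,
    8659860211630439807832523752532088364915246415910796152444658990796216368091432202,
    8097, by decide +kernel⟩,
  ⟨derivedDualHallB, derivedDualHallB_isPlane,
    7810357846846036431086259184174476271522992472593504099719925175552579731456,
    8098, by decide +kernel⟩,
  ⟨derivedDualHallB, derivedDualHallB_isPlane,
    8659945635152335673158337143463749718800423387267427993351027338783841358883430480,
    8128, by decide +kernel⟩]

/-- Unitals in the plane with table `derivedDualHallB.dual`. -/
noncomputable def derivedDualHallBDualUnitals : List TableUnital := [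
  ⟨derivedDualHallB.dual, derivedDualHallB_isPlane.dual,
    114843259753918867579601546823999323645679054049510534778259770442752,
    45, by decide +kernel⟩,
  ⟨derivedDualHallB.dual, derivedDualHallB_isPlane.dual,
    7590287342305596624443964987167838283165950926833975527811121949121874049534007432,
    66, by decide +kernel⟩,
  ⟨derivedDualHallB.dual, derivedDualHallB_isPlane.dual,
    232043558927154344311068350354403098403500233479591636479149166891660582715407,
    261, by decide +kernel⟩,
  ⟨derivedDualHallB.dual, derivedDualHallB_isPlane.dual,
    5734150115111350479227795878630699855386409533805457525726464373778609031753367625,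
    473, by decide +kernel⟩,
  ⟨derivedDualHallB.dual, derivedDualHallB_isPlane.dual,
    1901248549907803126808428860513560327265196813583470703071931722559002911109760033,
    951, by decide +kernel⟩,
  ⟨derivedDualHallB.dual, derivedDualHallB_isPlane.dual,
    7590376347226484831235310266910730604926148708343951280262360052705271389983121632,
    1057, by decide +kernel⟩,
  ⟨derivedDualHallB.dual, derivedDualHallB_isPlane.dual,
    7588550710184250328389904924611301606282493893972481745881494946041758480439775768,
    1441, by decide +kernel⟩,
  ⟨derivedDualHallB.dual, derivedDualHallB_isPlane.dual,
    7588550460967077540901971915342474720644189374620406084153669642493799487858807640,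
    1957, by decide +kernel⟩,
  ⟨derivedDualHallB.dual, derivedDualHallB_isPlane.dual,
    15008507438583975986120557271757358446089285699835008239018011296718306084430816084,
    2529, by decide +kernel⟩,
  ⟨derivedDualHallB.dual, derivedDualHallB_isPlane.dual,
    7588550361931823922484856212556707157645885518528325365117116702757736989684402176,
    2658, by decide +kernel⟩,
  ⟨derivedDualHallB.dual, derivedDualHallB_isPlane.dual,
    114843259757390874660868305204685877080713997778722105416105547793408,
    2726, by decide +kernel⟩,
  ⟨derivedDualHallB.dual, derivedDualHallB_isPlane.dual,
    7894267709988486769641848802582034240000064832262802097188542519194608870420383744,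
    2788, by decide +kernel⟩,
  ⟨derivedDualHallB.dual, derivedDualHallB_isPlane.dual,
    7588576596076939579331544794749063291031653125776656441966683920073519947359567904,
    3395, by decide +kernel⟩,
  ⟨derivedDualHallB.dual, derivedDualHallB_isPlane.dual,
    489107594245031913720422060171470763072712130579170196938467347671096460938320266,
    3687, by decide +kernel⟩,
  ⟨derivedDualHallB.dual, derivedDualHallB_isPlane.dual,
    5006041253066203691915093570827570855825821749180792176688358354968971693761581082,
    3775, by decide +kernel⟩,
  ⟨derivedDualHallB.dual, derivedDualHallB_isPlane.dual,
    232043558927154344311135915224335509552458155878399568271945452544841264200032,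
    4424, by decide +kernel⟩,
  ⟨derivedDualHallB.dual, derivedDualHallB_isPlane.dual,
    489107594245031913720419965276630604222253998491897837556744290305079897591320805,
    4516, by decide +kernel⟩,
  ⟨derivedDualHallB.dual, derivedDualHallB_isPlane.dual,
    2494785437220177435161709353659330930138581102946422797440799068,
    4646, by decide +kernel⟩,
  ⟨derivedDualHallB.dual, derivedDualHallB_isPlane.dual,
    14702842657944409891016757764896020105743338762045713920768163769120205037505642498,
    4673, by decide +kernel⟩,
  ⟨derivedDualHallB.dual, derivedDualHallB_isPlane.dual,
    15008507438584043023877242072243429018319511955322244681555922107908534246100174211,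
    5538, by decide +kernel⟩,
  ⟨derivedDualHallB.dual, derivedDualHallB_isPlane.dual,
    9726655120538100697074438752476435757682659768681441468753843358259766493050053130,
    6844, by decide +kernel⟩,
  ⟨derivedDualHallB.dual, derivedDualHallB_isPlane.dual,
    7590376348901452396225749332286001262095902086312503452364751907573478095329501716,
    7587, by decide +kernel⟩,
  ⟨derivedDualHallB.dual, derivedDualHallB_isPlane.dual,
    7755290968849937644746728585139895659020589452605118915523916837563214089456484354,
    7905, by decide +kernel⟩]

/-- The incidence table of another plane derived from the plane of `semifieldB`. -/
def derivedSemifieldB : IncidenceTable where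
  lineRows := [
  000017034051068085102119136153170187204221238255257,
  002019032049070087100117138155168185206223236253257,
  003018033048071086101116139154169184207222237252257,
  004021038055064081098115140157174191200217234251257,
  006023036053066083096113142159172189202219232249257,
  007022037052067082097112143158173188203218233248257,
  009024043058077092111126129144163178197212231246257,
  010027040057078095108125130147160177198215228245257,
  011026041056079094109124131146161176199214229244257,
  013028047062073088107122133148167182193208227242257,
  014031044061074091104121134151164181194211224241257,
  015030045060075090105120135150165180195210225240257,
  000018035049077095110124134148165183203217232250258,
  001019034048076094111125135149164182202216233251258,
  003017032050078092109127133151166180200218235249258,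
  004022039053073091106120130144161179207221236254258,
  005023038052072090107121131145160178206220237255258,
  007021036054074088105123129147162176204222239253258,
  008026043057069087102116142156173191195209224242258,
  009027042056068086103117143157172190194208225243258,
  010024041059071085100118140158175189193211226240258,
  012030047061065083098112138152169187199213228246258,
  013031046060064082099113139153168186198212229247258,
  014028045063067081096114136154171185197215230244258,
  000019033050073090104123142157175188199212230245259,
  001018032051072091105122143156174189198213231244259,
  002017035048075088106121140159173190197214228247259,
  004023037054077094108127138153171184195208226241259,
  005022036055076095109126139152170185194209227240259,
  006021039052079092110125136155169186193210224243259,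
  008027041058065082096115134149167180207220238253259,
  009026040059064083097114135148166181206221239252259,
  011024042057066081099112133150164183204223237254259,
  012031045062069086100119130145163176203216234249259,
  013030044063068087101118131144162177202217235248259,
  015028046061070085103116129146160179200219233250259,
  000020042062072092098118135147173185207219229241260,
  001021043063073093099119134146172184206218228240260,
  002022040060074094096116133145175187205217231243260,
  003023041061075095097117132144174186204216230242260,
  005017047059077089103115130150168188202222224244260,
  006018044056078090100112129149171191201221227247260,
  008028034054064084106126143155165177199211237249260,
  009029035055065085107127142154164176198210236248260,
  010030032052066086104124141153167179197209239251260,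
  011031033053067087105125140152166178196208238250260,
  013025039051069081111123138158160180194214232252260,
  014026036048070082108120137157163183193213235255260,
  000029037056070091099126140145169180202215239242261,
  001028036057071090098127141144168181203214238243261,
  002031039058068089097124142147171182200213237240261,
  003030038059069088096125143146170183201212236241261,
  004025033060066095103122136149173176206211235246261,
  005024032061067094102123137148172177207210234247261,
  006027035062064093101120138151175178204209233244261,
  007026034063065092100121139150174179205208232245261,
  008021045048078083107118132153161188194223231250261,
  009020044049079082106119133152160189195222230251261,
  014019043054072085109112130159167186196217225252261,
  015018042055073084108113131158166187197216224253261,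
  000021040061071082111122131150171190196209236249262,
  001020041060070083110123130151170191197208237248262,
  006019046059065084105124133144173184194215234255262,
  007018047058064085104125132145172185195214235254262,
  008029032053079090103114139158163182204217228241262,
  009028033052078091102115138159162183205216229240262,
  010031034055077088101112137156161180206219230243262,
  011030035054076089100113136157160181207218231242262,
  012025036049075094099118143154167178200221224245262,
  013024037048074095098119142155166179201220225244262,
  014027038051073092097116141152165176202223226247262,
  015026039050072093096117140153164177203222227246262,
  000030036058067093103121133155161191198216226252263,
  001031037059066092102120132154160190199217227253263,
  002028038056065095101123135153163189196218224254263,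
  003029039057064094100122134152162188197219225255263,
  004026032062071089099125129159165187194220230248263,
  007025035061068090096126130156166184193223229251263,
  008022044050075085111113141147169183206208234244263,
  009023045051074084110112140146168182207209235245263,
  010020046048073087109115143145171181204210232246263,
  011021047049072086108114142144170180205211233247263,
  012018040054079081107117137151173179202212238240263,
  015017043053076082104118138148174176201215237243263,
  000022041063066084107125138156163181200222225247264,
  001023040062067085106124139157162180201223224246264,
  002020043061064086105127136158161183202220227245264,
  003021042060065087104126137159160182203221226244264,
  005019044058071081110120143153166176205219228242264,
  007017046056069083108122141155164178207217230240264,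
  009031032054075093098116131149170188193215232254264,
  011029034052073095096118129151168190195213234252264,
  012026037051078088103113134144175185196210237251264,
  013027036050079089102112135145174184197211236250264,
  014024039049076090101115132146173187198208239249264,
  015025038048077091100114133147172186199209238248264,
  000031038057076083106117129158167184205210235244265,
  002029036059078081104119131156165186207208233246265,
  004027034061072087110113133154163188201214239240265,
  005026035060073086111112132155162189200215238241265,
  006025032063074085108115135152161190203212237242265,
  007024033062075084109114134153160191202213236243265,
  008023046049068091098125137150175176197218227252265,
  009022047048069090099124136151174177196219226253265,
  010021044051070089096127139148173178199216225254265,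
  011020045050071088097126138149172179198217224255265,
  012019042053064095102121141146171180193222231248265,
  014017040055066093100123143144169182195220229250265,
  000024045053065089108116143151162186206214227251266,
  001025044052064088109117142150163187207215226250266,
  002026047055067091110118141149160184204212225249266,
  003027046054066090111119140148161185205213224248266,
  004028041049069093104112139147166190202210231255266,
  005029040048068092105113138146167191203211230254266,
  006030043051071095106114137145164188200208229253266,
  007031042050070094107115136144165189201209228252266,
  010018039063075083102126133157168176196220233241266,
  011019038062074082103127132156169177197221232240266,
  012020033057077085096120131155174182194218239247266,
  013021032056076084097121130154175183195219238246266,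
  000026046052075081101127130152172182201211231253267,
  003025045055072082102124129155175181202208228254267,
  004030042048079085097123134156168178205215227249267,
  005031043049078084096122135157169179204214226248267,
  006028040050077087099121132158170176207213225251267,
  007029041051076086098120133159171177206212224250267,
  008018038060067089109119138144164190193219239245267,
  011017037063064090110116137147167189194216236246267,
  012022034056071093105115142148160186197223235241267,
  013023035057070092104114143149161187196222234240267,
  014020032058069095107113140150162184199221233243267,
  015021033059068094106112141151163185198220232242267,
  000023043060079088100115141154166177194213233254268,
  001022042061078089101114140155167176195212232255268,
  003020040063076091103112142153165178193214234253268,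
  004019047056075092096119137158162181198209237250268,
  005018046057074093097118136159163180199208236251268,
  006017045058073094098117139156160183196211239248268,
  009030034053070081109122132147175184203220224247268,
  010029033054069082110121135144172187200223227244268,
  011028032055068083111120134145173186201222226245268,
  012027039048067084104127129150170189206217229242268,
  014025037050065086106125131148168191204219231240268,
  015024036051064087107124130149169190205218230241268,
  000027044055069094105114132159168179193218237246269,
  002025046053071092107112134157170177195216239244269,
  003024047052070093106113135156171176194217238245269,
  005030041050064091108119129154173182196223232243269,
  006029042049067088111116130153174181199220235240269,
  007028043048066089110117131152175180198221234241269,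
  008019036063077086097122140151160187201210229254269,
  009018037062076087096123141150161186200211228255269,
  010017038061079084099120142149162185203208231252269,
  012023032059073082101126136147164191205214225250269,
  013022033058072083100127137146165190204215224251269,
  015020035056074081102125139144167188206213226249269,
  000025047054078087097120139146164189197220234243270,
  001024046055079086096121138147165188196221235242270,
  002027045052076085099122137144166191199222232241270,
  003026044053077084098123136145167190198223233240270,
  004029043050074083101124143150160185193216238247270,
  006031041048072081103126141148162187195218236245270,
  008017039062070095105112131154172181205212226251270,
  010019037060068093107114129152174183207214224249270,
  012021035058066091109116135158168177201208230255270,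
  013020034059067090108117134159169176200209231254270,
  014023033056064089111118133156170179203210228253270,
  015022032057065088110119132157171178202211229252270,
  000028039059074086109113137149174178195223228248271,
  001029038058075087108112136148175179194222229249271,
  002030037057072084111115139151172176193221230250271,
  004024035063078082105117141145170182199219224252271,
  005025034062079083104116140144171183198218225253271,
  007027032060077081106118142146169181196216227255271,
  008020047051066094101121129157166186203215236240271,
  010022045049064092103123131159164184201213238242271,
  011023044048065093102122130158165185200212239243271,
  013017042054071091096124132152163191206210233245271,
  014018041053068088099127135155160188205209234246271,
  015019040052069089098126134154161189204208235247271,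
  000001002003004005006007008009010011012013014015272,
  032033034035036037038039040041042043044045046047272,
  048049050051052053054055056057058059060061062063272,
  064065066067068069070071072073074075076077078079272,
  096097098099100101102103104105106107108109110111272,
  112113114115116117118119120121122123124125126127272,
  144145146147148149150151152153154155156157158159272,
  160161162163164165166167168169170171172173174175272,
  176177178179180181182183184185186187188189190191272,
  208209210211212213214215216217218219220221222223272,
  224225226227228229230231232233234235236237238239272,
  240241242243244245246247248249250251252253254255272,
  001016017026027030033049074107126158171186219234254,
  001035053069080097115129131133137153169185211225245,
  001039054065103118128145166183209230247257265267269,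
  001045056077104113152173177192193200204205220236252,
  001047050068081082084095100116159161178210239241256,
  002016018021023024034050069103120152167181215229248,
  002033063079098113129130132143148164180209226255256,
  002041054073102114150169178192194198201203219235251,
  002042051077082083090093109125128154162179211234242,
  002044062066080108126146174188210238252258262267268,
  003016019022028031035051079108118150172191220239246,
  003034058074099114128130131138141157173189210227250,
  003036062068110115158164179192195196199206215231247,
  003037049073080081083085089105121149163177209229243,
  003043056067107120147168187211232251256259262265271,
  004017018020031036052065111114146175177223225242256,
  004040058070080084086088090102118152164186218232244,
  004044059076107116128155172180196197203204213229245,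
  004016045057068109121148169189212233253260262264269,
  004046051067100126131132135142151167183192222228243,
  005020021027028037053075100124128156164187212235252,
  005033051065080099117147161181193195197201217233249,
  005016039056066082085087088098114151165184216231245,
  005042063069106127149175186192213239250257262263270,
  005045054070101125133134141142158174190221229246256,
  006020022024026038054068080104122154168180216228250,
  006033055070097119128150167177214231241258263264271,
  006034057075082086089091107123146166185192217226246,
  006037061069109118157165182197198205206222238254256,
  006016047060076102127131134140143147163179223230252,
  007019020023030039055078099116148163190192211238244,
  007038049071102113128151161182215225246259260268270,
  007016040053072101119149168183194197199200210226242,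
  007044057073103124135137138140154170186220231249256,
  007045059079080087091093095111127157167187219237247,
  008024025030031040056073110127128159174185222233255,
  008033061076081088092093108124145168189192221225248,
  008035059072099123152171179216235243256257264266268,
  008016037055071104117130133135136146162178213232247,
  008042052074080100120148170184196198200202214230246,
  009017019021025041057067080101113145165179213227241,
  009016036061073100125153173180217237244266267270271,
  009038050066105118130134137139155171187192214233242,
  009039060071108121156167185199201202204218234250256,
  009046063072088089094095104120128158169191223238249,
  010023025026028042058076105119151169188217236247256,
  010035050067098122128146163186194195202205221237253,
  010036056072080106116132134136138150166182212234248,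
  010016043062065081090091094097113155170190222235250,
  010047053074111117154165191192218229255259261264267,
  011018022025027043059070098121153162182192210230249,
  011036060069084085091092101117128148171188220228251,
  011039061077080107119135139141143159175191215235253,
  011040051075104115155163184219227248256258261269270,
  011016046058078106123154174187193202203206209225241,
  012017024028029044060072097125157161184192209232253,
  012016038063070111124159166188195198204207211227243,
  012041055074087089090092106122153172183215233252256,
  012043052068108123128132133139140149165181219236244,
  012046050076080110114156162190220226254257260261271,
  013018019026029045061066106115128147170178218226243,
  013038053078085086093094110126150173181213230253256,
  013040049065109120129136140141156172188192216237241,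
  013016041052077105116157164185221228249261263265268,
  013043055075080103125151171189199203205207223239255,
  014021022029030046062077102117149166189214237245256,
  014034060078080098124158172178222236242259263266269,
  014035052071083084087094103119147174180192212227254,
  014016042059075110122129138139142145161177218238251,
  014047057079105126128153175190200201206207216232248,
  015023027029031047063071080109123155173183221231251,
  015034049066097127145162191193194196207212228244256,
  015037058079101122159170181192223234245258260265266,
  015041062078111121128136137142143152168184217239254,
  015016044054067083086092095099115156175182214236255,
  017022023081086087128129134135193198199261262266272,
  018028030080082092094130140142194204206264265270272,
  019024027083088091131136139195200203256260263267272,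
  016020025029084089093132137141196201205257258259272,
  021026031085090095133138143192197202207268269271272,
  000016032048064080096112128144160176192208224240256]
  pointRows := [
  000012024036048060072084096108120132144156168180272,
  013025037049061073085109133157169180192193194195196,
  001026038050074086097110145158170180197198199200201,
  002014039051075087111121134146159180202203204205206,
  003015027052076098112122135160171180207208209210211,
  016028040053088099113123136147172180212213214215216,
  004029041054062100114124137148161180217218219220221,
  005017055063077089101115125149173180222223224225226,
  018030042056064078102126150162174180227228229230231,
  006019031043057065079090103138151180232233234235236,
  007020044066080104116139152163175180237238239240241,
  008032045067081091105117127140176180242243244245246,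
  021033068082092106118128141153164180247248249250251,
  009022034046069093119129154165177180252253254255256,
  010023047058070094107130142166178180257258259260261,
  011035059071083095131143155167179180262263264265266,
  192197202210214221224230233240246248255260266270272,
  000014026040083089107127137152162177192207232247267,
  002012025041059063082116126136151178197207242252268,
  001013024058062088106117135150163179202222232252269,
  036057061080086105118130134155165174207212217222270,
  003017029037056060081087104119131164197212232257271,
  005015028038078084103128133154167175202217242257267,
  004016027039079085102129132153166176197222237262267,
  006020032053069094101108143146157171197217227247269,
  046052068077095100109121142145156172227232237242270,
  008018031047055071076092099110120159192217237252271,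
  007019030054070093098111141144158173192212242262269,
  009023035042049065074112124140149168202212237247268,
  043048064075091097113125139148160169247252257262270,
  011021034044051067072114122138147170192222227257268,
  010022033045050066073090096115123161202207227262271,
  001014025044053064076090100119130140153167173181272,
  002024045052065101118131139154166181192198213218228,
  000013042055066091098128138165172181197203219258263,
  012026043054067077099129155164171181193202229238259,
  004017028047049068072093097143150181204207233239243,
  005027048069073092127142151163170181205212220230264,
  003016051070074095096117126152169181217223234248253,
  015029046050071075094116141162168181194214222235244,
  007031038060082085107113124134179181208224227245254,
  008020030039061084112125147161178181199232249255265,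
  019032036059087106115122133148177181200215231237260,
  006018037058083086114123132149160181206240242250256,
  010034041057078088104109144159176181201209225247266,
  011023033056079105108121137158175181195210216226252,
  022035062080089102111120136145157181211236246251257,
  009021040063081103110135146156174181196221241261262,
  002013026047056069080095103113122141149161176182272,
  001012057068081094102112123148175182192205223254263,
  014024071078093105115124142147160182196197234238251,
  000025046070079092104114125143174182200202211213245,
  005016029044065091109120146158179182207231250255259,
  004015045064083106108138145159178182193212224241253,
  017027042058067082090111139156177182194199216217266,
  003028043059066107110121140144157182218222230249256,
  008019041048074089119128135155166182195206214227239,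
  007018032049075096118129136167170182210219225232261,
  006030050063072088130137154164169182203208237246264,
  020031040051062073097131153165168182209226229242260,
  011022038052061087099126132163173182221235243247258,
  010021035039053060077086098133152182220228233244252,
  009033036054076085101117151162172182201204240257265,
  023034037055084100116127134150171182198215236248262,
  003022031042054063075086106109127143147166175183272,
  021030043055062074087108142167176183194207213240254,
  004032044052073084107111149164174183201214234252263,
  005023045053072085110126141148165183206211232238266,
  000019034050077102113131140163178183196204210217250,
  018033046051089103112130139144179183193197215220243,
  001035047048061104115129138146162183208216218242248,
  002020049060076088105114128145177183223230235259262,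
  016025036058071081098121154161170183224229236239247,
  009015024037059070080091099137153183199205225227233,
  010017038069079100117136155160168183192203231241249,
  011026039068078090101116120135169183212219245256260,
  013028067083094096119125134151158183209221228237251,
  006012027040066095118124150159173183195200244255257,
  007014041056065092097123133156171183222246253258265,
  008029057064082093122132152157172183198202226261264,
  193201205208213217226231232239244251256258262268272,
  003023032046082088097120138155161173196205228240267,
  005022030047057060083117121139153171196200214219268,
  004021031056061089096116140154160172200205259266269,
  042059062079084101119123141152159170196208243259270,
  000020035043058063078085100118122158205214243253271,
  002019033044081086099125142150157168208219253266267,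
  001018034045080087098124143151156169214226249259267,
  009017026051066092105109132148167178208214228236269,
  040050067076093104108126133149166179205219236249270,
  011016024041049064077094103111127165200208240249271,
  010015025048065095102110134147164177219226240243269,
  006014029036055070073113129135145175228243249266268,
  037054071072090107112128136146163176200226228253270,
  008013027038053068075115131137144174236240253259268,
  007012028039052069074091106114130162196226236266271,
  004023030038051071077091104118123135151157177184272,
  005031039050070105119122136150156184193218240247263,
  003021036049069090102125137159179184198214238242258,
  022032037048068076103124152158178184203213222229266,
  001020033041055067075095107132154184196211212231233,
  002034054066074094120133153160174184216224232243264,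
  000018053065073093106116121155176184199208221223257,
  019035040052064072092117134161175184194197225256259,
  010024044063083087097112129141172184195217230236245,
  011017025045062086113128144162171184205234237255261,
  015026042057085096114131142146173184215239246249252,
  009016043056082084115130143145163184192206209219244,
  007027047059081089100108147165169184201202228235250,
  008014028058080101109126138164168184200210220254262,
  012029061079088098110127139149167184204227251253260,
  006013046060078099111140148166170184207226241248265,
  005021032041058066079093099112131134145162169185272,
  004022059067078092098113130146168185195198223232240,
  023031064081095101114129133144163185199203207214251,
  003030040065080094100115128132170185193204245252266,
  002018035038070090108127148164172185196209222239255,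
  001019039071082096109137149165171185213230241243257,
  020034036056068083091110136166173185194202208220234,
  000033037057069097111126135147167185218224237244259,
  011015047054073088118125140152156185197206231236254,
  010016026055072106119124139157174185205210235242265,
  009025052060075089123138150158176185217238249260264,
  017024046053061074107122151159175185219229246250262,
  008012044050062085103121143160177185212225228248258,
  007013029045051063076084102142155185200216233247256,
  006028042048077087105116153161179185192201211253261,
  014027043049086104117120141154178185215221226227263,
  194200203209212218223227236238243250252261265267272,
  006017035041076091096121141147163174193198254260267,
  007015033040058061077119120143148176198203230234268,
  008016034059060090097118142149162175193203211221269,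
  039056063073094099117124138144167177198211239250270,
  009014032038057062072095098116125166193216230250271,
  010012030037075092101122140145165179216221234239267,
  011013031036074093100123139146164178211225230244267,
  000023029052067086103115136153159169230239254265269,
  047053066082087102114127135154158168193225234265270,
  001021027046054065083084105113126157203225239260271,
  002022028055064085104112137155156170234244250260269,
  003020026045048071079111130133150172221225250254268,
  044049070078089106110131132151161171203216244254270,
  004018024043050069081109128134152173211216260265268,
  005019025042051068080088107108129160198221244265271,
  006015034039049062081092107115126139155158172186272,
  016033038048063080093114140159171186194228232260263,
  008035037051079094106113154156173186201207219230238,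
  007017036050078095112127138153157186206213221252259,
  009012031053083104111128142161169186198210222231243,
  013030041052090105110129143152168186205215224250257,
  011032040055060102109130141151160186199202218239253,
  010014054061082091103108131150170186211214223237256,
  021028045057070075100120149163177186195197208229265,
  000022027044056071074088101134148186193233242249261,
  002023043068073098119132147162179186200217225241246,
  001029042069072089099118121133178186209234240245262,
  018025066077084097117122137146166186212235251254266,
  003019024047067085116123145167174186203220226247255,
  005020046059064086096124135164176186192204216236258,
  004026058065076087125136144165175186196227244248264,
  007016035046057067073087101110128137150160178187272,
  008015056066072086100111129151179187196213223247260,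
  017034065075085099108130135152161187200230242251263,
  006033047064074084098109131136177187205221222238245,
  010013032043071089114126153156175187198204208212255,
  011012042070076097115134154157176187214220232241250,
  014031045059069077088112132158174187194219239248257,
  009030044058068096113127133155159187197211218226235,
  001022040049079091116122142144164187206217224228265,
  002021029048078107117123143165173187193199210236237,
  000028051061081090124141145166171187225231240252264,
  023027041050060080106125146167172187192229234243256,
  004019037053063095105120139162170187202209249254258,
  005018026036052062082094104140147187195203233253262,
  003025039055083093103118148163168187201216227246259,
  020024038054092102119121138149169187207215244261266,
  008017033043052070083088102116124133146165170188272,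
  007034042053071103117125132145164188195205207218260,
  006016045054068089104122134167168188196199230252258,
  015035044055069082105123144166169188200204221229232,
  011014030046048066081085106136149188198209217233259,
  010031049067080084121135148162173188197213250253264,
  009013050064079087107118120147171188220223239242266,
  012032047051065078086119137163172188194211224249262,
  002027037062077093096110130138175188214231245247265,
  001023028036063092111131152160176188193219227235255,
  022029039058095097108128140151174188192208215225238,
  000021038059076094109129139150161188206212226234246,
  005024040056075090098114155157178188201237243248254,
  004020025057074099115127141156179188203210228256257,
  019026060073091100112126143154159188216222240251261,
  003018041061072101113142153158177188202236241244263,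
  195199204211215219222228234241242247254259264271272,
  009020029047077090106126134144160170195213246263267,
  010019028046056062076118127132146169199224238263268,
  011018027057063091107119133145161168204213238248269,
  045058060074092103116129137147157173204209231263270,
  006023026044059061075093102117128156209213220224271,
  007022025043072094105131135149159172199220231248267,
  008021024042073095104130136148158171204224235256267,
  003014035050068084099114139151165176195224231261269,
  041051069083085098115120140150164175199213235261270,
  004013034040048070082086101112121167231235238246271,
  005012033049071087100113138152166174199209246256269,
  000017032039054064080110123142154179195209235248268,
  038055065081088096111122143153162178195220238256270,
  001016031037052066078108125141155177204220246261268,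
  002015030036053067079089097109124163248256261263271,
  009019027045055061078094097114121136152164179189272,
  018028044054060079095115135165178189194198205246247,
  011029043053080092096112150166177189196201203224242,
  010020042052081093113120137151167189193200206222248,
  006022024051082100110125133162176189210212239259263,
  021025047050091101111124132155175189209215230232253,
  008026046049063098108123134153163189218231234257266,
  007023048062083090099109122154174189197204223244249,
  013033039059065072104127145160173189214217229254261,
  003012034038058064073089105141146189213219233237265,
  005014037067074102118143144161172189208235241252260,
  004035036066075088103119126142171189192199226245250,
  016030069076086107116131138148156189195202225243251,
  000015031041068087117130149157170189216228238255262,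
  002017040057071084106129140158169189211220227240258,
  001032056070077085128139147159168189207221236256264,
  010018029040059068074085105111125138154163171190272,
  011019058069075084104110124153172190193207223228246,
  020027070072087103109123140155162190198219224251252,
  009028041071073086102108122139173190203232245248259,
  007021026037064088115121151166168190211217243255263,
  008022036065077107114141150167169190197205209216241,
  023024039057066076089113143164170190194221231242253,
  006025038056067106112120142152165190204214218225262,
  004012046055080090117131133147158190206208230247261,
  005013035054081097116130132159177190210213227234249,
  003033053062078091129134149156178190192200235239264,
  014034047052063079096128148157179190199212229240244,
  001015043051060093101127136161174190195237250258266,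
  002016032042050061083092100135144190226233238254257,
  000030045049082095099119146160175190201220222236260,
  017031044048094098118126137145176190196202215256265,
  011020028037050065082089098117129142148159174191272,
  010027036051064099116128143149158191196218232246254,
  009018039048067088100131141157175191200207224234258,
  019029038049066083101130147156176191205211229248252,
  008023025040054069078087096139145191208222233250263,
  007024055068079086126140146161177191193209214257264,
  006021052071080085097119127144178191202216219223231,
  022026041053070081084118138160179191194204226230237,
  005034043061076095106111123137168191197228239245261,
  004014033042060094110122155163169191213225236242255,
  012035045056093107109125135153170191203215217235240,
  003013044057077092108124136154162191199206243260262,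
  002031046058072091102115152167171191195201212221249,
  001017030059073103114120134166172191210238244247253,
  015032063074090104113121132150165191192220251259265,
  000016047062075105112133151164173191198227241256266,
  196198206207216220225229235237245249253257263269272,
  000001002003004005006007008009010011194215229251270,
  012013014015016017018019020021022023201218245264270,
  024025026027028029030031032033034035206223241258270,
  036037038039040041042043044045046047210223251264269,
  048049050051052053054055056057058059241245251255267,
  060061062063064065066067068069070071201206210215267,
  072073074075076077078079080081082083215218255258269,
  084085086087088089090091092093094095210218229241268,
  096097098099100101102103104105106107194206255264268,
  108109110111112113114115116117118119229233258264267,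
  120121122123124125126127128129130131194201233241269,
  132133134135136137138139140141142143201223229255271,
  144145146147148149150151152153154155194210245258271,
  156157158159160161162163164165166167215223233245268,
  168169170171172173174175176177178179206218233251271,
  180181182183184185186187188189190191267268269270271]

theorem derivedSemifieldB_isPlane : derivedSemifieldB.IsPlane := by
  constructor <;> decide +kernel

/-- Unitals in the plane with table `derivedSemifieldB`. -/
noncomputable def derivedSemifieldBUnitals : List TableUnital := [
  ⟨derivedSemifieldB, derivedSemifieldB_isPlane,
    7718240230533686620621942678212254896664138626437707003208178485476996928418907154,
    19, by decide +kernel⟩,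
  ⟨derivedSemifieldB, derivedSemifieldB_isPlane,
    3800188396748039813390835058135742092208961563524638014196870758712164696277486658,
    1024, by decide +kernel⟩,
  ⟨derivedSemifieldB, derivedSemifieldB_isPlane,
    16371632512673346494078514094628179621689603990674246366321348380825416377490,
    1153, by decide +kernel⟩,
  ⟨derivedSemifieldB, derivedSemifieldB_isPlane,
    116018263297155085821300296887513115414231694032195480979738412032802501075716,
    1952, by decide +kernel⟩,
  ⟨derivedSemifieldB, derivedSemifieldB_isPlane,
    14156240005821001269086637738169197131603901444057650428484925569938500144,
    2178, by decide +kernel⟩,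
  ⟨derivedSemifieldB, derivedSemifieldB_isPlane,
    180034911857838768918530376768766460831386736702767039122196133340892378465392,
    2659, by decide +kernel⟩,
  ⟨derivedSemifieldB, derivedSemifieldB_isPlane,
    126891644595979660522484988701981000539989554977350892771840534558282573025382,
    2851, by decide +kernel⟩,
  ⟨derivedSemifieldB, derivedSemifieldB_isPlane,
    11704388117047150363018054602980517778684930744188995610482376793996834316094542176,
    3042, by decide +kernel⟩,
  ⟨derivedSemifieldB, derivedSemifieldB_isPlane,
    10092439038579681758392086412624075447238887177812587482591847382367210454319630358,
    3297, by decide +kernel⟩,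
  ⟨derivedSemifieldB, derivedSemifieldB_isPlane,
    6562153416954270599598481096502006983621923197744894009723921310625036248240,
    3552, by decide +kernel⟩,
  ⟨derivedSemifieldB, derivedSemifieldB_isPlane,
    3862086396123868182151865713836350635530700159282064402900298300391653311393083428,
    4257, by decide +kernel⟩,
  ⟨derivedSemifieldB, derivedSemifieldB_isPlane,
    552115141943377589687025736545033119180392401868361148343125222528804079186041152,
    4354, by decide +kernel⟩,
  ⟨derivedSemifieldB, derivedSemifieldB_isPlane,
    119411986242145707460703195795173084165822426680857807645313832676792113199616,
    5280, by decide +kernel⟩,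
  ⟨derivedSemifieldB, derivedSemifieldB_isPlane,
    3800193496806876060298467420697726307865291640946205145686785558567350636065660928,
    5598, by decide +kernel⟩,
  ⟨derivedSemifieldB, derivedSemifieldB_isPlane,
    116697851999834499874201457597504166227675293961072910795172127741817651927316,
    5791, by decide +kernel⟩,
  ⟨derivedSemifieldB, derivedSemifieldB_isPlane,
    552100550878652150759695636036198612025391287480990204317865056715788458899610132,
    6144, by decide +kernel⟩,
  ⟨derivedSemifieldB, derivedSemifieldB_isPlane,
    5084658604597895479913650248578584731389534969332820205387043404932542413498657312,
    6722, by decide +kernel⟩,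
  ⟨derivedSemifieldB, derivedSemifieldB_isPlane,
    5996779068053341834344694830255272560829406837317683794790750555146688399176,
    7072, by decide +kernel⟩,
  ⟨derivedSemifieldB, derivedSemifieldB_isPlane,
    116018362182499046718670786514202646540358206137677634545909978664602954518572,
    7200, by decide +kernel⟩,
  ⟨derivedSemifieldB, derivedSemifieldB_isPlane,
    719329699881990035006129527740770426128193773853904871225242684535693260029568176,
    7233, by decide +kernel⟩]

/-- Unitals in the plane with table `derivedSemifieldB.dual`. -/
noncomputable def derivedSemifieldBDualUnitals : List TableUnital := [
  ⟨derivedSemifieldB.dual, derivedSemifieldB_isPlane.dual,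
    8300472917571494122790523071461540768210718165520069850430607931615500948086066178,
    163, by decide +kernel⟩,
  ⟨derivedSemifieldB.dual, derivedSemifieldB_isPlane.dual,
    463168384583210322819066776405665944192447521151584549817745378619794673745921,
    996, by decide +kernel⟩,
  ⟨derivedSemifieldB.dual, derivedSemifieldB_isPlane.dual,
    8302297436565253930119611081488515182197206414495172917486667468105548414450729990,
    1250, by decide +kernel⟩,
  ⟨derivedSemifieldB.dual, derivedSemifieldB_isPlane.dual,
    13372654702428807349447614964923814755384397824201096251510169574169190509736894640,
    1730, by decide +kernel⟩,
  ⟨derivedSemifieldB.dual, derivedSemifieldB_isPlane.dual,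
    3802051378001435697845331270671131198454984446318540478732616655287137045036999844,
    1809, by decide +kernel⟩,
  ⟨derivedSemifieldB.dual, derivedSemifieldB_isPlane.dual,
    9193432844552209683676789978696892200377122725704357490450640403130524398099365958,
    1858, by decide +kernel⟩,
  ⟨derivedSemifieldB.dual, derivedSemifieldB_isPlane.dual,
    7590410393078797398034283398738883179425102225322270076372529120957528230293571627,
    2723, by decide +kernel⟩,
  ⟨derivedSemifieldB.dual, derivedSemifieldB_isPlane.dual,
    11475705274495827738415261815242780299822493384275751030510296825772334663376979108,
    3394, by decide +kernel⟩,
  ⟨derivedSemifieldB.dual, derivedSemifieldB_isPlane.dual,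
    8718681667271420703305666246284191716053637510086207291744784190498827624656144658,
    3457, by decide +kernel⟩,
  ⟨derivedSemifieldB.dual, derivedSemifieldB_isPlane.dual,
    1897600761954845420234431130916824516762981286326326016338380110261348558296356004,
    3938, by decide +kernel⟩,
  ⟨derivedSemifieldB.dual, derivedSemifieldB_isPlane.dual,
    11427296943640145734414014012578035914821580175366072183677293296482480135833425060,
    4800, by decide +kernel⟩,
  ⟨derivedSemifieldB.dual, derivedSemifieldB_isPlane.dual,
    13372654702428807349447611918643332701074344736125684845112111821977479924291078178,
    4833, by decide +kernel⟩,
  ⟨derivedSemifieldB.dual, derivedSemifieldB_isPlane.dual,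
    7828471684888427811916235732324873686043954939370122464841968478919781723655135576,
    6433, by decide +kernel⟩,
  ⟨derivedSemifieldB.dual, derivedSemifieldB_isPlane.dual,
    11649610518410242912070258222773629886521580247390713969037827555321161519940600070,
    7008, by decide +kernel⟩,
  ⟨derivedSemifieldB.dual, derivedSemifieldB_isPlane.dual,
    7714656568367814388371391938760906915068015646542652646744879199059408834321893909,
    7138, by decide +kernel⟩,
  ⟨derivedSemifieldB.dual, derivedSemifieldB_isPlane.dual,
    7589483935306575594077382104658723587931287177096260812746479794894418836526728192,
    7201, by decide +kernel⟩,
  ⟨derivedSemifieldB.dual, derivedSemifieldB_isPlane.dual,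
    9193432844552209683676791903206367889965551797724715027658304910579282814836424785,
    7361, by decide +kernel⟩,
  ⟨derivedSemifieldB.dual, derivedSemifieldB_isPlane.dual,
    11889074114798390598950199298598498779406708783488545724523266385256274504536228144,
    7392, by decide +kernel⟩,
  ⟨derivedSemifieldB.dual, derivedSemifieldB_isPlane.dual,
    463168384583210322821094268115394314636801533960747453029280359008791125233665,
    7650, by decide +kernel⟩]

/-- The incidence table of a plane derived from the plane of `semifieldB`. -/
def derivedSemifieldA : IncidenceTable where
  lineRows := [
  004021038055064081098115140157174191200217234251257,
  005020039054065080099114141156175190201216235250257,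
  006023036053066083096113142159172189202219232249257,
  007022037052067082097112143158173188203218233248257,
  008025042059076093110127128145162179196213230247257,
  009024043058077092111126129144163178197212231246257,
  010027040057078095108125130147160177198215228245257,
  011026041056079094109124131146161176199214229244257,
  012029046063072089106123132149166183192209226243257,
  013028047062073088107122133148167182193208227242257,
  014031044061074091104121134151164181194211224241257,
  015030045060075090105120135150165180195210225240257,
  004022039053073091106120130144161179207221236254258,
  005023038052072090107121131145160178206220237255258,
  006020037055075089104122128146163177205223238252258,
  007021036054074088105123129147162176204222239253258,
  008026043057069087102116142156173191195209224242258,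
  009027042056068086103117143157172190194208225243258,
  010024041059071085100118140158175189193211226240258,
  011025040058070084101119141159174188192210227241258,
  012030047061065083098112138152169187199213228246258,
  013031046060064082099113139153168186198212229247258,
  014028045063067081096114136154171185197215230244258,
  015029044062066080097115137155170184196214231245258,
  004023037054077094108127138153171184195208226241259,
  005022036055076095109126139152170185194209227240259,
  006021039052079092110125136155169186193210224243259,
  007020038053078093111124137154168187192211225242259,
  008027041058065082096115134149167180207220238253259,
  009026040059064083097114135148166181206221239252259,
  010025043056067080098113132151165182205222236255259,
  011024042057066081099112133150164183204223237254259,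
  012031045062069086100119130145163176203216234249259,
  013030044063068087101118131144162177202217235248259,
  014029047060071084102117128147161178201218232251259,
  015028046061070085103116129146160179200219233250259,
  001021043063073093099119134146172184206218228240260,
  002022040060074094096116133145175187205217231243260,
  003023041061075095097117132144174186204216230242260,
  005017047059077089103115130150168188202222224244260,
  006018044056078090100112129149171191201221227247260,
  007019045057079091101113128148170190200220226246260,
  008028034054064084106126143155165177199211237249260,
  009029035055065085107127142154164176198210236248260,
  011031033053067087105125140152166178196208238250260,
  012024038050068080110122139159161181195215233253260,
  013025039051069081111123138158160180194214232252260,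
  015027037049071083109121136156162182192212234254260,
  001028036057071090098127141144168181203214238243261,
  002031039058068089097124142147171182200213237240261,
  003030038059069088096125143146170183201212236241261,
  004025033060066095103122136149173176206211235246261,
  006027035062064093101120138151175178204209233244261,
  007026034063065092100121139150174179205208232245261,
  009020044049079082106119133152160189195222230251261,
  010023047050076081105116134155163190192221229248261,
  011022046051077080104117135154162191193220228249261,
  012017041052074087111114128157165184198219227254261,
  014019043054072085109112130159167186196217225252261,
  015018042055073084108113131158166187197216224253261,
  001020041060070083110123130151170191197208237248262,
  002023042063069080109120129148169188198211238251262,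
  003022043062068081108121128149168189199210239250262,
  004017044057067086107126135146175186192213232253262,
  006019046059065084105124133144173184194215234255262,
  007018047058064085104125132145172185195214235254262,
  009028033052078091102115138159162183205216229240262,
  010031034055077088101112137156161180206219230243262,
  011030035054076089100113136157160181207218231242262,
  012025036049075094099118143154167178200221224245262,
  014027038051073092097116141152165176202223226247262,
  015026039050072093096117140153164177203222227246262,
  001031037059066092102120132154160190199217227253263,
  002028038056065095101123135153163189196218224254263,
  003029039057064094100122134152162188197219225255263,
  005027033063070088098124128158164186195221231249263,
  006024034060069091097127131157167185192222228250263,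
  007025035061068090096126130156166184193223229251263,
  008022044050075085111113141147169183206208234244263,
  009023045051074084110112140146168182207209235245263,
  011021047049072086108114142144170180205211233247263,
  012018040054079081107117137151173179202212238240263,
  013019041055078080106116136150172178203213239241263,
  015017043053076082104118138148174176201215237243263,
  001023040062067085106124139157162180201223224246264,
  002020043061064086105127136158161183202220227245264,
  003021042060065087104126137159160182203221226244264,
  004018045059070080111121142152167177204218229243264,
  005019044058071081110120143153166176205219228242264,
  007017046056069083108122141155164178207217230240264,
  008030033055074092099117130148171189192214233255264,
  010028035053072094097119128150169191194212235253264,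
  011029034052073095096118129151168190195213234252264,
  012026037051078088103113134144175185196210237251264,
  013027036050079089102112135145174184197211236250264,
  014024039049076090101115132146173187198208239249264,
  001030039056077082107116128159166185204211234245265,
  002029036059078081104119131156165186207208233246265,
  003028037058079080105118130157164187206209232247265,
  004027034061072087110113133154163188201214239240265,
  005026035060073086111112132155162189200215238241265,
  007024033062075084109114134153160191202213236243265,
  008023046049068091098125137150175176197218227252265,
  010021044051070089096127139148173178199216225254265,
  011020045050071088097126138149172179198217224255265,
  012019042053064095102121141146171180193222231248265,
  013018043052065094103120140147170181192223230249265,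
  014017040055066093100123143144169182195220229250265,
  001025044052064088109117142150163187207215226250266,
  002026047055067091110118141149160184204212225249266,
  003027046054066090111119140148161185205213224248266,
  004028041049069093104112139147166190202210231255266,
  006030043051071095106114137145164188200208229253266,
  007031042050070094107115136144165189201209228252266,
  009017036060072080101125134158171179199223234242266,
  010018039063075083102126133157168176196220233241266,
  011019038062074082103127132156169177197221232240266,
  012020033057077085096120131155174182194218239247266,
  014022035059079087098122129153172180192216237245266,
  015023034058078086099123128152173181193217236244266,
  001027047053074080100126131153173183200210230252267,
  002024044054073083103125128154174180203209229255267,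
  003025045055072082102124129155175181202208228254267,
  005031043049078084096122135157169179204214226248267,
  006028040050077087099121132158170176207213225251267,
  007029041051076086098120133159171177206212224250267,
  008018038060067089109119138144164190193219239245267,
  009019039061066088108118139145165191192218238244267,
  011017037063064090110116137147167189194216236246267,
  012022034056071093105115142148160186197223235241267,
  013023035057070092104114143149161187196222234240267,
  015021033059068094106112141151163185198220232242267,
  001022042061078089101114140155167176195212232255268,
  002021041062077090102113143152164179192215235252268,
  003020040063076091103112142153165178193214234253268,
  004019047056075092096119137158162181198209237250268,
  005018046057074093097118136159163180199208236251268,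
  006017045058073094098117139156160183196211239248268,
  008031035052071080108123133146174185202221225246268,
  009030034053070081109122132147175184203220224247268,
  010029033054069082110121135144172187200223227244268,
  013026038049066085105126128151171188207216228243268,
  014025037050065086106125131148168191204219231240268,
  015024036051064087107124130149169190205218230241268,
  001026045054068095104115133158169178192219236247269,
  002025046053071092107112134157170177195216239244269,
  003024047052070093106113135156171176194217238245269,
  004031040051065090109118128155172183197222233242269,
  005030041050064091108119129154173182196223232243269,
  006029042049067088111116130153174181199220235240269,
  008019036063077086097122140151160187201210229254269,
  009018037062076087096123141150161186200211228255269,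
  010017038061079084099120142149162185203208231252269,
  013022033058072083100127137146165190204215224251269,
  014021034057075080103124138145166189207212227248269,
  015020035056074081102125139144167188206213226249269,
  001024046055079086096121138147165188196221235242270,
  002027045052076085099122137144166191199222232241270,
  003026044053077084098123136145167190198223233240270,
  004029043050074083101124143150160185193216238247270,
  005028042051075082100125142151161184192217239246270,
  007030040049073080102127140149163186194219237244270,
  008017039062070095105112131154172181205212226251270,
  010019037060068093107114129152174183207214224249270,
  011018036061069092106115128153175182206215225248270,
  012021035058066091109116135158168177201208230255270,
  013020034059067090108117134159169176200209231254270,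
  014023033056064089111118133156170179203210228253270,
  001029038058075087108112136148175179194222229249271,
  002030037057072084111115139151172176193221230250271,
  003031036056073085110114138150173177192220231251271,
  004024035063078082105117141145170182199219224252271,
  005025034062079083104116140144171183198218225253271,
  006026033061076080107119143147168180197217226254271,
  008020047051066094101121129157166186203215236240271,
  009021046050067095100120128156167187202214237241271,
  010022045049064092103123131159164184201213238242271,
  013017042054071091096124132152163191206210233245271,
  014018041053068088099127135155160188205209234246271,
  015019040052069089098126134154161189204208235247271,
  064065066067068069070071072073074075076077078079272,
  080081082083084085086087088089090091092093094095272,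
  096097098099100101102103104105106107108109110111272,
  112113114115116117118119120121122123124125126127272,
  128129130131132133134135136137138139140141142143272,
  144145146147148149150151152153154155156157158159272,
  160161162163164165166167168169170171172173174175272,
  176177178179180181182183184185186187188189190191272,
  192193194195196197198199200201202203204205206207272,
  208209210211212213214215216217218219220221222223272,
  224225226227228229230231232233234235236237238239272,
  240241242243244245246247248249250251252253254255272,
  000001002003017018019033034035049050051257258259272,
  001004012013016076084097125129156164189205220225244,
  001005009014032069094105113137149174177193213233254,
  001006007008048072081103118135152161182198216231241,
  001010011015065091111122143145171186202209239251256,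
  002004008015032079088100114132159168178194223228248,
  002005007010016066087106117138146167181197210234247,
  002006012014070082108126140150162190206214236242256,
  002009011013048075093098121130155173185201219226253,
  003004007009071089099116131151169180196215227249256,
  003005012015048067092101127133147172191207211229252,
  003006010013032074086109115141154166179195218237246,
  003008011014016078083107120139158163184200222235243,
  000004005006011068085102123134148165187203212230245,
  004010014020026030036042046048052058062260263267272,
  005008013021024029037040045053056061256261262266272,
  006009015016022025031038041047054057063264265270272,
  007011012023027028032039043044055059060268269271272,
  000007013014015077095110119142157175183199221238255,
  000008009010012073090104124136153170188204217232250,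
  016017020028029068092109113140145173180204221228241,
  017021025030032078085097121133153161190197209238249,
  017022023024048065088102119136151166177200214225247,
  017026027031075081106127129159170187193218235255256,
  018020024031032072095098116143148162184207210232244,
  016018021023026071082101122130154165183194213231250,
  018022028030066086110124134156174178198222226252256,
  018025027029048077091105114139146169189203217237242,
  019020023025073087100115135147164185199212233243256,
  019021028031048076083111117131149175188195223236245,
  019022026029032070090099125138157163182202211230253,
  016019024027030067094104123142155168179206216227251,
  000020021022027069084107118132150171181196219229246,
  000023029030031079093103126141158167191205215239254,
  000024025026028074089108120137152172186201220234248,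
  016033036044045065093108116132157161188193212237252,
  032033037041046073081101126142145169181201222225245,
  033038039040048071086104113129150167184199209230248,
  033042043047079090097123139154175177207219234241256,
  032034036040047068082111120136146164191196216226255,
  016034037039042074085098119135149170178202215229242,
  034038044046076094102114130158172182204210238246256,
  034041043045048066089107125141153162187194221233251,
  035036039041067084103121137148163183195217228247256,
  035037044047048069095099124140159165179197220239243,
  032035038042045077083106118134147173186205214227250,
  016035040043046075088110115131152171190203211232254,
  000036037038043070091100117133155166180198213235244,
  000039045046047078087109127143151174189206223231253,
  000040041042044072092105122138156168185200218236249,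
  016049052060061077081100124141148172177196209236253,
  032049053057062065089110117129158165185206217229241,
  048049054055056070087097120134145168183193215232246,
  049058059063074095107113138155161191203223225250256,
  032050052056063066084104127130152175180200212239242,
  016050053055058069090103114133151162186199218226245,
  050054060062078092098118142146166188194220230254256,
  048050057059061073082109123137157171178205210235249,
  051052055057068083105119132153167179201211231244256,
  048051053060063079085108115143156163181204213227255,
  032051054058061067093102122131150170189198221234243,
  016051056059062072091099126136147174187195219238248,
  000052053054059075086101116139149164182197214228251,
  000055061062063071094111125135159173190207222237247,
  000056057058060076088106121140154169184202216233252,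
  000065081097113130146162178195211227243266267270271,
  000066082098114131147163179193209225241260262264269,
  000067083099115129145161177194210226242261263265268,
  048068084100116138154170186206222238254257264266268,
  069085101117136152168184205221237253256257265267269,
  016070086102118137153169185207223239255257260261271,
  032071087103119139155171187204220236252257262263270,
  072088104120141157173189197213229245256259260268270,
  016073089105121143159175191198214230246259263266269,
  048074090106122142158174190196212228244259262265271,
  032075091107123140156172188199215231247259261264267,
  032076092108124135151167183203219235251258260265266,
  077093109125133149165181200216232248256258263264271,
  048078094110126132148164180202218234250258261269270,
  016079095111127134150166182201217233249258262267268,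
  000016032048064080096112128144160176192208224240256]
  pointRows := [
  192205210211224225226239240241254255256257258259272,
  036048060072084096108120132144156168192193194195196,
  037049061073085097109121133145157169192197198199200,
  038050062074086098110122134146158170192201202203204,
  000012024051063087099111135147159171193197201205206,
  001013025039075088100123136148160172194198202205207,
  002014026040052064076112124137149173195199203205208,
  003015027041053065077089101113125161195198201209210,
  004016028042078090102126138150162174195197204207211,
  005017029043054066079114127139151175194200201208211,
  006018030055067091103115140152163176196198203206211,
  007019031044056068080092104116128164196200204205209,
  008020032045057069081093105117129165193199202209211,
  009021033046082094106130141153166177193200203207210,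
  010022034058070095107118142154167178194199204206210,
  011023035047059071083119131143155179196197202208210,
  193198204208212217223227232238242247253262265271272,
  039057063083089107114128137152162177192212213214215,
  040059065081087106115126136151164178192216217218219,
  041058064082088105116127135150163179192220221222223,
  001014027054060085104117134155166174206212216220224,
  000015026036080086103131133154165175207213217221224,
  003012025037056062078118129132153176208214218222224,
  002013024038055061079084102119130167209214217220225,
  005018031045076095101121143146156171207214216223226,
  004019030046051069077108122142145172208213219220226,
  007016029053071093100109141144158173206215217222226,
  006017028047052070075094099110120157209215219223224,
  009022035042048066073091098111124160209212218221226,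
  008023034043074092097125140149159168207212219222225,
  011020033050068090096112139148161169206213218223225,
  010021032044049067072113123138147170208215216221225,
  194197203209213216222228231237243246252263267268272,
  044051066075090101117131140153167173192227228229230,
  042053067076092099119129139154166172192231232233234,
  043052068077091100118130138155165171192235236237238,
  002015025048069094097114143150164170206227231235239,
  003014024047072093098128142151163169207228232236239,
  000013027045050070073116126141152168208229233237239,
  001012026046049071074095096115127162209229232235240,
  006019029037081084107124134147161179207229231238241,
  007018028038057060082111125133148178208228234235241,
  004017031059061086105113132149160177206230232237241,
  005016030036058062083085106112123159209230234238239,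
  010023033040054063078088103108121158209227233236241,
  011022032041079087104122137144157176207227234237240,
  008021035056064089102110136145156175206228233238240,
  009020034039055065080109120135146174208230231236240,
  195200202206214219221229234236244249251260266270272,
  047054069080095102111123141149161176192242243244245,
  045055071078094104113124142148159175192246247248249,
  046056070079093103112125143147160174192250251252253,
  003013026057066092106108138146157179206242246250254,
  002012027044083091105120139145158178207243247251254,
  001015024042058068081110121140144177208244248252254,
  000014025043059067082090107109122156209244247250255,
  007017030040073089096129135155167170207244246253256,
  006016031041048063074117130136154169208243249250256,
  005019028049065088098119137153165168206245247252256,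
  004018029039050064072087097118131166209245249253254,
  011021034037051060076086100114126163209242248251256,
  010020035038077085099127132152164173207242249252255,
  009023032052062084101116133151162172206243248253255,
  008022033036053061075115128134150171208245246251255,
  000021029042052065074085105108128143148167176180272,
  001020028043053064073086106142147180196214227243257,
  002023031051072107110127141165174180198218234246258,
  003022030044063084109126149166175180202223235252259,
  017033045049062077102131144163178180205212231250260,
  016032046050061076089111140164179180194224236247261,
  019035060075087103113130139146162180199222239244262,
  018034047048088104112129138145177180201217229255263,
  008013058071080091099114122153169180195216241253264,
  009012036059070092100121137161170180211220228249265,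
  010015037057079090116120136155159180203226232245266,
  011014038069078101115135154160168180200215238254267,
  004025055068083095125134151157173180193221233256268,
  005024039056067096117124133150158180210219237242269,
  006027040066082093097119123132171180204213240248270,
  007026041054081094098118152156172180197225230251271,
  001023030045056061082087098114120138154161173181272,
  000022031046055062081088097139155181195215228242257,
  003021028054083096116122140160171181199217231249258,
  002020029047060089115121153159172181204221237250259,
  019034042059064079101123152158169181193224235246260,
  018035043058065078084117141157170181205213232251261,
  017032063080085100119125142150156181203218229254262,
  016033044057086099118124143151168181198220240244263,
  009015050067075093104108127149178181197214238256264,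
  008014039049068094103126132167179181201226234243265,
  011013040048077095110128133147166181211222230247266,
  010012041066076102109134148165177181196219239253267,
  005026053070072090130135145164176181202212241248268,
  004027036052071107111129136146163181200225227252269,
  007024037069074091106113131137174181194223233255270,
  006025038051073092105112144162175181210216236245271,
  002022028037050071077092103117123135151156177182272,
  003023029038049070076091104136150182193213230244257,
  000020030048075102118125137158179182200216232248258,
  001021031036069090119124152157178182201222236253259,
  018032040053068074107120153160175182197220239242260,
  019033041052067073095114132159174182202217228254261,
  016034066072094105115122133155161182205214233252262,
  017035039051093106116121134154176182195225235247263,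
  010014056065083086097111130144172182211223229246264,
  011015044055064085098129141162171182194219241250265,
  008012042054082084112131142146164182198215237256266,
  009013043063081096113143145163173182204224234245267,
  006024059062080089127138148166168182199226227251268,
  007025047058061101108126139147165182203212240249269,
  004026045060079088099109128140170182210218238243270,
  005027046057078087100110149167169182196221231255271,
  003020031040058067079094100111131134145162168183272,
  002021030041059068078093099133146183194212229245257,
  001022029057080101112130132163170183197219233247258,
  000023028039066095113129144164169183203220238251259,
  016035037055070082096128149165172183201216227254260,
  017034038056071081090108137166171183198221239243261,
  018033069083092098109127136147167183195224237248262,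
  019032036054091097110126135148173183210214232250263,
  011012052061072088106117125152175183204226231244264,
  010013047053062087105124140156174183200213235256265,
  009014045051074089118123139150157183196217241252266,
  008015046060073107119138151158176183205223230249267,
  007027049064075084122143154159177183211218236242268,
  006026044050065102114121142155160183193222234255269,
  005025042063077086104115120141179183199225228253270,
  004024043048076085103116153161178183202215240246271,
  004014034041057062075091096119121141147164175184272,
  005015035040061092118122148163174184193215229243259,
  006012032039058060077090098143149184200217233246257,
  007013033059076097117120142162176184201221238252258,
  008030038065072095100116124139177184197224227250270,
  009031037054064099115125138144167184202213239247269,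
  010028036055074093101114145166179184205218237244271,
  011029056063073094123140146165178184195220232255268,
  022026047051068082085113136158168184211214231253261,
  023027067081086102112128135153157184194226235249262,
  020024046052066083104126154156170184198222241245260,
  021025045053084103111127137155169184204219230254263,
  000018044071079106110132150161172184199212236256267,
  001019048070078089105109131151171184203225234242264,
  002016043049080087108129134152160184210223228248266,
  003017042050069088107130133159173184196216240251265,
  005012033038048064080093107113126140155157172185272,
  004013032037065094112127154158171185196212228244259,
  007014035036050063079095105138153185198219231248257,
  006015034049078106111128139156173185202220237253258,
  009029041061083090103110129142168185205216235242270,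
  008028040051062104109130143152161185194221232254269,
  011031039053082091102108151159170185199224229252271,
  010030052060081092131141150160169185201214240247268,
  020025044054070074087119133163177185195226238246261,
  021024071073088101118120134149164185211213234250262,
  022027043056069072099121148162179185203217230256260,
  023026042055089100117122132147178185200223239245263,
  001016047067077097116137146167175185193218241251267,
  000017057068076084098115123145174185210222227249264,
  003018046059075085114124135144165185204225233243266,
  002019045058066086096125136166176185197215236255265,
  006013035046054068072086101109129137150159178186272,
  007012034045067085110130151160179186195213227245259,
  004015033047056066074084100135152186199216234247257,
  005014032055073099108131136161177186204222235251258,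
  010031043071075089098112126133176186193220231254270,
  011030042057070097113127134153156186205217236243269,
  008029044059077088096111154157174186203214239248271,
  009028058069076087128132155158175186198225229250268,
  021027039048062079092115142165173186197223241244261,
  020026061078091107116123143144166186201219228256262,
  023025041050060080106124145167171186211215232252260,
  022024040049090105114125141146172186196224238249263,
  002017036065082104118140147162169186202226233242267,
  003016051064081095103119120148170186200212237255264,
  000019038053083094117121138149163186194218240253266,
  001018037052063093102122139164168186210221230246265,
  007015032043051070083088102115124132146166169187272,
  006014033042071087116125145165170187194214230242259,
  005013034044052069082089103134144187197218232249257,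
  004012035053081104114123133167168187203223236250258,
  011028046067080084105118121136173187201212239246270,
  010029045048068106119122135149162187198224228251269,
  009030047049079086107117148164171187195222233254271,
  008031050066078085120137147163172187210217235244268,
  023024036057064077094109139160176187204216229256261,
  022025065076093096110131138152159187200220241243262,
  021026038058063075097129151161174187196226237247260,
  020027037059095098108130140150175187205215234253263,
  003019039061074099112141155156178187211221227248267,
  002018054062073090100113128154179187193219240252264,
  001017041055072092111126143153158187199213238255266,
  000016040056060091101127142157177187202225231245265,
  008019027047055063076090106118127133144160170188272,
  009018026056077105119126134159169188194215227244258,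
  010017025046064091117128146161168188197217234248259,
  011016024045054065075092107132145188203221235253257,
  004023044058073093115130137148156188201224231242266,
  005022059060074094102116129147173188198213236254264,
  006021043057061095104131135158172188195218239252265,
  007020042062072103114136149157171188210220229247267,
  000035041049069100112120140151166188204214241246269,
  001034040050083084099113150165176188200226228250271,
  002033039070081085101111122138175188196222232256270,
  003032048071082086121139152167174188205219238245268,
  015031038052087096109123142153179188211212233251263,
  014030037053066080088110143162178188193225237249261,
  013029036051067078098125155164177188199223240243260,
  012028068079089097108124141154163188202216230255262,
  009017024044053060078095097112122136152165179189272,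
  008016025052079098113121135166178189196213229242258,
  011019026043062093111120150167177189198216233249259,
  010018027042051061080094096137151189202222238250257,
  005021047050081091109125132154162189205220227246266,
  004020049063082092101110124155176189194217239251264,
  007023046048065090099123134163175189199214237254265,
  006022045064083100108133153164174189201225232244267,
  001032038059066103118128141145159189195223231256269,
  000033037058072089104119146160173189211219235243271,
  003034036068073087102117127143172189203215241247270,
  002035057067074088126142144161171189200224230253268,
  013028041056085107115131139149170189193226236248263,
  012029040055069075086116138156169189210212234252261,
  015030039054071076105130147157168189204218228255260,
  014031070077084106114129140148158189197221240245262,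
  010016026039059069073084104110125139153163171190272,
  011017027058074103109124138164172190193214228245258,
  008018024041070086108123155162173190200218231247259,
  009019025040057071072085102140154190201223237251257,
  006020036056076088113122141151167190197212235254266,
  007021055066077087107112121150168190202224232243264,
  004022038054067089106120143165169190205222229248265,
  005023037068075105111142152166170190195217240250267,
  002034046053063098116131132148157190211216238244269,
  003035045052080090097115147158177190194220234256271,
  000032047064078092096114130134178190198226230252270,
  001033051065079091129133149156179190204215239249268,
  012030043050094101119128136144174190199221241242263,
  013031042049060083093118135161175190203219227255261,
  014028044048061081100127146159176190210213233253260,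
  015029062082095099117126137145160190196225236246262,
  011018025036049066081089099116130142149158174191272,
  010019024050082100115129143157175191195212230243258,
  009016027038068088114131147156176191199219232246259,
  008017026037048067083087101141148191204220236252257,
  007022039052078086119127140145161191193216239250266,
  006023053069079085096118126146177191205221228247264,
  005020041051071084097128138160178191203224233244265,
  004021040070080098117139144159179191198214235255267,
  003033043055060105110123137154164191197226229253269,
  002032042056075095106109155163168191201213241249271,
  001035044062076094107108125135169191211217237245270,
  000034054061077093124136153162170191196223234254268,
  014029046058092102113120133152171191202218227256263,
  015028045059063072091112134167172191200222240242261,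
  012031047057065073103122150166173191194225238248260,
  013030064074090104111121132151165191210215231251262,
  196199201207215218220230233235245248250261264269272,
  000001002003004005006007008009010011192260261262263,
  012013014015016017018019020021022023192268269270271,
  024025026027028029030031032033034035192264265266267,
  036037038039040041042043044045046047206258262264268,
  048049050051052053054055056057058059207259262267270,
  060061062063064065066067068069070071207258263266271,
  072073074075076077078079080081082083206259263265269,
  084085086087088089090091092093094095208258260267269,
  096097098099100101102103104105106107208259261266268,
  108109110111112113114115116117118119207257260265268,
  120121122123124125126127128129130131206257261267271,
  132133134135136137138139140141142143209259260264271,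
  144145146147148149150151152153154155209258261265270,
  156157158159160161162163164165166167208257263264270,
  168169170171172173174175176177178179209257262266269,
  180181182183184185186187188189190191192206207208209]

theorem derivedSemifieldA_isPlane : derivedSemifieldA.IsPlane := by
  constructor <;> decide +kernel

/-- Unitals in the plane with table `derivedSemifieldA`. -/
noncomputable def derivedSemifieldAUnitals : List TableUnital := [
  ⟨derivedSemifieldA, derivedSemifieldA_isPlane,
    14249248504665010973035436180429000041733870967226688247666921778803392658,
    383, by decide +kernel⟩,
  ⟨derivedSemifieldA, derivedSemifieldA_isPlane,
    12805810158533103595111624241663972180163867976464758957290195427483250354397848641,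
    960, by decide +kernel⟩,
  ⟨derivedSemifieldA, derivedSemifieldA_isPlane,
    57319063662013837299584665548318874973217182292406679728015061941072565344,
    2465, by decide +kernel⟩,
  ⟨derivedSemifieldA, derivedSemifieldA_isPlane,
    1919632635058914310797964409086524940981170253142631123933725071464350560397869216,
    3137, by decide +kernel⟩,
  ⟨derivedSemifieldA, derivedSemifieldA_isPlane,
    147466170244563555270238326034797524304727484897315072194908495941590152456241,
    4162, by decide +kernel⟩,
  ⟨derivedSemifieldA, derivedSemifieldA_isPlane,
    180377416859940424014968501564442838851275825963802441598935625688184024981897415,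
    5296, by decide +kernel⟩,
  ⟨derivedSemifieldA, derivedSemifieldA_isPlane,
    13637297517852124589021246715384927233202572276122734964107297944830167442876663552,
    5601, by decide +kernel⟩,
  ⟨derivedSemifieldA, derivedSemifieldA_isPlane,
    6047145980706971416750468545345248538338849664396388191903929914971214540712707353,
    6112, by decide +kernel⟩,
  ⟨derivedSemifieldA, derivedSemifieldA_isPlane,
    13637297518622481791926739835791694453992997223791812962369983927542407706888376896,
    6272, by decide +kernel⟩,
  ⟨derivedSemifieldA, derivedSemifieldA_isPlane,
    189527276054309854799091633711767078795175501277701477084616276937446678155361,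
    6322, by decide +kernel⟩]

/-- Unitals in the plane with table `derivedSemifieldA.dual`. -/
noncomputable def derivedSemifieldADualUnitals : List TableUnital := [
  ⟨derivedSemifieldA.dual, derivedSemifieldA_isPlane.dual,
    7588579704948334939773985627071638748356565632306184649541379059333757443703833600,
    417, by decide +kernel⟩,
  ⟨derivedSemifieldA.dual, derivedSemifieldA_isPlane.dual,
    12431468554077331557147665793249321479646854039474831024105796872823498791577002006,
    2400, by decide +kernel⟩,
  ⟨derivedSemifieldA.dual, derivedSemifieldA_isPlane.dual,
    444641622671294190426518883317330663558480372504898233146755792102114501407473904,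
    2468, by decide +kernel⟩,
  ⟨derivedSemifieldA.dual, derivedSemifieldA_isPlane.dual,
    11451144795423420943772258062803947662156732731611644440982913397832174247216710689,
    3202, by decide +kernel⟩,
  ⟨derivedSemifieldA.dual, derivedSemifieldA_isPlane.dual,
    11449525868860905769321342678480321307636879415966245707974665563831529586303197354,
    3392, by decide +kernel⟩,
  ⟨derivedSemifieldA.dual, derivedSemifieldA_isPlane.dual,
    7588608830544193394475416048650309711873679209845816320841535336973694280892154880,
    4130, by decide +kernel⟩,
  ⟨derivedSemifieldA.dual, derivedSemifieldA_isPlane.dual,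
    14850335446412081173815026363030524434451317145870121777418357069521534504810762,
    5155, by decide +kernel⟩,
  ⟨derivedSemifieldA.dual, derivedSemifieldA_isPlane.dual,
    444641622671294190426519090204362233724661915658115304846568635996627290540935520,
    5523, by decide +kernel⟩,
  ⟨derivedSemifieldA.dual, derivedSemifieldA_isPlane.dual,
    7590174170533595538543627884854118531835280098545707222979764898613572030243471360,
    5537, by decide +kernel⟩,
  ⟨derivedSemifieldA.dual, derivedSemifieldA_isPlane.dual,
    14850335446412081173816267621387448771703620315987572804383314058567189849442912,
    5571, by decide +kernel⟩]

/-- The incidence table of the semifield plane with a collineation group of order `73728`. -/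
def semifieldA : IncidenceTable where
  lineRows := [
  000016032048064080096112128144160176192208224240256,
  001017033049065081097113129145161177193209225241256,
  002018034050066082098114130146162178194210226242256,
  003019035051067083099115131147163179195211227243256,
  004020036052068084100116132148164180196212228244256,
  005021037053069085101117133149165181197213229245256,
  006022038054070086102118134150166182198214230246256,
  007023039055071087103119135151167183199215231247256,
  008024040056072088104120136152168184200216232248256,
  009025041057073089105121137153169185201217233249256,
  010026042058074090106122138154170186202218234250256,
  011027043059075091107123139155171187203219235251256,
  012028044060076092108124140156172188204220236252256,
  013029045061077093109125141157173189205221237253256,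
  014030046062078094110126142158174190206222238254256,
  015031047063079095111127143159175191207223239255256,
  000017034051068085102119136153170187204221238255257,
  001016035050069084103118137152171186205220239254257,
  002019032049070087100117138155168185206223236253257,
  003018033048071086101116139154169184207222237252257,
  004021038055064081098115140157174191200217234251257,
  005020039054065080099114141156175190201216235250257,
  006023036053066083096113142159172189202219232249257,
  007022037052067082097112143158173188203218233248257,
  008025042059076093110127128145162179196213230247257,
  009024043058077092111126129144163178197212231246257,
  010027040057078095108125130147160177198215228245257,
  011026041056079094109124131146161176199214229244257,
  012029046063072089106123132149166183192209226243257,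
  013028047062073088107122133148167182193208227242257,
  014031044061074091104121134151164181194211224241257,
  015030045060075090105120135150165180195210225240257,
  000018045063065083108126138152167181203217230244258,
  001019044062064082109127139153166180202216231245258,
  002016047061067081110124136154165183201219228246258,
  003017046060066080111125137155164182200218229247258,
  004022041059069087104122142156163177207221226240258,
  005023040058068086105123143157162176206220227241258,
  006020043057071085106120140158161179205223224242258,
  007021042056070084107121141159160178204222225243258,
  008026037055073091100118130144175189195209238252258,
  009027036054072090101119131145174188194208239253258,
  010024039053075089102116128146173191193211236254258,
  011025038052074088103117129147172190192210237255258,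
  012030033051077095096114134148171185199213234248258,
  013031032050076094097115135149170184198212235249258,
  014028035049079093098112132150169187197215232250258,
  015029034048078092099113133151168186196214233251258,
  000019047060072091103116142157161178198213233250259,
  001018046061073090102117143156160179199212232251259,
  002017045062074089101118140159163176196215235248259,
  003016044063075088100119141158162177197214234249259,
  004023043056076095099112138153165182194209237254259,
  005022042057077094098113139152164183195208236255259,
  006021041058078093097114136155167180192211239252259,
  007020040059079092096115137154166181193210238253259,
  008027039052064083111124134149169186206221225242259,
  009026038053065082110125135148168187207220224243259,
  010025037054066081109126132151171184204223227240259,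
  011024036055067080108127133150170185205222226241259,
  012031035048068087107120130145173190202217229246259,
  013030034049069086106121131144172191203216228247259,
  014029033050070085105122128147175188200219231244259,
  015028032051071084104123129146174189201218230245259,
  000028036056069089097125139151175179206210234246260,
  001029037057068088096124138150174178207211235247260,
  002030038058071091099127137149173177204208232244260,
  003031039059070090098126136148172176205209233245260,
  004024032060065093101121143147171183202214238242260,
  005025033061064092100120142146170182203215239243260,
  006026034062067095103123141145169181200212236240260,
  007027035063066094102122140144168180201213237241260,
  008020044048077081105117131159167187198218226254260,
  009021045049076080104116130158166186199219227255260,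
  010022046050079083107119129157165185196216224252260,
  011023047051078082106118128156164184197217225253260,
  012016040052073085109113135155163191194222230250260,
  013017041053072084108112134154162190195223231251260,
  014018042054075087111115133153161189192220228248260,
  015019043055074086110114132152160188193221229249260,
  000020041061066086107127135147174186197209236248261,
  001021040060067087106126134146175187196208237249261,
  002022043063064084105125133145172184199211238250261,
  003023042062065085104124132144173185198210239251261,
  004016045057070082111123131151170190193213232252261,
  005017044056071083110122130150171191192212233253261,
  006018047059068080109121129149168188195215234254261,
  007019046058069081108120128148169189194214235255261,
  008028033053074094099119143155166178205217228240261,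
  009029032052075095098118142154167179204216229241261,
  010030035055072092097117141153164176207219230242261,
  011031034054073093096116140152165177206218231243261,
  012024037049078090103115139159162182201221224244261,
  013025036048079091102114138158163183200220225245261,
  014026039051076088101113137157160180203223226246261,
  015027038050077089100112136156161181202222227247261,
  000021046059074095100113131150173184201220231242262,
  001020047058075094101112130151172185200221230243262,
  002023044057072093102115129148175186203222229240262,
  003022045056073092103114128149174187202223228241262,
  004017042063078091096117135146169188205216227246262,
  005016043062079090097116134147168189204217226247262,
  006019040061076089098119133144171190207218225244262,
  007018041060077088099118132145170191206219224245262,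
  008029038051066087108121139158165176193212239250262,
  009028039050067086109120138159164177192213238251262,
  010031036049064085110123137156167178195214237248262,
  011030037048065084111122136157166179194215236249262,
  012025034055070083104125143154161180197208235254262,
  013024035054071082105124142155160181196209234255262,
  014027032053068081106127141152163182199210233252262,
  015026033052069080107126140153162183198211232253262,
  000022033055075093106124137159168190194212227245263,
  001023032054074092107125136158169191195213226244263,
  002020035053073095104126139157170188192214225247263,
  003021034052072094105127138156171189193215224246263,
  004018037051079089110120141155172186198208231241263,
  005019036050078088111121140154173187199209230240263,
  006016039049077091108122143153174184196210229243263,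
  007017038048076090109123142152175185197211228242263,
  008030041063067085098116129151160182202220235253263,
  009031040062066084099117128150161183203221234252263,
  010028043061065087096118131149162180200222233255263,
  011029042060064086097119130148163181201223232254263,
  012026045059071081102112133147164178206216239249263,
  013027044058070080103113132146165179207217238248263,
  014024047057069083100114135145166176204218237251263,
  015025046056068082101115134144167177205219236250263,
  000023035052077090110121133146166177200223235252264,
  001022034053076091111120132147167176201222234253264,
  002021033054079088108123135144164179202221233254264,
  003020032055078089109122134145165178203220232255264,
  004019039048073094106125129150162181204219239248264,
  005018038049072095107124128151163180205218238249264,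
  006017037050075092104127131148160183206217237250264,
  007016036051074093105126130149161182207216236251264,
  008031043060069082102113141154174185192215227244264,
  009030042061068083103112140155175184193214226245264,
  010029041062071080100115143152172187194213225246264,
  011028040063070081101114142153173186195212224247264,
  012027047056065086098117137158170189196211231240264,
  013026046057064087099116136159171188197210230241264,
  014025045058067084096119139156168191198209229242264,
  015024044059066085097118138157169190199208228243264,
  000024042050073081099123134158172180207215229253265,
  001025043051072080098122135159173181206214228252265,
  002026040048075083097121132156174182205213231255265,
  003027041049074082096120133157175183204212230254265,
  004028046054077085103127130154168176203211225249265,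
  005029047055076084102126131155169177202210224248265,
  006030044052079087101125128152170178201209227251265,
  007031045053078086100124129153171179200208226250265,
  008016034058065089107115142150164188199223237245265,
  009017035059064088106114143151165189198222236244265,
  010018032056067091105113140148166190197221239247265,
  011019033057066090104112141149167191196220238246265,
  012020038062069093111119138146160184195219233241265,
  013021039063068092110118139147161185194218232240265,
  014022036060071095109117136144162186193217235243265,
  015023037061070094108116137145163187192216234242265,
  000025040049071094111118141148165188202211226251266,
  001024041048070095110119140149164189203210227250266,
  002027042051069092109116143150167190200209224249266,
  003026043050068093108117142151166191201208225248266,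
  004029044053067090107114137144161184206215230255266,
  005028045052066091106115136145160185207214231254266,
  006031046055065088105112139146163186204213228253266,
  007030047054064089104113138147162187205212229252266,
  008017032057079086103126133156173180194219234243266,
  009016033056078087102127132157172181195218235242266,
  010019034059077084101124135158175182192217232241266,
  011018035058076085100125134159174183193216233240266,
  012021036061075082099122129152169176198223238247266,
  013020037060074083098123128153168177199222239246266,
  014023038063073080097120131154171178196221236245266,
  015022039062072081096121130155170179197220237244266,
  000026044054078084098120143149163185193219237247267,
  001027045055079085099121142148162184192218236246267,
  002024046052076086096122141151161187195217239245267,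
  003025047053077087097123140150160186194216238244267,
  004030040050074080102124139145167189197223233243267,
  005031041051075081103125138144166188196222232242267,
  006028042048072082100126137147165191199221235241267,
  007029043049073083101127136146164190198220234240267,
  008018036062070092106112135157171177201211229255267,
  009019037063071093107113134156170176200210228254267,
  010016038060068094104114133159169179203209231253267,
  011017039061069095105115132158168178202208230252267,
  012022032058066088110116131153175181205215225251267,
  013023033059067089111117130152174180204214224250267,
  014020034056064090108118129155173183207213227249267,
  015021035057065091109119128154172182206212226248267,
  000027037062076087105114129154164191205214232243268,
  001026036063077086104115128155165190204215233242268,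
  002025039060078085107112131152166189207212234241268,
  003024038061079084106113130153167188206213235240268,
  004031033058072083109118133158160187201210236247268,
  005030032059073082108119132159161186200211237246268,
  006029035056074081111116135156162185203208238245268,
  007028034057075080110117134157163184202209239244268,
  008019045054068095097122137146172183197222224251268,
  009018044055069094096123136147173182196223225250268,
  010017047052070093099120139144174181199220226249268,
  011016046053071092098121138145175180198221227248268,
  012023041050064091101126141150168179193218228255268,
  013022040051065090100127140151169178192219229254268,
  014021043048066089103124143148170177195216230253268,
  015020042049067088102125142149171176194217231252268,
  000029039058079082104117140145171182195222228249269,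
  001028038059078083105116141144170183194223229248269,
  002031037056077080106119142147169180193220230251269,
  003030036057076081107118143146168181192221231250269,
  004025035062075086108113136149175178199218224253269,
  005024034063074087109112137148174179198219225252269,
  006027033060073084110115138151173176197216226255269,
  007026032061072085111114139150172177196217227254269,
  008021047050071090096125132153163190203214236241269,
  009020046051070091097124133152162191202215237240269,
  010023045048069088098127134155161188201212238243269,
  011022044049068089099126135154160189200213239242269,
  012017043054067094100121128157167186207210232245269,
  013016042055066095101120129156166187206211233244269,
  014019041052065092102123130159165184205208234247269,
  015018040053064093103122131158164185204209235246269,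
  000030043053070088109115130156169183196218239241270,
  001031042052071089108114131157168182197219238240270,
  002028041055068090111113128158171181198216237243270,
  003029040054069091110112129159170180199217236242270,
  004026047049066092105119134152173179192222235245270,
  005027046048067093104118135153172178193223234244270,
  006024045051064094107117132154175177194220233247270,
  007025044050065095106116133155174176195221232246270,
  008022035061078080101123138148161191204210231249270,
  009023034060079081100122139149160190205211230248270,
  010020033063076082103121136150163189206208229251270,
  011021032062077083102120137151162188207209228250270,
  012018039057074084097127142144165187200214227253270,
  013019038056075085096126143145164186201215226252270,
  014016037059072086099125140146167185202212225255270,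
  015017036058073087098124141147166184203213224254270,
  000031038057067092101122132155162189199216225254271,
  001030039056066093100123133154163188198217224255271,
  002029036059065094103120134153160191197218227252271,
  003028037058064095102121135152161190196219226253271,
  004027034061071088097126128159166185195220229250271,
  005026035060070089096127129158167184194221228251271,
  006025032063069090099124130157164187193222231248271,
  007024033062068091098125131156165186192223230249271,
  008023046049075084109114140147170181207208233246271,
  009022047048074085108115141146171180206209232247271,
  010021044051073086111112142145168183205210235244271,
  011020045050072087110113143144169182204211234245271,
  012019042053079080105118136151174177203212237242271,
  013018043052078081104119137150175176202213236243271,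
  014017040055077082107116138149172179201214239240271,
  015016041054076083106117139148173178200215238241271,
  000001002003004005006007008009010011012013014015272,
  016017018019020021022023024025026027028029030031272,
  032033034035036037038039040041042043044045046047272,
  048049050051052053054055056057058059060061062063272,
  064065066067068069070071072073074075076077078079272,
  080081082083084085086087088089090091092093094095272,
  096097098099100101102103104105106107108109110111272,
  112113114115116117118119120121122123124125126127272,
  128129130131132133134135136137138139140141142143272,
  144145146147148149150151152153154155156157158159272,
  160161162163164165166167168169170171172173174175272,
  176177178179180181182183184185186187188189190191272,
  192193194195196197198199200201202203204205206207272,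
  208209210211212213214215216217218219220221222223272,
  224225226227228229230231232233234235236237238239272,
  240241242243244245246247248249250251252253254255272,
  256257258259260261262263264265266267268269270271272]
  pointRows := [
  000016032048064080096112128144160176192208224240256,
  001017033049065081097113129145161177193209225241256,
  002018034050066082098114130146162178194210226242256,
  003019035051067083099115131147163179195211227243256,
  004020036052068084100116132148164180196212228244256,
  005021037053069085101117133149165181197213229245256,
  006022038054070086102118134150166182198214230246256,
  007023039055071087103119135151167183199215231247256,
  008024040056072088104120136152168184200216232248256,
  009025041057073089105121137153169185201217233249256,
  010026042058074090106122138154170186202218234250256,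
  011027043059075091107123139155171187203219235251256,
  012028044060076092108124140156172188204220236252256,
  013029045061077093109125141157173189205221237253256,
  014030046062078094110126142158174190206222238254256,
  015031047063079095111127143159175191207223239255256,
  000017034051076084101118135152169186203221238255257,
  001016035050077085100119134153168187202220239254257,
  002019032049078086103116133154171184201223236253257,
  003018033048079087102117132155170185200222237252257,
  004021038055072080097114131156173190207217234251257,
  005020039054073081096115130157172191206216235250257,
  006023036053074082099112129158175188205219232249257,
  007022037052075083098113128159174189204218233248257,
  008025042059068092109126143144161178195213230247257,
  009024043058069093108127142145160179194212231246257,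
  010027040057070094111124141146163176193215228245257,
  011026041056071095110125140147162177192214229244257,
  012029046063064088105122139148165182199209226243257,
  013028047062065089104123138149164183198208227242257,
  014031044061066090107120137150167180197211224241257,
  015030045060067091106121136151166181196210225240257,
  000018045063068089110113131154168188197215235246258,
  001019044062069088111112130155169189196214234247258,
  002016047061070091108115129152170190199213233244258,
  003017046060071090109114128153171191198212232245258,
  004022041059064093106117135158172184193211239242258,
  005023040058065092107116134159173185192210238243258,
  006020043057066095104119133156174186195209237240258,
  007021042056067094105118132157175187194208236241258,
  008026037055076081102121139146160180205223227254258,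
  009027036054077080103120138147161181204222226255258,
  010024039053078083100123137144162182207221225252258,
  011025038052079082101122136145163183206220224253258,
  012030033051072085098125143150164176201219231250258,
  013031032050073084099124142151165177200218230251258,
  014028035049074087096127141148166178203217229248258,
  015029034048075086097126140149167179202216228249258,
  000019047060072093107119132146161182206218229249259,
  001018046061073092106118133147160183207219228248259,
  002017045062074095105117134144163180204216231251259,
  003016044063075094104116135145162181205217230250259,
  004023043056076089111115128150165178202222225253259,
  005022042057077088110114129151164179203223224252259,
  006021041058078091109113130148167176200220227255259,
  007020040059079090108112131149166177201221226254259,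
  008027039052064085099127140154169190198210237241259,
  009026038053065084098126141155168191199211236240259,
  010025037054066087097125142152171188196208239243259,
  011024036055067086096124143153170189197209238242259,
  012031035048068081103123136158173186194214233245259,
  013030034049069080102122137159172187195215232244259,
  014029033050070083101121138156175184192212235247259,
  015028032051071082100120139157174185193213234246259,
  000020033056069082106123141153167190204223230243260,
  001021032057068083107122140152166191205222231242260,
  002022035058071080104121143155165188206221228241260,
  003023034059070081105120142154164189207220229240260,
  004016037060065086110127137157163186200219226247260,
  005017036061064087111126136156162187201218227246260,
  006018039062067084108125139159161184202217224245260,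
  007019038063066085109124138158160185203216225244260,
  008028041048077090098115133145175182196215238251260,
  009029040049076091099114132144174183197214239250260,
  010030043050079088096113135147173180198213236249260,
  011031042051078089097112134146172181199212237248260,
  012024045052073094102119129149171178192211234255260,
  013025044053072095103118128148170179193210235254260,
  014026047054075092100117131151169176194209232253260,
  015027046055074093101116130150168177195208233252260,
  000021035059073086111125138145174180199210232252261,
  001020034058072087110124139144175181198211233253261,
  002023033057075084109127136147172182197208234254261,
  003022032056074085108126137146173183196209235255261,
  004017039063077082107121142149170176195214236248261,
  005016038062076083106120143148171177194215237249261,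
  006019037061079080105123140151168178193212238250261,
  007018036060078081104122141150169179192213239251261,
  008029043051065094103117130153166188207218224244261,
  009028042050064095102116131152167189206219225245261,
  010031041049067092101119128155164190205216226246261,
  011030040048066093100118129154165191204217227247261,
  012025047055069090099113134157162184203222228240261,
  013024046054068091098112135156163185202223229241261,
  014027045053071088097115132159160186201220230242261,
  015026044052070089096114133158161187200221231243261,
  000022044055065091100122142147175178201216237245262,
  001023045054064090101123143146174179200217236244262,
  002020046053067089102120140145173176203218239247262,
  003021047052066088103121141144172177202219238246262,
  004018040051069095096126138151171182205220233241262,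
  005019041050068094097127139150170183204221232240262,
  006016042049071093098124136149169180207222235243262,
  007017043048070092099125137148168181206223234242262,
  008030036063073083108114134155167186193208229253262,
  009031037062072082109115135154166187192209228252262,
  010028038061075081110112132153165184195210231255262,
  011029039060074080111113133152164185194211230254262,
  012026032059077087104118130159163190197212225249262,
  013027033058076086105119131158162191196213224248262,
  014024034057079085106116128157161188199214227251262,
  015025035056078084107117129156160189198215226250262,
  000023046052077095097124137155166184194213227250263,
  001022047053076094096125136154167185195212226251263,
  002021044054079093099126139153164186192215225248263,
  003020045055078092098127138152165187193214224249263,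
  004019042048073091101120141159162188198209231254263,
  005018043049072090100121140158163189199208230255263,
  006017040050075089103122143157160190196211229252263,
  007016041051074088102123142156161191197210228253263,
  008031038060069087105116129147174176202221235242263,
  009030039061068086104117128146175177203220234243263,
  010029036062071085107118131145172178200223233240263,
  011028037063070084106119130144173179201222232241263,
  012027034056065083109112133151170180206217239246263,
  013026035057064082108113132150171181207216238247263,
  014025032058067081111114135149168182204219237244263,
  015024033059066080110115134148169183205218236245263,
  000024042062075087099121133150173191193220226244264,
  001025043063074086098120132151172190192221227245264,
  002026040060073085097123135148175189195222224246264,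
  003027041061072084096122134149174188194223225247264,
  004028046058079083103125129146169187197216230240264,
  005029047059078082102124128147168186196217231241264,
  006030044056077081101127131144171185199218228242264,
  007031045057076080100126130145170184198219229243264,
  008016034054067095107113141158165183201212234252264,
  009017035055066094106112140159164182200213235253264,
  010018032052065093105115143156167181203214232254264,
  011019033053064092104114142157166180202215233255264,
  012020038050071091111117137154161179205208238248264,
  013021039051070090110116136155160178204209239249264,
  014022036048069089109119139152163177207210236250264,
  015023037049068088108118138153162176206211237251264,
  000025040061071083102127130158164181202209236251265,
  001024041060070082103126131159165180203208237250265,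
  002027042063069081100125128156166183200211238249265,
  003026043062068080101124129157167182201210239248265,
  004029044057067087098123134154160177206213232255265,
  005028045056066086099122135155161176207212233254265,
  006031046059065085096121132152162179204215234253265,
  007030047058064084097120133153163178205214235252265,
  008017032053079091110119138150172189194217228243265,
  009016033052078090111118139151173188195216229242265,
  010019034055077089108117136148174191192219230241265,
  011018035054076088109116137149175190193218231240265,
  012021036049075095106115142146168185198221224247265,
  013020037048074094107114143147169184199220225246265,
  014023038051073093104113140144170187196223226245265,
  015022039050072092105112141145171186197222227244265,
  000026039049079094109120134156165179196219233242266,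
  001027038048078095108121135157164178197218232243266,
  002024037051077092111122132158167177198217235240266,
  003025036050076093110123133159166176199216234241266,
  004030035053075090105124130152161183192223237246266,
  005031034052074091104125131153160182193222236247266,
  006028033055073088107126128154163181194221239244266,
  007029032054072089106127129155162180195220238245266,
  008018047057071086101112142148173187204211225250266,
  009019046056070087100113143149172186205210224251266,
  010016045059069084103114140150175185206209227248266,
  011017044058068085102115141151174184207208226249266,
  012022043061067082097116138144169191200215229254266,
  013023042060066083096117139145168190201214228255266,
  014020041063065080099118136146171189202213231252266,
  015021040062064081098119137147170188203212230253266,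
  000027037050067090104126129148172185207214231253267,
  001026036051066091105127128149173184206215230252267,
  002025039048065088106124131150174187205212229255267,
  003024038049064089107125130151175186204213228254267,
  004031033054071094108122133144168189203210227249267,
  005030032055070095109123132145169188202211226248267,
  006029035052069092110120135146170191201208225251267,
  007028034053068093111121134147171190200209224250267,
  008019045058075082096118137156164177199222239245267,
  009018044059074083097119136157165176198223238244267,
  010017047056073080098116139158166179197220237247267,
  011016046057072081099117138159167178196221236246267,
  012023041062079086100114141152160181195218235241267,
  013022040063078087101115140153161180194219234240267,
  014021043060077084102112143154162183193216233243267,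
  015020042061076085103113142155163182192217232242267,
  000028043054078085105114136159170177205211228247268,
  001029042055079084104115137158171176204210229246268,
  002030041052076087107112138157168179207209230245268,
  003031040053077086106113139156169178206208231244268,
  004024047050074081109118140155174181201215224243268,
  005025046051075080108119141154175180200214225242268,
  006026045048072083111116142153172183203213226241268,
  007027044049073082110117143152173182202212227240268,
  008020035062070093097122128151162185197219236255268,
  009021034063071092096123129150163184196218237254268,
  010022033060068095099120130149160187199217238253268,
  011023032061069094098121131148161186198216239252268,
  012016039058066089101126132147166189193223232251268,
  013017038059067088100127133146167188192222233250268,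
  014018037056064091103124134145164191195221234249268,
  015019036057065090102125135144165190194220235248268,
  000029041053066081108116143151163187198222234248269,
  001028040052067080109117142150162186199223235249269,
  002031043055064083110118141149161185196220232250269,
  003030042054065082111119140148160184197221233251269,
  004025045049070085104112139147167191194218238252269,
  005024044048071084105113138146166190195219239253269,
  006027047051068087106114137145165189192216236254269,
  007026046050069086107115136144164188193217237255269,
  008021033061074089100124135159171179206214226240269,
  009020032060075088101125134158170178207215227241269,
  010023035063072091102126133157169177204212224242269,
  011022034062073090103127132156168176205213225243269,
  012017037057078093096120131155175183202210230244269,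
  013016036056079092097121130154174182203211231245269,
  014019039059076095098122129153173181200208228246269,
  015018038058077094099123128152172180201209229247269,
  000030038057074092103115139149162189200212239241270,
  001031039056075093102114138148163188201213238240270,
  002028036059072094101113137151160191202214237243270,
  003029037058073095100112136150161190203215236242270,
  004026034061078088099119143145166185204208235245270,
  005027035060079089098118142144167184205209234244270,
  006024032063076090097117141147164187206210233247270,
  007025033062077091096116140146165186207211232246270,
  008022046049066084111123131157170181192220231249270,
  009023047048067085110122130156171180193221230248270,
  010020044051064086109121129159168183194222229251270,
  011021045050065087108120128158169182195223228250270,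
  012018042053070080107127135153174177196216227253270,
  013019043052071081106126134152175176197217226252270,
  014016040055068082105125133155172179198218225255270,
  015017041054069083104124132154173178199219224254270,
  000031036058070088098117140157171183195217225254271,
  001030037059071089099116141156170182194216224255271,
  002029038056068090096119142159169181193219227252271,
  003028039057069091097118143158168180192218226253271,
  004027032062066092102113136153175179199221229250271,
  005026033063067093103112137152174178198220228251271,
  006025034060064094100115138155173177197223231248271,
  007024035061065095101114139154172176196222230249271,
  008023044050078080106125132149163191203209233246271,
  009022045051079081107124133148162190202208232247271,
  010021046048076082104127134151161189201211235244271,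
  011020047049077083105126135150160188200210234245271,
  012019040054074084110121128145167187207213237242271,
  013018041055075085111120129144166186206212236243271,
  014017042052072086108123130147165185205215239240271,
  015016043053073087109122131146164184204214238241271,
  000001002003004005006007008009010011012013014015272,
  016017018019020021022023024025026027028029030031272,
  032033034035036037038039040041042043044045046047272,
  048049050051052053054055056057058059060061062063272,
  064065066067068069070071072073074075076077078079272,
  080081082083084085086087088089090091092093094095272,
  096097098099100101102103104105106107108109110111272,
  112113114115116117118119120121122123124125126127272,
  128129130131132133134135136137138139140141142143272,
  144145146147148149150151152153154155156157158159272,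
  160161162163164165166167168169170171172173174175272,
  176177178179180181182183184185186187188189190191272,
  192193194195196197198199200201202203204205206207272,
  208209210211212213214215216217218219220221222223272,
  224225226227228229230231232233234235236237238239272,
  240241242243244245246247248249250251252253254255272,
  256257258259260261262263264265266267268269270271272]

theorem semifieldA_isPlane : semifieldA.IsPlane := by
  constructor <;> decide +kernel

/-- Unitals in the plane with table `semifieldA`. -/
noncomputable def semifieldAUnitals : List TableUnital := [
  ⟨semifieldA, semifieldA_isPlane,
    115849181093407925402953572592597236546850724107569631729907463727683577708576,
    796, by decide +kernel⟩,
  ⟨semifieldA, semifieldA_isPlane,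
    178338921814253151263950436432278408320878691279607015125342977124513462891526,
    1827, by decide +kernel⟩,
  ⟨semifieldA, semifieldA_isPlane,
    116019225746677127927959533607633796871429822878316028945187502617390365171756,
    1828, by decide +kernel⟩,
  ⟨semifieldA, semifieldA_isPlane,
    160124967952104847735159134608759900679029680311101967973319644671154573021396,
    3364, by decide +kernel⟩,
  ⟨semifieldA, semifieldA_isPlane,
    141800078913820660862816960786940780933094640736455898902578929077221805013376,
    4379, by decide +kernel⟩,
  ⟨semifieldA, semifieldA_isPlane,
    121789209900481575412150190132438926884198573342605431140927005224653644398741,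
    4388, by decide +kernel⟩,
  ⟨semifieldA, semifieldA_isPlane,
    161362615649204295529099820259257395751271578565511750526680656539523980366341,
    4899, by decide +kernel⟩,
  ⟨semifieldA, semifieldA_isPlane,
    119728964449090047696026578883505645271646089070435516076440388403433723414026,
    5152, by decide +kernel⟩,
  ⟨semifieldA, semifieldA_isPlane,
    177618059211378145449684025049384566205886926067845951547554458403510694458626,
    5411, by decide +kernel⟩,
  ⟨semifieldA, semifieldA_isPlane,
    123835329833026819622720952673433302883236550705497374171857452360163626330216,
    6689, by decide +kernel⟩,
  ⟨semifieldA, semifieldA_isPlane,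
    128009395544704123129852827294138558998108148267633282962594434889161554526336,
    6945, by decide +kernel⟩]

/-- Unitals in the plane with table `semifieldA.dual`. -/
noncomputable def semifieldADualUnitals : List TableUnital := [
  ⟨semifieldA.dual, semifieldA_isPlane.dual,
    11627906988967040704774263435859338343873345809135671239224368485962732493651312640,
    290, by decide +kernel⟩,
  ⟨semifieldA.dual, semifieldA_isPlane.dual,
    11427413304309058162604140014227357880949802557969886580491037399538290966789226496,
    2341, by decide +kernel⟩,
  ⟨semifieldA.dual, semifieldA_isPlane.dual,
    8570590788987572210985013360165407628304765101104452764762647281985742076467281920,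
    3876, by decide +kernel⟩,
  ⟨semifieldA.dual, semifieldA_isPlane.dual,
    7737404740066967562129312803612558619072399632261625084357936207437715097094651904,
    4642, by decide +kernel⟩,
  ⟨semifieldA.dual, semifieldA_isPlane.dual,
    8124220003847534854159221110763312154561948767981791368712126964592071194028605440,
    5923, by decide +kernel⟩,
  ⟨semifieldA.dual, semifieldA_isPlane.dual,
    9620050365936165723121835644207654804250456820296800422392917413727137240803966976,
    7458, by decide +kernel⟩,
  ⟨semifieldA.dual, semifieldA_isPlane.dual,
    9731182618768002719435311564852905383322965022841517394868813055347132090689257472,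
    7714, by decide +kernel⟩]

/-- The incidence table of a translation plane with a collineation group of order `258048`. -/
def translationPlane : IncidenceTable where
  lineRows := [
  000016032048064080096112128144160176192208224240256,
  001017033049065081097113129145161177193209225241256,
  002018034050066082098114130146162178194210226242256,
  003019035051067083099115131147163179195211227243256,
  004020036052068084100116132148164180196212228244256,
  005021037053069085101117133149165181197213229245256,
  006022038054070086102118134150166182198214230246256,
  007023039055071087103119135151167183199215231247256,
  008024040056072088104120136152168184200216232248256,
  009025041057073089105121137153169185201217233249256,
  010026042058074090106122138154170186202218234250256,
  011027043059075091107123139155171187203219235251256,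
  012028044060076092108124140156172188204220236252256,
  013029045061077093109125141157173189205221237253256,
  014030046062078094110126142158174190206222238254256,
  015031047063079095111127143159175191207223239255256,
  000017034051068085102119136153170187204221238255257,
  001016035050069084103118137152171186205220239254257,
  002019032049070087100117138155168185206223236253257,
  003018033048071086101116139154169184207222237252257,
  004021038055064081098115140157174191200217234251257,
  005020039054065080099114141156175190201216235250257,
  006023036053066083096113142159172189202219232249257,
  007022037052067082097112143158173188203218233248257,
  008025042059076093110127128145162179196213230247257,
  009024043058077092111126129144163178197212231246257,
  010027040057078095108125130147160177198215228245257,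
  011026041056079094109124131146161176199214229244257,
  012029046063072089106123132149166183192209226243257,
  013028047062073088107122133148167182193208227242257,
  014031044061074091104121134151164181194211224241257,
  015030045060075090105120135150165180195210225240257,
  000018035049072090107121140158175189196214231245258,
  001019034048073091106120141159174188197215230244258,
  002016033051074088105123142156173191198212229247258,
  003017032050075089104122143157172190199213228246258,
  004022039053076094111125136154171185192210227241258,
  005023038052077095110124137155170184193211226240258,
  006020037055078092109127138152169187194208225243258,
  007021036054079093108126139153168186195209224242258,
  008026043057064082099113132150167181204222239253258,
  009027042056065083098112133151166180205223238252258,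
  010024041059066080097115134148165183206220237255258,
  011025040058067081096114135149164182207221236254258,
  012030047061068086103117128146163177200218235249258,
  013031046060069087102116129147162176201219234248258,
  014028045063070084101119130144161179202216233251258,
  015029044062071085100118131145160178203217232250258,
  000030037059073087108114131157166184202212239241259,
  001031036058072086109115130156167185203213238240259,
  002028039057075085110112129159164186200214237243259,
  003029038056074084111113128158165187201215236242259,
  004026033063077083104118135153162188206208235245259,
  005027032062076082105119134152163189207209234244259,
  006024035061079081106116133155160190204210233247259,
  007025034060078080107117132154161191205211232246259,
  008022045051065095100122139149174176194220231249259,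
  009023044050064094101123138148175177195221230248259,
  010020047049067093102120137151172178192222229251259,
  011021046048066092103121136150173179193223228250259,
  012018041055069091096126143145170180198216227253259,
  013019040054068090097127142144171181199217226252259,
  014016043053071089098124141147168182196218225255259,
  015017042052070088099125140146169183197219224254259,
  000020042062069081111123130150168188199211237249260,
  001021043063068080110122131151169189198210236248260,
  002022040060071083109121128148170190197209239251260,
  003023041061070082108120129149171191196208238250260,
  004016046058065085107127134146172184195215233253260,
  005017047059064084106126135147173185194214232252260,
  006018044056067087105125132144174186193213235255260,
  007019045057066086104124133145175187192212234254260,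
  008028034054077089103115138158160180207219229241260,
  009029035055076088102114139159161181206218228240260,
  010030032052079091101113136156162182205217231243260,
  011031033053078090100112137157163183204216230242260,
  012024038050073093099119142154164176203223225245260,
  013025039051072092098118143155165177202222224244260,
  014026036048075095097117140152166178201221227247260,
  015027037049074094096116141153167179200220226246260,
  000025038063066091100125129152167190195218229252261,
  001024039062067090101124128153166191194219228253261,
  002027036061064089102127131154165188193216231254261,
  003026037060065088103126130155164189192217230255261,
  004029034059070095096121133156163186199222225248261,
  005028035058071094097120132157162187198223224249261,
  006031032057068093098123135158161184197220227250261,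
  007030033056069092099122134159160185196221226251261,
  008017046055074083108117137144175182203210237244261,
  009016047054075082109116136145174183202211236245261,
  010019044053072081110119139146173180201208239246261,
  011018045052073080111118138147172181200209238247261,
  012021042051078087104113141148171178207214233240261,
  013020043050079086105112140149170179206215232241261,
  014023040049076085106115143150169176205212235242261,
  015022041048077084107114142151168177204213234243261,
  000027047052071092104115142149161186201210230253262,
  001026046053070093105114143148160187200211231252262,
  002025045054069094106113140151163184203208228255262,
  003024044055068095107112141150162185202209229254262,
  004031043048067088108119138145165190205214226249262,
  005030042049066089109118139144164191204215227248262,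
  006029041050065090110117136147167188207212224251262,
  007028040051064091111116137146166189206213225250262,
  008019039060079084096123134157169178193218238245262,
  009018038061078085097122135156168179192219239244262,
  010017037062077086098121132159171176195216236247262,
  011016036063076087099120133158170177194217237246262,
  012023035056075080100127130153173182197222234241262,
  013022034057074081101126131152172183196223235240262,
  014021033058073082102125128155175180199220232243262,
  015020032059072083103124129154174181198221233242262,
  000022044058075093103113133147169191206216226244263,
  001023045059074092102112132146168190207217227245263,
  002020046056073095101115135145171189204218224246263,
  003021047057072094100114134144170188205219225247263,
  004018040062079089099117129151173187202220230240263,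
  005019041063078088098116128150172186203221231241263,
  006016042060077091097119131149175185200222228242263,
  007017043061076090096118130148174184201223229243263,
  008030036050067085111121141155161183198208234252263,
  009031037051066084110120140154160182199209235253263,
  010028038048065087109123143153163181196210232254263,
  011029039049064086108122142152162180197211233255263,
  012026032054071081107125137159165179194212238248263,
  013027033055070080106124136158164178195213239249263,
  014024034052069083105127139157167177192214236250263,
  015025035053068082104126138156166176193215237251263,
  000028041053074086099127135155174178205209228248264,
  001029040052075087098126134154175179204208229249264,
  002030043055072084097125133153172176207211230250264,
  003031042054073085096124132152173177206210231251264,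
  004024045049078082103123131159170182201213224252264,
  005025044048079083102122130158171183200212225253264,
  006026047051076080101121129157168180203215226254264,
  007027046050077081100120128156169181202214227255264,
  008020033061066094107119143147166186197217236240264,
  009021032060067095106118142146167187196216237241264,
  010022035063064092105117141145164184199219238242264,
  011023034062065093104116140144165185198218239243264,
  012016037057070090111115139151162190193221232244264,
  013017036056071091110114138150163191192220233245264,
  014018039059068088109113137149160188195223234246264,
  015019038058069089108112136148161189194222235247264,
  000019033050076095109126132151165182200219233250265,
  001018032051077094108127133150164183201218232251265,
  002017035048078093111124134149167180202217235248265,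
  003016034049079092110125135148166181203216234249265,
  004023037054072091105122128147161178204223237254265,
  005022036055073090104123129146160179205222236255265,
  006021039052074089107120130145163176206221239252265,
  007020038053075088106121131144162177207220238253265,
  008027041058068087101118140159173190192211225242265,
  009026040059069086100119141158172191193210224243265,
  010025043056070085103116142157175188194209227240265,
  011024042057071084102117143156174189195208226241265,
  012031045062064083097114136155169186196215229246265,
  013030044063065082096115137154168187197214228247265,
  014029047060066081099112138153171184198213231244265,
  015028046061067080098113139152170185199212230245265,
  000031039056077082106117139148172179198217225254266,
  001030038057076083107116138149173178199216224255266,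
  002029037058079080104119137150174177196219227252266,
  003028036059078081105118136151175176197218226253266,
  004027035060073086110113143144168183194221229250266,
  005026034061072087111112142145169182195220228251266,
  006025033062075084108115141146170181192223231248266,
  007024032063074085109114140147171180193222230249266,
  008023047048069090098125131156164187206209233246266,
  009022046049068091099124130157165186207208232247266,
  010021045050071088096127129158166185204211235244266,
  011020044051070089097126128159167184205210234245266,
  012019043052065094102121135152160191202213237242266,
  013018042053064095103120134153161190203212236243266,
  014017041054067092100123133154162189200215239240266,
  015016040055066093101122132155163188201214238241266,
  000021040061065084105124138159162183203222227246267,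
  001020041060064085104125139158163182202223226247267,
  002023042063067086107126136157160181201220225244267,
  003022043062066087106127137156161180200221224245267,
  004017044057069080109120142155166179207218231242267,
  005016045056068081108121143154167178206219230243267,
  006019046059071082111122140153164177205216229240267,
  007018047058070083110123141152165176204217228241267,
  008029032053073092097116130151170191195214235254267,
  009028033052072093096117131150171190194215234255267,
  010031034055075094099118128149168189193212233252267,
  011030035054074095098119129148169188192213232253267,
  012025036049077088101112134147174187199210239250267,
  013024037048076089100113135146175186198211238251267,
  014027038051079090103114132145172185197208237248267,
  015026039050078091102115133144173184196209236249267,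
  000024036060070094098122137145173181207215235243268,
  001025037061071095099123136144172180206214234242268,
  002026038062068092096120139147175183205213233241268,
  003027039063069093097121138146174182204212232240268,
  004028032056066090102126141149169177203211239247268,
  005029033057067091103127140148168176202210238246268,
  006030034058064088100124143151171179201209237245268,
  007031035059065089101125142150170178200208236244268,
  008016044052078086106114129153165189199223227251268,
  009017045053079087107115128152164188198222226250268,
  010018046054076084104112131155167191197221225249268,
  011019047055077085105113130154166190196220224248268,
  012020040048074082110118133157161185195219231255268,
  013021041049075083111119132156160184194218230254268,
  014022042050072080108116135159163187193217229253268,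
  015023043051073081109117134158162186192216228252268,
  000026045055067089110116134156171177197223232242269,
  001027044054066088111117135157170176196222233243269,
  002024047053065091108118132158169179199221234240269,
  003025046052064090109119133159168178198220235241269,
  004030041051071093106112130152175181193219236246269,
  005031040050070092107113131153174180192218237247269,
  006028043049069095104114128154173183195217238244269,
  007029042048068094105115129155172182194216239245269,
  008018037063075081102124142148163185205215224250269,
  009019036062074080103125143149162184204214225251269,
  010016039061073083100126140150161187207213226248269,
  011017038060072082101127141151160186206212227249269,
  012022033059079085098120138144167189201211228254269,
  013023032058078084099121139145166188200210229255269,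
  014020035057077087096122136146165191203209230252269,
  015021034056076086097123137147164190202208231253269,
  000023046057079088097118141154163180194213236251270,
  001022047056078089096119140155162181195212237250270,
  002021044059077090099116143152161182192215238249270,
  003020045058076091098117142153160183193214239248270,
  004019042061075092101114137158167176198209232255270,
  005018043060074093100115136159166177199208233254270,
  006017040063073094103112139156165178196211234253270,
  007016041062072095102113138157164179197210235252270,
  008031038049071080105126133146171188202221228243270,
  009030039048070081104127132147170189203220229242270,
  010029036051069082107124135144169190200223230241270,
  011028037050068083106125134145168191201222231240270,
  012027034053067084109122129150175184206217224247270,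
  013026035052066085108123128151174185207216225246270,
  014025032055065086111120131148173186204219226245270,
  015024033054064087110121130149172187205218227244270,
  000029043054078083101120143146164185193220234247271,
  001028042055079082100121142147165184192221235246271,
  002031041052076081103122141144166187195222232245271,
  003030040053077080102123140145167186194223233244271,
  004025047050074087097124139150160189197216238243271,
  005024046051075086096125138151161188196217239242271,
  006027045048072085099126137148162191199218236241271,
  007026044049073084098127136149163190198219237240271,
  008021035062070091109112135154172177201212226255271,
  009020034063071090108113134155173176200213227254271,
  010023033060068089111114133152174179203214224253271,
  011022032061069088110115132153175178202215225252271,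
  012017039058066095105116131158168181205208230251271,
  013016038059067094104117130159169180204209231250271,
  014019037056064093107118129156170183207210228249271,
  015018036057065092106119128157171182206211229248271,
  000001002003004005006007008009010011012013014015272,
  016017018019020021022023024025026027028029030031272,
  032033034035036037038039040041042043044045046047272,
  048049050051052053054055056057058059060061062063272,
  064065066067068069070071072073074075076077078079272,
  080081082083084085086087088089090091092093094095272,
  096097098099100101102103104105106107108109110111272,
  112113114115116117118119120121122123124125126127272,
  128129130131132133134135136137138139140141142143272,
  144145146147148149150151152153154155156157158159272,
  160161162163164165166167168169170171172173174175272,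
  176177178179180181182183184185186187188189190191272,
  192193194195196197198199200201202203204205206207272,
  208209210211212213214215216217218219220221222223272,
  224225226227228229230231232233234235236237238239272,
  240241242243244245246247248249250251252253254255272,
  256257258259260261262263264265266267268269270271272]
  pointRows := [
  000016032048064080096112128144160176192208224240256,
  001017033049065081097113129145161177193209225241256,
  002018034050066082098114130146162178194210226242256,
  003019035051067083099115131147163179195211227243256,
  004020036052068084100116132148164180196212228244256,
  005021037053069085101117133149165181197213229245256,
  006022038054070086102118134150166182198214230246256,
  007023039055071087103119135151167183199215231247256,
  008024040056072088104120136152168184200216232248256,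
  009025041057073089105121137153169185201217233249256,
  010026042058074090106122138154170186202218234250256,
  011027043059075091107123139155171187203219235251256,
  012028044060076092108124140156172188204220236252256,
  013029045061077093109125141157173189205221237253256,
  014030046062078094110126142158174190206222238254256,
  015031047063079095111127143159175191207223239255256,
  000017034062068089107118140147175181200218231253257,
  001016035063069088106119141146174180201219230252257,
  002019032060070091105116142145173183202216229255257,
  003018033061071090104117143144172182203217228254257,
  004021038058064093111114136151171177204222227249257,
  005020039059065092110115137150170176205223226248257,
  006023036056066095109112138149169179206220225251257,
  007022037057067094108113139148168178207221224250257,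
  008025042054076081099126132155167189192210239245257,
  009024043055077080098127133154166188193211238244257,
  010027040052078083097124134153165191194208237247257,
  011026041053079082096125135152164190195209236246257,
  012029046050072085103122128159163185196214235241257,
  013028047051073084102123129158162184197215234240257,
  014031044048074087101120130157161187198212233243257,
  015030045049075086100121131156160186199213232242257,
  000018035053074086111124137145167184196221238251258,
  001019034052075087110125136144166185197220239250258,
  002016033055072084109126139147165186198223236249258,
  003017032054073085108127138146164187199222237248258,
  004022039049078082107120141149163188192217234255258,
  005023038048079083106121140148162189193216235254258,
  006020037051076080105122143151161190194219232253258,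
  007021036050077081104123142150160191195218233252258,
  008026043061066094103116129153175176204213230243258,
  009027042060067095102117128152174177205212231242258,
  010024041063064092101118131155173178206215228241258,
  011025040062065093100119130154172179207214229240258,
  012030047057070090099112133157171180200209226247258,
  013031046056071091098113132156170181201208227246258,
  014028045059068088097114135159169182202211224245258,
  015029044058069089096115134158168183203210225244258,
  000019033059078095100122133146168189204215233246259,
  001018032058079094101123132147169188205214232247259,
  002017035057076093102120135144170191206213235244259,
  003016034056077092103121134145171190207212234245259,
  004023037063074091096126129150172185200211237242259,
  005022036062075090097127128151173184201210236243259,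
  006021039061072089098124131148174187202209239240259,
  007020038060073088099125130149175186203208238241259,
  008027041051070087108114141154160181196223225254259,
  009026040050071086109115140155161180197222224255259,
  010025043049068085110112143152162183198221227252259,
  011024042048069084111113142153163182199220226253259,
  012031045055066083104118137158164177192219229250259,
  013030044054067082105119136159165176193218228251259,
  014029047053064081106116139156166179194217231248259,
  015028046052065080107117138157167178195216230249259,
  000020040057069082103123138156173177198211239254260,
  001021041056068083102122139157172176199210238255260,
  002022042059071080101121136158175179196209237252260,
  003023043058070081100120137159174178197208236253260,
  004016044061065086099127142152169181194215235250260,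
  005017045060064087098126143153168180195214234251260,
  006018046063067084097125140154171183192213233248260,
  007019047062066085096124141155170182193212232249260,
  008028032049077090111115130148165185206219231246260,
  009029033048076091110114131149164184207218230247260,
  010030034051079088109113128150167187204217229244260,
  011031035050078089108112129151166186205216228245260,
  012024036053073094107119134144161189202223227242260,
  013025037052072095106118135145160188203222226243260,
  014026038055075092105117132146163191200221225240260,
  015027039054074093104116133147162190201220224241260,
  000021042055065091108125134159162180206217232243261,
  001020043054064090109124135158163181207216233242261,
  002023040053067089110127132157160182204219234241261,
  003022041052066088111126133156161183205218235240261,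
  004017046051069095104121130155166176202221236247261,
  005016047050068094105120131154167177203220237246261,
  006019044049071093106123128153164178200223238245261,
  007018045048070092107122129152165179201222239244261,
  008029034063073083100117142151170188198209224251261,
  009028035062072082101116143150171189199208225250261,
  010031032061075081102119140149168190196211226249261,
  011030033060074080103118141148169191197210227248261,
  012025038059077087096113138147174184194213228255261,
  013024039058076086097112139146175185195212229254261,
  014027036057079085098115136145172186192215230253261,
  015026037056078084099114137144173187193214231252261,
  000022043060079084104119131157170185194222225245262,
  001023042061078085105118130156171184195223224244262,
  002020041062077086106117129159168187192220227247262,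
  003021040063076087107116128158169186193221226246262,
  004018047056075080108115135153174189198218229241262,
  005019046057074081109114134152175188199219228240262,
  006016045058073082110113133155172191196216231243262,
  007017044059072083111112132154173190197217230242262,
  008030035052071092096127139149162177202214233253262,
  009031034053070093097126138148163176203215232252262,
  010028033054069094098125137151160179200212235255262,
  011029032055068095099124136150161178201213234254262,
  012026039048067088100123143145166181206210237249262,
  013027038049066089101122142144167180207211236248262,
  014024037050065090102121141147164183204208239251262,
  015025036051064091103120140146165182205209238250262,
  000023041050075093099113143158165188202212230248263,
  001022040051074092098112142159164189203213231249263,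
  002021043048073095097115141156167190200214228250263,
  003020042049072094096114140157166191201215229251263,
  004019045054079089103117139154161184206208226252263,
  005018044055078088102116138155160185207209227253263,
  006017047052077091101119137152163186204210224254263,
  007016046053076090100118136153162187205211225255263,
  008031033058067085107121135150173180194220238240263,
  009030032059066084106120134151172181195221239241263,
  010029035056065087105123133148175182192222236242263,
  011028034057064086104122132149174183193223237243263,
  012027037062071081111125131146169176198216234244263,
  013026036063070080110124130147168177199217235245263,
  014025039060069083109127129144171178196218232246263,
  015024038061068082108126128145170179197219233247263,
  000024044051066081110117135148171186201214237255264,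
  001025045050067080111116134149170187200215236254264,
  002026046049064083108119133150169184203212239253264,
  003027047048065082109118132151168185202213238252264,
  004028040055070085106113131144175190205210233251264,
  005029041054071084107112130145174191204211232250264,
  006030042053068087104115129146173188207208235249264,
  007031043052069086105114128147172189206209234248264,
  008016036059074089102125143156163178193222229247264,
  009017037058075088103124142157162179192223228246264,
  010018038057072091100127141158161176195220231245264,
  011019039056073090101126140159160177194221230244264,
  012020032063078093098121139152167182197218225243264,
  013021033062079092099120138153166183196219224242264,
  014022034061076095096123137154165180199216227241264,
  015023035060077094097122136155164181198217226240264,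
  000025046061070088101115139151164191193220234242265,
  001024047060071089100114138150165190192221235243265,
  002027044063068090103113137149166189195222232240265,
  003026045062069091102112136148167188194223233241265,
  004029042057066092097119143147160187197216238246265,
  005028043056067093096118142146161186196217239247265,
  006031040059064094099117141145162185199218236244265,
  007030041058065095098116140144163184198219237245265,
  008017038053078080109123131159172183201212226250265,
  009016039052079081108122130158173182200213227251265,
  010019036055076082111121129157174181203214224248265,
  011018037054077083110120128156175180202215225249265,
  012021034049074084105127135155168179205208230254265,
  013020035048075085104126134154169178204209231255265,
  014023032051072086107125133153170177207210228252265,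
  015022033050073087106124132152171176206211229253265,
  000026047054072087097121142149172178205219227244266,
  001027046055073086096120143148173179204218226245266,
  002024045052074085099123140151174176207217225246266,
  003025044053075084098122141150175177206216224247266,
  004030043050076083101125138145168182201223231240266,
  005031042051077082100124139144169183200222230241266,
  006028041048078081103127136147170180203221229242266,
  007029040049079080102126137146171181202220228243266,
  008018039062064095105113134157164186197211235252266,
  009019038063065094104112135156165187196210234253266,
  010016037060066093107115132159166184199209233254266,
  011017036061067092106114133158167185198208232255266,
  012022035058068091109117130153160190193215239248266,
  013023034059069090108116131152161191192214238249266,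
  014020033056070089111119128155162188195213237250266,
  015021032057071088110118129154163189194212236251266,
  000027045056076094106127130150163183197209228249267,
  001026044057077095107126131151162182196208229248267,
  002025047058078092104125128148161181199211230251267,
  003024046059079093105124129149160180198210231250267,
  004031041060072090110123134146167179193213224253267,
  005030040061073091111122135147166178192212225252267,
  006029043062074088108121132144165177195215226255267,
  007028042063075089109120133145164176194214227254267,
  008019037048068086098119138158171191205217236241267,
  009018036049069087099118139159170190204216237240267,
  010017039050070084096117136156169189207219238243267,
  011016038051071085097116137157168188206218239242267,
  012023033052064082102115142154175187201221232245267,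
  013022032053065083103114143155174186200220233244267,
  014021035054066080100113140152173185203223234247267,
  015020034055067081101112141153172184202222235246267,
  000028036058071083105126141152166187207213226241268,
  001029037059070082104127140153167186206212227240268,
  002030038056069081107124143154164185205215224243268,
  003031039057068080106125142155165184204214225242268,
  004024032062067087109122137156162191203209230245268,
  005025033063066086108123136157163190202208231244268,
  006026034060065085111120139158160189201211228247268,
  007027035061064084110121138159161188200210229246268,
  008020044050079091097118133144174179199221234249268,
  009021045051078090096119132145175178198220235248268,
  010022046048077089099116135146172177197223232251268,
  011023047049076088098117134147173176196222233250268,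
  012016040054075095101114129148170183195217238253268,
  013017041055074094100115128149171182194216239252268,
  014018042052073093103112131150168181193219236255268,
  015019043053072092102113130151169180192218237254268,
  000029038052067090098120129155169190199223229252269,
  001028039053066091099121128154168191198222228253269,
  002031036054065088096122131153171188197221231254269,
  003030037055064089097123130152170189196220230255269,
  004025034048071094102124133159173186195219225248269,
  005024035049070095103125132158172187194218224249269,
  006027032050069092100126135157175184193217227250269,
  007026033051068093101127134156174185192216226251269,
  008021046060075082106112137147161182207215237244269,
  009020047061074083107113136146160183206214236245269,
  010023044062073080104114139145163180205213239246269,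
  011022045063072081105115138144162181204212238247269,
  012017042056079086110116141151165178203211233240269,
  013016043057078087111117140150164179202210232241269,
  014019040058077084108118143149167176201209235242269,
  015018041059076085109119142148166177200208234243269,
  000030039063077085102114132153161179203216236250270,
  001031038062076084103115133152160178202217237251270,
  002028037061079087100112134155163177201218238248270,
  003029036060078086101113135154162176200219239249270,
  004026035059073081098118128157165183207220232254270,
  005027034058072080099119129156164182206221233255270,
  006024033057075083096116130159167181205222234252270,
  007025032056074082097117131158166180204223235253270,
  008022047055069093110122140145169187195208228242270,
  009023046054068092111123141144168186194209229243270,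
  010020045053071095108120142147171185193210230240270,
  011021044052070094109121143146170184192211231241270,
  012018043051065089106126136149173191199212224246270,
  013019042050064088107127137148172190198213225247270,
  014016041049067091104124138151175189197214226244270,
  015017040048066090105125139150174188196215227245270,
  000031037049073092109116136154174182195210235247271,
  001030036048072093108117137155175183194211234246271,
  002029039051075094111118138152172180193208233245271,
  003028038050074095110119139153173181192209232244271,
  004027033053077088105112140158170178199214239243271,
  005026032052076089104113141159171179198215238242271,
  006025035055079090107114142156168176197212237241271,
  007024034054078091106115143157169177196213236240271,
  008023045057065084101124128146166190203218227255271,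
  009022044056064085100125129147167191202219226254271,
  010021047059067086103126130144164188201216225253271,
  011020046058066087102127131145165189200217224252271,
  012019041061069080097120132150162186207222231251271,
  013018040060068081096121133151163187206223230250271,
  014017043063071082099122134148160184205220229249271,
  015016042062070083098123135149161185204221228248271,
  000001002003004005006007008009010011012013014015272,
  016017018019020021022023024025026027028029030031272,
  032033034035036037038039040041042043044045046047272,
  048049050051052053054055056057058059060061062063272,
  064065066067068069070071072073074075076077078079272,
  080081082083084085086087088089090091092093094095272,
  096097098099100101102103104105106107108109110111272,
  112113114115116117118119120121122123124125126127272,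
  128129130131132133134135136137138139140141142143272,
  144145146147148149150151152153154155156157158159272,
  160161162163164165166167168169170171172173174175272,
  176177178179180181182183184185186187188189190191272,
  192193194195196197198199200201202203204205206207272,
  208209210211212213214215216217218219220221222223272,
  224225226227228229230231232233234235236237238239272,
  240241242243244245246247248249250251252253254255272,
  256257258259260261262263264265266267268269270271272]

theorem translationPlane_isPlane : translationPlane.IsPlane := by
  constructor <;> decide +kernel

/-- Unitals in the plane with table `translationPlane`. -/
noncomputable def translationPlaneUnitals : List TableUnital := [
  ⟨translationPlane, translationPlane_isPlane,
    8066952629963591937359606860409951264187189750807077041853986162831415351315531360,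
    448, by decide +kernel⟩,
  ⟨translationPlane, translationPlane_isPlane,
    5736174117958684539296482346275129928101393804965555241836430794315752124454535296,
    466, by decide +kernel⟩,
  ⟨translationPlane, translationPlane_isPlane,
    29722441827079392965489470679612561938454910159714480898048021967490395339292736,
    898, by decide +kernel⟩,
  ⟨translationPlane, translationPlane_isPlane,
    7588558290142991886819792604912131237212494868127322190645375100039548700641611786,
    1217, by decide +kernel⟩,
  ⟨translationPlane, translationPlane_isPlane,
    7588559477464219615353403421936985045903827607075475774972284520212040069167595906,
    2274, by decide +kernel⟩,
  ⟨translationPlane, translationPlane_isPlane,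
    29657434378300287104665067495787105235524284608659580148784110614563211291738576,
    2434, by decide +kernel⟩,
  ⟨translationPlane, translationPlane_isPlane,
    29657435348429850824639061186533678306764495044784838516005969945146635500126216,
    6432, by decide +kernel⟩]

/-- Unitals in the plane with table `translationPlane.dual`. -/
noncomputable def translationPlaneDualUnitals : List TableUnital := [
  ⟨translationPlane.dual, translationPlane_isPlane.dual,
    7600776377106236918617619438349332182820347638957362396103599673217134787339223190,
    3, by decide +kernel⟩,
  ⟨translationPlane.dual, translationPlane_isPlane.dual,
    7600776376558409252341648783169670396965944488289131936346758924022111386944405654,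
    1734, by decide +kernel⟩,
  ⟨translationPlane.dual, translationPlane_isPlane.dual,
    7588565859288653484237972841791250403850186765314833505217746903245059567963416596,
    2497, by decide +kernel⟩,
  ⟨translationPlane.dual, translationPlane_isPlane.dual,
    189102955735816741463855617817595448238744792668766277423851571266512341579073376,
    2545, by decide +kernel⟩,
  ⟨translationPlane.dual, translationPlane_isPlane.dual,
    10701109566877116362551398397328324011454011591692470281128784271885326923135030784,
    4097, by decide +kernel⟩,
  ⟨translationPlane.dual, translationPlane_isPlane.dual,
    474385787153539641918888122331320722838247199016523465052336735454494106499155968,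
    4195, by decide +kernel⟩,
  ⟨translationPlane.dual, translationPlane_isPlane.dual,
    7588568488246765851706639126076368431254548309259703782623521685578712141025847316,
    6626, by decide +kernel⟩]

/-- The incidence table of a plane derived from the dual of the Hall plane. -/
def derivedDualHallA : IncidenceTable where
  lineRows := [
  001017033049065081097113129145161177193209225241256,
  002018034050066082098114130146162178194210226242256,
  004020036052068084100116132148164180196212228244256,
  007023039055071087103119135151167183199215231247256,
  008024040056072088104120136152168184200216232248256,
  009025041057073089105121137153169185201217233249256,
  010026042058074090106122138154170186202218234250256,
  011027043059075091107123139155171187203219235251256,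
  012028044060076092108124140156172188204220236252256,
  013029045061077093109125141157173189205221237253256,
  014030046062078094110126142158174190206222238254256,
  015031047063079095111127143159175191207223239255256,
  001016035057072094108114134154175181203215228253257,
  002019032058075093111113133153172182200212231254257,
  004021038060077091105119131159170176206210225248257,
  007022037063078088106116128156169179205209226251257,
  008025042048065087101123143147166188194222237244257,
  009024043049064086100122142146167189195223236245257,
  010027040050067085103121141145164190192220239246257,
  011026041051066084102120140144165191193221238247257,
  012029046052069083097127139151162184198218233240257,
  013028047053068082096126138150163185199219232241257,
  014031044054071081099125137149160186196216235242257,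
  015030045055070080098124136148161187197217234243257,
  001019045063064090107121140149162183206214232244258,
  002016046060067089104122143150161180205213235247258,
  004022040058069095110124137144167178203211237241258,
  007021043057070092109127138147164177200208238242258,
  008026036054073083098112133156171190199223225253258,
  009027037055072082099113132157170191198222224252258,
  010024038052075081096114135158169188197221227255258,
  011025039053074080097115134159168189196220226254258,
  012030032050077087102116129152175186195219229249258,
  013031033051076086103117128153174187194218228248258,
  014028034048079085100118131154173184193217231251258,
  015029035049078084101119130155172185192216230250258,
  001018047055073085102122139158172179196208237248259,
  002017044052074086101121136157175176199211238251259,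
  004023042050076080099127142155169182193213232253259,
  007020041049079083096124141152170181194214235254259,
  008027038062064092111115130151165186205217228241259,
  009026039063065093110114131150164187204216229240259,
  010025036060066094109113128149167184207219230243259,
  011024037061067095108112129148166185206218231242259,
  012031034058068088107119134147161190201221224245259,
  013030035059069089106118135146160191200220225244259,
  014029032056070090105117132145163188203223226247259,
  015028033057071091104116133144162189202222227246259,
  001021039058079084099112136146174188205219233246260,
  002022036057076087096115139145173191206216234245260,
  004016034063074081102117141151171185200222236243260,
  007019033060073082101118142148168186203221239240260,
  008028046051070093106121129155167181196210224255260,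
  009029047050071092107120128154166180197211225254260,
  010030044049068095104123131153165183198208226253260,
  011031045048069094105122130152164182199209227252260,
  012024042055066089110125133159163177192214228251260,
  013025043054067088111124132158162176193215229250260,
  014026040053064091108127135157161179194212230249260,
  015027041052065090109126134156160178195213231248260,
  001020037050070091110115143153160184199221236250261,
  002023038049069088109112140154163187196222239249261,
  004017032055067094107118138156165189194216233255261,
  007018035052064093104117137159166190193219234252261,
  008029044059079082103122134144169177206212229243261,
  009028045058078083102123135145168176207213228242261,
  010031046057077080101120132146171179204214231241261,
  011030047056076081100121133147170178205215230240261,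
  012025040063075086099126130148173181202208225247261,
  013024041062074087098127131149172180203209224246261,
  014027042061073084097124128150175183200210227245261,
  015026043060072085096125129151174182201211226244261,
  001023043052078095105120133150173186194220224243262,
  002020040055077092106123134149174185193223227240262,
  004018046049075090108125128147168191199217229246262,
  007017045050072089111126131144171188196218230245262,
  008030034061071086096113140159164179203213233250262,
  009031035060070087097112141158165178202212232251262,
  010028032063069084098115142157166177201215235248262,
  011029033062068085099114143156167176200214234249262,
  012026038057067082100117136155160183207209237254262,
  013027039056066083101116137154161182206208236255262,
  014024036059065080102119138153162181205211239252262,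
  015025037058064081103118139152163180204210238253262,
  001022041060071080100123130157163190200218229255263,
  002021042063068083103120129158160189203217230252263,
  004019044057066085097126135152166187205223224250263,
  007016047058065086098125132155165184206220227249263,
  008031032053078089109114139148170183193211236246263,
  009030033052079088108115138149171182192210237247263,
  010029034055076091111112137150168181195209238244263,
  011028035054077090110113136151169180194208239245263,
  012027036049074093105118143144174179197215232242263,
  013026037048075092104119142145175178196214233243263,
  014025038051072095107116141146172177199213234240263,
  015024039050073094106117140147173176198212235241263,
  001025046061068092098117135144170182195216239251264,
  002026045062071095097118132147169181192219236248264,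
  004028043056065089103112130149175179198221234254264,
  007031040059066090100115129150172176197222233253264,
  008016039052077085107124142153163191202209230242264,
  009017038053076084106125143152162190203208231243264,
  010018037054079087105126140155161189200211228240264,
  011019036055078086104127141154160188201210229241264,
  012020035048073081111120138157167187206213226246264,
  013021034049072080110121139156166186207212227247264,
  014022033050075083109122136159165185204215224244264,
  015023032051074082108123137158164184205214225245264,
  001024044053077083111118128155164178201222234247265,
  002027047054078080108117131152167177202221233244265,
  004029041048072086106115133158161183204219239242265,
  007030042051075085105112134157162180207216236241265,
  008017037060068090102127137146173187192215227254265,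
  009016036061069091103126136147172186193214226255265,
  010019039062070088100125139144175185194213225252265,
  011018038063071089101124138145174184195212224253265,
  012021033056064094098123141150169191196211231250265,
  013020032057065095099122140151168190197210230251265,
  014023035058066092096121143148171189198209229248265,
  015022034059067093097120142149170188199208228249265,
  001027034051069087104125138148169176204223230254266,
  002024033048070084107126137151170179207220229253266,
  004030039054064082109120143145172181201218227251266,
  007029036053067081110123140146175182202217224248266,
  008018043058076094097116131157160185197214239247266,
  009019042059077095096117130156161184196215238246266,
  010016041056078092099118129159162187199212237245266,
  011017040057079093098119128158163186198213236244266,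
  012022047062072090101112135153164189193210235243266,
  013023046063073091100113134152165188192211234242266,
  014020045060074088103114133155166191195208233241266,
  015021044061075089102115132154167190194209232240266,
  001026032059076088101126141159167180198217227242267,
  002025035056079091102125142156164183197218224241267,
  004031037062073093096123136154162177195220230247267,
  007028038061074094099120139153161178192223229244267,
  008019041050069081108119132150174189207208234251267,
  009018040051068080109118133151175188206209235250267,
  010017043048071083110117134148172191205210232249267,
  011016042049070082111116135149173190204211233248267,
  012023045054065085104115128146170185203212238255267,
  013022044055064084105114129147171184202213239254267,
  014021047052067087106113130144168187201214236253267,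
  015020046053066086107112131145169186200215237252267,
  001029040054074089096116142147165187207210231252268,
  002030043053073090099119141144166184204209228255268,
  004024045051079092101113139150160190202215226249268,
  007027046048076095102114136149163189201212225250268,
  008020033063067080105125135154172178198219238245268,
  009021032062066081104124134155173179199218239244268,
  010022035061065082107127133152174176196217236247268,
  011023034060064083106126132153175177197216237246268,
  012016037059071084109121131158168182194223234241268,
  013017036058070085108120130159169183195222235240268,
  014018039057069086111123129156170180192221232243268,
  015019038056068087110122128157171181193220233242268,
  001028042062067086109119137152171191197212226240269,
  002031041061064085110116138155168188198215225243269,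
  004025047059070083104114140157174186192209231245269,
  007026044056069080107113143158173185195210228246269,
  008021035055074095100126128145162182204221235249269,
  009020034054075094101127129144163183205220234248269,
  010023033053072093102124130147160180206223233251269,
  011022032052073092103125131146161181207222232250269,
  012017039051078091096122132149166178200217239253269,
  013016038050079090097123133148167179201216238252269,
  014019037049076089098120134151164176202219237255269,
  015018036048077088099121135150165177203218236254269,
  001031036056075082106124131151166189192213238249270,
  002028039059072081105127128148165190195214237250270,
  004026033061078087111121134146163184197208235252270,
  007025034062077084108122133145160187198211232255270,
  008022045049066091099117138158175180201220231240270,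
  009023044048067090098116139159174181200221230241270,
  010020047051064089097119136156173182203222229242270,
  011021046050065088096118137157172183202223228243270,
  012018041053070095103113142154171176205216227244270,
  013019040052071094102112143155170177204217226245270,
  014016043055068093101115140152169178207218225246270,
  015017042054069092100114141153168179206219224247270,
  001030038048066093103127132156168185202211235245271,
  002029037051065094100124135159171186201208232246271,
  004027035053071088098122129153173188207214238240271,
  007024032054068091097121130154174191204213237243271,
  008023047057075084110118141149161176195218226252271,
  009022046056074085111119140148160177194219227253271,
  010021045059073086108116143151163178193216224254271,
  011020044058072087109117142150162179192217225255271,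
  012019043061079080106114137145165180199222230248271,
  013018042060078081107115136144164181198223231249271,
  014017041063077082104112139147167182197220228250271,
  015016040062076083105113138146166183196221229251271,
  000016017028029064066073075080087088095160164170174,
  003016018025027032033044045096100106110112119120127,
  005016019021022048051053054192195197198256259261262,
  006016020026030128130137139176177188189224231232239,
  016023024031144145156157208210217219240244250254272,
  005017018020023056059061062201202204207257258260263,
  003017019024026034035046047099103105109115116123124,
  006017021027031133135140142180181184185226229234237,
  017022025030150151154155212214221223242246248252272,
  000018019030031065067072074083084091092163167169173,
  018021026029148149152153213215220222241245251255272,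
  006018022024028132134141143182183186187225230233238,
  019020027028146147158159209211216218243247249253272,
  006019023025029129131136138178179190191227228235236,
  000020021024025069071076078082085090093161165171175,
  003020022029031038039042043098102104108113118121126,
  003021023028030036037040041097101107111114117122125,
  000022023026027068070077079081086089094162166168172,
  005024027029030057058060063193194196199264267269270,
  005025026028031049050052055200203205206265266268271,
  000032034041043128135136143192196202206240241252253,
  006032035037038080083085086144147149150256260266270,
  005032036042046064071072079176178185187208209220221,
  032039040047048049060061160162169171224228234238272,
  006033034036039089090092095152155157158257261267271,
  000033035040042131132139140195199201205242243254255,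
  005033037043047066069074077181183188190212213216217,
  033038041046054055058059164166173175226230232236272,
  034037042045052053056057165167172174225229235239272,
  005034038040044065070073078180182189191214215218219,
  035036043044050051062063161163168170227231233237272,
  005035039041045067068075076177179184186210211222223,
  000036038045047129134137142194198200204246247250251,
  000037039044046130133138141193197203207244245248249,
  006040043045046081082084087153154156159259263265269,
  006041042044047088091093094145146148151258262264268,
  006048050057059064068074078112113124125240247248255,
  003048052058062080082089091128129140141208215216223,
  000048055056063096097108109144146153155176180186190,
  006049051056058067071073077114115126127243244251252,
  003049053059063085087092094132133136137210213218221,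
  000049054057062102103106107148150157159178182184188,
  000050053058061100101104105149151156158177181187191,
  003050054056060084086093095134135138139209214217222,
  000051052059060098099110111145147152154179183185189,
  003051055057061081083088090130131142143211212219220,
  006052054061063066070072076118119122123241246249254,
  006053055060062065069075079116117120121242245250253,
  003064065076077144148154158192199200207224226233235,
  064067069070096099101102128131133134256263264271272,
  065066068071105106108111136139141142258261266269272,
  003066067078079147151153157195196203204225227232234,
  003068069072073145149155159194197202205229231236238,
  003070071074075146150152156193198201206228230237239,
  072075077078097098100103137138140143259260267268272,
  073074076079104107109110129130132135257262265270272,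
  080081092093112116122126176183184191192194201203272,
  005080084090094096103104111224225236237240242249251,
  005081085091095098101106109228229232233245247252254,
  082083094095115119121125179180187188193195200202272,
  005082086088092097102105110230231234235244246253255,
  005083087089093099100107108226227238239241243248250,
  084085088089113117123127178181186189197199204206272,
  086087090091114118120124177182185190196198205207272,
  006096098105107160167168175192193204205208212218222,
  006097099104106163164171172194195206207211215217221,
  006100102109111161166169174198199202203210214216220,
  006101103108110162165170173196197200201209213219223,
  005112114121123128132138142144151152159160161172173,
  000112115117118208211213214224227229230256257268269,
  000113114116119217218220223232235237238260261264265,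
  005113115120122131135137141147148155156162163174175,
  005116118125127130134136140145150153158166167170171,
  005117119124126129133139143146149154157164165168169,
  000120123125126209210212215233234236239258259270271,
  000121122124127216219221222225226228231262263266267,
  003160163165166176179181182240243245246256258265267,
  003161162164167185186188191248251253254261263268270,
  003168171173174177178180183249250252255257259264266,
  003169170172175184187189190241242244247260262269271,
  000001002003004005006007008009010011012013014015272]
  pointRows := [
  192201206209212217224225230233234236261262266267272,
  000012024036048060072084096108120132144156168180272,
  001013025037049061073085097109121133145157169181272,
  193198207208229232235237240243244245268269270271272,
  002014026038050062074086098110122134146158170182272,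
  194197210211214218221223249250252253260263264265272,
  195199203205213216226227228231238239256257258259272,
  003015027039051063075087099111123135147159171183272,
  004016028040052064076088100112124136148160172184272,
  005017029041053065077089101113125137149161173185272,
  006018030042054066078090102114126138150162174186272,
  007019031043055067079091103115127139151163175187272,
  008020032044056068080092104116128140152164176188272,
  009021033045057069081093105117129141153165177189272,
  010022034046058070082094106118130142154166178190272,
  011023035047059071083095107119131143155167179191272,
  012025050087100113126139152165178191192193194195196,
  000037062075101112127138153164179190192197198199200,
  001036063074102115124137154167176189193197201202203,
  013024051086103114125136155166177188194198201204205,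
  002039060073104117130143148161174187195197204206207,
  014027048085105116131142149160175186194199202206208,
  015026049084106119128141150163172185194200203207209,
  003038061072107118129140151162173184196197205208209,
  004017030043056069082095108121146183196198203206210,
  005016031042057068083094096133158171193200205206211,
  006019028041058071080093097132159170195198202209211,
  007018029040059070081092109120147182193199204209210,
  008021034047052065078091098135156169192203204208211,
  009020035046053064079090110123144181192202205207210,
  010023032045054067076089111122145180195200201208210,
  011022033044055066077088099134157168196199201207211,
  013032046062078088107117132149163183193212213214215,
  000033047051079089106116121148162170193216217218219,
  001034044050076090105119120151161171198212216220221,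
  012035045063077091104118133150160182198213217222223,
  002028042049082092103113123153167168208214216222224,
  015029043060083093102112134152166181208213218220225,
  014030040061080094101115135155165180207213219221224,
  003031041048081095100114122154164169207215216223225,
  004018026058068073099127137144177191208215217221226,
  005019039059069084110126136157176190208212219223227,
  006016038056070085111125139156179189207214217220227,
  007017027057071072098124138145178188207212218222226,
  008022037054064086108131141159173187193221222225227,
  009023024055065075097130140146172186193220223224226,
  010020025052066074096129143147175185198214219225226,
  011021036053067087109128142158174184198215218224227,
  016034055093104110121138147167173180194215228229230,
  000017035039054061074092105139166172211215231232233,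
  001018032038053060075095106136165175211222228234235,
  019033052094107111120137146164174181194222231236237,
  002020030037059063072089100142163177211220229236238,
  021031058088101108123143145162176182194220232234239,
  022028057091102109122140144161179183194219233235238,
  003023029036056062073090103141160178211219230237239,
  004046067081098116126133155159168185197220230231235,
  005012027047049066080086117127154184210220228233237,
  006013026044048065083087118124153187210219229231234,
  007045064082099119125132152158169186197219228232236,
  008014025042051071077084112130151189210215235236239,
  009043070076096113131135150157170188197215234237238,
  010040069079097114128134149156171191197222229233239,
  011015024041050068078085115129148190210222230232238,
  017024040058063083116122141151157174192214228240241,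
  000016041059082087098117140150175181201221239240242,
  001019042056081086099118143149172180192218238242243,
  018025043057062080119123142148156173201223231241243,
  002021044054079085096112137155178183209223228242244,
  020026045055061078113120136154159179206218239241244,
  023027046052060077114121139153158176209221238241245,
  003022047053076084097115138152177182206214231242245,
  004012029071075094105110128162169187201214238244246,
  005028036051070095104129134145163186192221231244247,
  006031037050069092107130135144160185201218228245247,
  007013030068074093106111131161168184192223239245246,
  008033038049067090101124132147166191206223238240247,
  009014032066073091100108125167171190209218231240246,
  010015035065072088103109126164170189206221228243246,
  011034039048064089102127133146165188209214239243247,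
  023031038066082084105109137148159188192213229248249,
  000022030050067083104123136149169189209226237248250,
  001021029051064080107122139150168190206226229251252,
  020028039065081085106108138151158191201213237251253,
  002019035048070078101121141152171184201226235249254,
  018034036071079086100111140153157185206213232250254,
  017033037068076087103110143154156186209213235252255,
  003016032049069077102120142155170187192226232253255,
  004015044057061089114130132167175182192227237252254,
  005025045056075088098115131144166174209216229253254,
  006024046059074091099112128145165173206216237249255,
  007014047058060090113129133164172183201227229250255,
  008027040053073093096118126146163179201216232248252,
  009013041052063092119127134162178180206227235248253,
  010012042055062095116124135161177181209227232249251,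
  011026043054072094097117125147160176192216235250251,
  021030039049071076118125134144164175193230241249256,
  000020031070077086097119124165174183208230246252257,
  001023028069078087096116127166173182207236246250256,
  022029038048068079117126135145167172198236241253257,
  002017034067080084099114129160179181193234246253258,
  016035037051066081115128132146161178208234241250259,
  019032036050065082112131133147162177207233241252258,
  003018033064083085098113130163176180198233246249259,
  004025047054063093103120140149158190207234247249257,
  005014046055072092102111141148169191198234242252256,
  006015045052073095101110142151168188193233242250257,
  007024044053062094100121143150159189208233247253256,
  008012043058074089107109136153171186207230242253259,
  009027042059061088106122137152156187198230247250258,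
  010026041056060091105123138155157184193236247252259,
  011013040057075090104108139154170185208236242249258,
  028043048061077090098111128143177190193228248260261,
  000013029042076091129142146159176191207228254262263,
  001012030041079088130141147158179188208231255260262,
  031040049060078089099110131140178189198231251261263,
  002015032047081094124139144157173186198239248262264,
  033046050063080095096109125138172187208239254261265,
  034045051062083092097108126137175184207238255261264,
  003014035044082093127136145156174185193238251262265,
  004019053066072085104119122135153166193239255263266,
  005018024037052067105118152167170183207239251260267,
  006017025036055064106117155164171182208238248263267,
  007016054065073084107116123134154165198238254260266,
  008023026039057070100115149162168181198228255265267,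
  009022056071074087101114120133148163208228251264266,
  010021059068075086102113121132151160207231248265266,
  011020027038058069103112150161169180193231254264267,
  015033042053070074108127140155160169195212229241260,
  000032043052071085099126141154161182205224229247265,
  001035040055068084098125142153162183195225237247264,
  014034041054069075109124143152163168205217237241263,
  002029046057066087097131136151164180203217232247260,
  013028047056067072110130137150165171199225232241265,
  012031044059064073111129138149166170203224235241264,
  003030045058065086096128139148167181199212235247263,
  004023037048080091106113134147174189205212232242264,
  005022026063081090107112121156175188195224232246263,
  006021027062082089104115120157172191205225235246260,
  007020036049083088105114135146173190195217235242265,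
  008019024061076095102117123158178185199217229246264,
  009018039050077094103116132145179184203225229242263,
  010017038051078093100119133144176187199224237242260,
  011016025060079092101118122159177186203212237246265,
  019026047064075092096114142145161189196213230240260,
  000018046049065093115122143160171188196227236244264,
  001017045048066094112123140163170191204227230245265,
  016027044067074095097113141144162190204213236243263,
  002023043051068088118120138165169185202227233240263,
  022024042069073089098119139147164184202213234244265,
  021025041070072090099116136146167187200213233245264,
  003020040050071091117121137166168186200227234243260,
  004032039055083086101109129150156178202216236245260,
  005013033054060082100128135151179182202226230243264,
  006012034053061081103131134148176183200226236240265,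
  007035038052080087102108130149157177200216230244263,
  008015028059062079105125133154174180196226234245263,
  009029037058078084104111124155158175196216233243265,
  010030036057077085107110127152159172204216234240264,
  011014031056063076106126132153173181204226233244260,
  022045059060080085103124146162171185192215256260268,
  000023025044058081102110125135163184206222258260269,
  001020024047057082101111126134160187209215259263269,
  021046056061083084100127147161170186201222257263268,
  002018027041055076107108128133166189192219257265269,
  019040054062077087106129144167169188206220259265268,
  016043053063078086105130145164168191209219258264268,
  003017026042052079104109131132165190201220256264269,
  004031051065074090117142152157179180209222256265270,
  005015030038064091097116120143153178201215258265271,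
  006014029039067088096119121140154177192222259264271,
  007028050066075089118141155156176181206215257264270,
  008013035036069094099113122138148175209220257260271,
  009034049068072095112139149159174182201219259260270,
  010033048071073092115136150158173183192220258263270,
  011012032037070093098114123137151172206219256263271,
  014037057065079095099120150166176184195214230248268,
  000027056064078094109134151167177185195223234255270,
  001026059067077093108135148164178186205214233254270,
  015036058066076092098121149165179187205223236251268,
  002025053069083091111132154162172188199221230251270,
  012039052068082090097122155163173189199218234254268,
  013038055071081089096123152160174190203221233255268,
  003024054070080088110133153161175191203218236248270,
  004020034042060087107115125141145170199223233248271,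
  005021035043050073106114124140159180199214236255269,
  006022032040051072105113127143158181203223230254269,
  007023033041061086104112126142144171203214234251271,
  008016030046048075103119129137157182195218233251269,
  009017031047062085102118128136147168195221236254271,
  010018028044063084101117131139146169205218230255271,
  011019029045049074100116130138156183205221234248269,
  018035056089097112129135154158168187194212240248256,
  000019034038057063073088113128155186210225245251256,
  001016033039058062072091114131152185210224244248257,
  017032059090096115130134153159169184194217243251257,
  002022031036052061075093116125150191210212243255259,
  023030053092099117124133151156170190194225244254259,
  020029054095098118127132148157171189194224245255258,
  003021028037055060074094119126149188210217240254258,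
  004013027045050070079084102143164173211224240251259,
  005044071078103108122142147165172181197217245248259,
  006047068077100109123141146166175180197212244251258,
  007012026046051069076085101140167174211225243248258,
  008041066083106110120139145160177183197224243254256,
  009015025040048067082086107138161176211217244255256,
  010014024043049064081087104137162179211212245254257,
  011042065080105111121136144163178182197225240255257,
  027036054068081091101119130136170181196214229256261,
  000015055069080090100118131137145158204214235259266,
  001014052070083089103117128138144159196223232258266,
  026037053071082088102116129139171180204223237257261,
  002013058064077095105115126140147156200218237256266,
  025038059065076094104114127141168183202218232259261,
  024039056066079093107113124142169182200221235258261,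
  003012057067078092106112125143146157202221229257266,
  004022035041049062096111151165176186204218229258267,
  005023034040074085123132150164177187196218235257262,
  006020033043075084122133149167178184204221232256262,
  007021032042048063097110148166179185196221237259267,
  008018031045072087121134155161172190202214237258262,
  009019030044051060098109154160173191200214232257267,
  010016029047050061099108153163174188202223235256267,
  011017028046073086120135152162175189200223229259262,
  029044052069072086106115123133179186195215240249261,
  000014028045053068107114147157178187203220243249267,
  001015031046054071104113146156177184199219240253267,
  030047055070073087105112122132176185205222243253261,
  002012033040056065102119145159175190205215245250267,
  032041057064074084103118121135174191199220244250261,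
  035042058067075085100117120134173188203219245252261,
  003013034043059066101116144158172189195222244252267,
  004021024038077092131138154163171181195219243250262,
  005020048062076093099109130139155162203222240250266,
  006023049063079094098108129136152161199215243252266,
  007022025039078095128137153160170180205220240252262,
  008017050060081088097111127142150167205219244249266,
  009016026036080089126143151166169183199222245249262,
  010019027037083090125140148165168182203215244253262,
  011018051061082091096110124141149164195220245253266,
  020041051067073094102131153156172182196212228249268,
  000021026040066095103111130133152173202212238253271,
  001022027043065092100110129132155174200217239249271,
  023042050064072093101128154157175183204217231253268,
  002016024045071090106109127135149176196225231252271,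
  017044049070075091107126148158177180202225239250268,
  018047048069074088104125151159178181200224238252268,
  003019025046068089105108124134150179204224228250271,
  004014033036059078097118123139161188200225228253269,
  005032058061079087119138146160168189204225238249270,
  006035057060076086116137147163169190196224239253270,
  007015034037056077096117122136162191202224231249269,
  008029055063082085114143144165170184200212231250270,
  009012028038054083099115121142164185204212239252269,
  010013031039053080098112120141167186196217238250269,
  011030052062081084113140145166171187202217228252270,
  000001002003004005006007008009010011194213241261268,
  012013014015016017018019020021022023197216247261270,
  024025026027028029030031032033034035197227242266268,
  036037038039040041042043044045046047194226246266270,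
  048049050051052053054055056057058059197213246262271,
  060061062063064065066067068069070071194216242262269,
  072073074075076077078079080081082083194227247267271,
  084085086087088089090091092093094095197226241267269,
  096097098099100101102103104105106107210227241262270,
  108109110111112113114115116117118119211226247262268,
  120121122123124125126127128129130131211213242267270,
  132133134135136137138139140141142143210216246267268,
  144145146147148149150151152153154155211227246261269,
  156157158159160161162163164165166167210226242261271,
  168169170171172173174175176177178179210213247266269,
  180181182183184185186187188189190191211216241266271,
  196200202204215219220222241242246247248251254255272]

theorem derivedDualHallA_isPlane : derivedDualHallA.IsPlane := by
  constructor <;> decide +kernel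

/-- Unitals in the plane with table `derivedDualHallA`. -/
noncomputable def derivedDualHallAUnitals : List TableUnital := [
  ⟨derivedDualHallA, derivedDualHallA_isPlane,
    69997242084403370352941154976891508554936659642070686668988075881502266563495936,
    2988, by decide +kernel⟩,
  ⟨derivedDualHallA, derivedDualHallA_isPlane,
    49560823500179636406763090996767314544867570158444110837416709801315882480791572,
    4775, by decide +kernel⟩,
  ⟨derivedDualHallA, derivedDualHallA_isPlane,
    13281368983113905369156656822807902080207058687612309148193967094513213995355865193,
    4865, by decide +kernel⟩,
  ⟨derivedDualHallA, derivedDualHallA_isPlane,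
    6890644974492823465558092399986351709758293500424900635548352456753184,
    4960, by decide +kernel⟩,
  ⟨derivedDualHallA, derivedDualHallA_isPlane,
    7558907585412006293474846340973230879308438355573841943674998140317684531044810784,
    6305, by decide +kernel⟩,
  ⟨derivedDualHallA, derivedDualHallA_isPlane,
    377945379273430917993208149790285172691711954261050910687319344967718324933689345,
    6306, by decide +kernel⟩,
  ⟨derivedDualHallA, derivedDualHallA_isPlane,
    480422330766004326083473349426040657530150975750595232595338013571100925849765888,
    6630, by decide +kernel⟩,
  ⟨derivedDualHallA, derivedDualHallA_isPlane,
    40999686138182409969010601443199295208692857319232272074546603077000332967968,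
    7842, by decide +kernel⟩]

/-- Unitals in the plane with table `derivedDualHallA.dual`. -/
noncomputable def derivedDualHallADualUnitals : List TableUnital := [
  ⟨derivedDualHallA.dual, derivedDualHallA_isPlane.dual,
    9828953839165335677800156323110634230182192717409967579360261071925673460953813056,
    33, by decide +kernel⟩,
  ⟨derivedDualHallA.dual, derivedDualHallA_isPlane.dual,
    5558472596671119793406769612774993620293308723495664286007870581409296287056172,
    1606, by decide +kernel⟩,
  ⟨derivedDualHallA.dual, derivedDualHallA_isPlane.dual,
    7588575136599148355199837604730778489185040688232700187618942917294332507174473472,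
    3073, by decide +kernel⟩,
  ⟨derivedDualHallA.dual, derivedDualHallA_isPlane.dual,
    8647382236989687070486436083942472092246802118943128694544396206964010090540314948,
    3270, by decide +kernel⟩]

/-- The incidence table of the semifield plane with a collineation group of order `442368`. -/
def semifieldB : IncidenceTable where
  lineRows := [
  000016032048064080096112128144160176192208224240256,
  001017033049065081097113129145161177193209225241256,
  002018034050066082098114130146162178194210226242256,
  003019035051067083099115131147163179195211227243256,
  004020036052068084100116132148164180196212228244256,
  005021037053069085101117133149165181197213229245256,
  006022038054070086102118134150166182198214230246256,
  007023039055071087103119135151167183199215231247256,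
  008024040056072088104120136152168184200216232248256,
  009025041057073089105121137153169185201217233249256,
  010026042058074090106122138154170186202218234250256,
  011027043059075091107123139155171187203219235251256,
  012028044060076092108124140156172188204220236252256,
  013029045061077093109125141157173189205221237253256,
  014030046062078094110126142158174190206222238254256,
  015031047063079095111127143159175191207223239255256,
  000017034051068085102119136153170187204221238255257,
  001016035050069084103118137152171186205220239254257,
  002019032049070087100117138155168185206223236253257,
  003018033048071086101116139154169184207222237252257,
  004021038055064081098115140157174191200217234251257,
  005020039054065080099114141156175190201216235250257,
  006023036053066083096113142159172189202219232249257,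
  007022037052067082097112143158173188203218233248257,
  008025042059076093110127128145162179196213230247257,
  009024043058077092111126129144163178197212231246257,
  010027040057078095108125130147160177198215228245257,
  011026041056079094109124131146161176199214229244257,
  012029046063072089106123132149166183192209226243257,
  013028047062073088107122133148167182193208227242257,
  014031044061074091104121134151164181194211224241257,
  015030045060075090105120135150165180195210225240257,
  000018035049077095110124134148165183203217232250258,
  001019034048076094111125135149164182202216233251258,
  002016033051079093108126132150167181201219234248258,
  003017032050078092109127133151166180200218235249258,
  004022039053073091106120130144161179207221236254258,
  005023038052072090107121131145160178206220237255258,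
  006020037055075089104122128146163177205223238252258,
  007021036054074088105123129147162176204222239253258,
  008026043057069087102116142156173191195209224242258,
  009027042056068086103117143157172190194208225243258,
  010024041059071085100118140158175189193211226240258,
  011025040058070084101119141159174188192210227241258,
  012030047061065083098112138152169187199213228246258,
  013031046060064082099113139153168186198212229247258,
  014028045063067081096114136154171185197215230244258,
  015029044062066080097115137155170184196214231245258,
  000019033050073090104123142157175188199212230245259,
  001018032051072091105122143156174189198213231244259,
  002017035048075088106121140159173190197214228247259,
  003016034049074089107120141158172191196215229246259,
  004023037054077094108127138153171184195208226241259,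
  005022036055076095109126139152170185194209227240259,
  006021039052079092110125136155169186193210224243259,
  007020038053078093111124137154168187192211225242259,
  008027041058065082096115134149167180207220238253259,
  009026040059064083097114135148166181206221239252259,
  010025043056067080098113132151165182205222236255259,
  011024042057066081099112133150164183204223237254259,
  012031045062069086100119130145163176203216234249259,
  013030044063068087101118131144162177202217235248259,
  014029047060071084102117128147161178201218232251259,
  015028046061070085103116129146160179200219233250259,
  000020042062072092098118135147173185207219229241260,
  001021043063073093099119134146172184206218228240260,
  002022040060074094096116133145175187205217231243260,
  003023041061075095097117132144174186204216230242260,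
  004016046058076088102114131151169189203223225245260,
  005017047059077089103115130150168188202222224244260,
  006018044056078090100112129149171191201221227247260,
  007019045057079091101113128148170190200220226246260,
  008028034054064084106126143155165177199211237249260,
  009029035055065085107127142154164176198210236248260,
  010030032052066086104124141153167179197209239251260,
  011031033053067087105125140152166178196208238250260,
  012024038050068080110122139159161181195215233253260,
  013025039051069081111123138158160180194214232252260,
  014026036048070082108120137157163183193213235255260,
  015027037049071083109121136156162182192212234254260,
  000029037056070091099126140145169180202215239242261,
  001028036057071090098127141144168181203214238243261,
  002031039058068089097124142147171182200213237240261,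
  003030038059069088096125143146170183201212236241261,
  004025033060066095103122136149173176206211235246261,
  005024032061067094102123137148172177207210234247261,
  006027035062064093101120138151175178204209233244261,
  007026034063065092100121139150174179205208232245261,
  008021045048078083107118132153161188194223231250261,
  009020044049079082106119133152160189195222230251261,
  010023047050076081105116134155163190192221229248261,
  011022046051077080104117135154162191193220228249261,
  012017041052074087111114128157165184198219227254261,
  013016040053075086110115129156164185199218226255261,
  014019043054072085109112130159167186196217225252261,
  015018042055073084108113131158166187197216224253261,
  000021040061071082111122131150171190196209236249262,
  001020041060070083110123130151170191197208237248262,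
  002023042063069080109120129148169188198211238251262,
  003022043062068081108121128149168189199210239250262,
  004017044057067086107126135146175186192213232253262,
  005016045056066087106127134147174187193212233252262,
  006019046059065084105124133144173184194215234255262,
  007018047058064085104125132145172185195214235254262,
  008029032053079090103114139158163182204217228241262,
  009028033052078091102115138159162183205216229240262,
  010031034055077088101112137156161180206219230243262,
  011030035054076089100113136157160181207218231242262,
  012025036049075094099118143154167178200221224245262,
  013024037048074095098119142155166179201220225244262,
  014027038051073092097116141152165176202223226247262,
  015026039050072093096117140153164177203222227246262,
  000030036058067093103121133155161191198216226252263,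
  001031037059066092102120132154160190199217227253263,
  002028038056065095101123135153163189196218224254263,
  003029039057064094100122134152162188197219225255263,
  004026032062071089099125129159165187194220230248263,
  005027033063070088098124128158164186195221231249263,
  006024034060069091097127131157167185192222228250263,
  007025035061068090096126130156166184193223229251263,
  008022044050075085111113141147169183206208234244263,
  009023045051074084110112140146168182207209235245263,
  010020046048073087109115143145171181204210232246263,
  011021047049072086108114142144170180205211233247263,
  012018040054079081107117137151173179202212238240263,
  013019041055078080106116136150172178203213239241263,
  014016042052077083105119139149175177200214236242263,
  015017043053076082104118138148174176201215237243263,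
  000022041063066084107125138156163181200222225247264,
  001023040062067085106124139157162180201223224246264,
  002020043061064086105127136158161183202220227245264,
  003021042060065087104126137159160182203221226244264,
  004018045059070080111121142152167177204218229243264,
  005019044058071081110120143153166176205219228242264,
  006016047057068082109123140154165179206216231241264,
  007017046056069083108122141155164178207217230240264,
  008030033055074092099117130148171189192214233255264,
  009031032054075093098116131149170188193215232254264,
  010028035053072094097119128150169191194212235253264,
  011029034052073095096118129151168190195213234252264,
  012026037051078088103113134144175185196210237251264,
  013027036050079089102112135145174184197211236250264,
  014024039049076090101115132146173187198208239249264,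
  015025038048077091100114133147172186199209238248264,
  000031038057076083106117129158167184205210235244265,
  001030039056077082107116128159166185204211234245265,
  002029036059078081104119131156165186207208233246265,
  003028037058079080105118130157164187206209232247265,
  004027034061072087110113133154163188201214239240265,
  005026035060073086111112132155162189200215238241265,
  006025032063074085108115135152161190203212237242265,
  007024033062075084109114134153160191202213236243265,
  008023046049068091098125137150175176197218227252265,
  009022047048069090099124136151174177196219226253265,
  010021044051070089096127139148173178199216225254265,
  011020045050071088097126138149172179198217224255265,
  012019042053064095102121141146171180193222231248265,
  013018043052065094103120140147170181192223230249265,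
  014017040055066093100123143144169182195220229250265,
  015016041054067092101122142145168183194221228251265,
  000024045053065089108116143151162186206214227251266,
  001025044052064088109117142150163187207215226250266,
  002026047055067091110118141149160184204212225249266,
  003027046054066090111119140148161185205213224248266,
  004028041049069093104112139147166190202210231255266,
  005029040048068092105113138146167191203211230254266,
  006030043051071095106114137145164188200208229253266,
  007031042050070094107115136144165189201209228252266,
  008016037061073081100124135159170178198222235243266,
  009017036060072080101125134158171179199223234242266,
  010018039063075083102126133157168176196220233241266,
  011019038062074082103127132156169177197221232240266,
  012020033057077085096120131155174182194218239247266,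
  013021032056076084097121130154175183195219238246266,
  014022035059079087098122129153172180192216237245266,
  015023034058078086099123128152173181193217236244266,
  000026046052075081101127130152172182201211231253267,
  001027047053074080100126131153173183200210230252267,
  002024044054073083103125128154174180203209229255267,
  003025045055072082102124129155175181202208228254267,
  004030042048079085097123134156168178205215227249267,
  005031043049078084096122135157169179204214226248267,
  006028040050077087099121132158170176207213225251267,
  007029041051076086098120133159171177206212224250267,
  008018038060067089109119138144164190193219239245267,
  009019039061066088108118139145165191192218238244267,
  010016036062065091111117136146166188195217237247267,
  011017037063064090110116137147167189194216236246267,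
  012022034056071093105115142148160186197223235241267,
  013023035057070092104114143149161187196222234240267,
  014020032058069095107113140150162184199221233243267,
  015021033059068094106112141151163185198220232242267,
  000023043060079088100115141154166177194213233254268,
  001022042061078089101114140155167176195212232255268,
  002021041062077090102113143152164179192215235252268,
  003020040063076091103112142153165178193214234253268,
  004019047056075092096119137158162181198209237250268,
  005018046057074093097118136159163180199208236251268,
  006017045058073094098117139156160183196211239248268,
  007016044059072095099116138157161182197210238249268,
  008031035052071080108123133146174185202221225246268,
  009030034053070081109122132147175184203220224247268,
  010029033054069082110121135144172187200223227244268,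
  011028032055068083111120134145173186201222226245268,
  012027039048067084104127129150170189206217229242268,
  013026038049066085105126128151171188207216228243268,
  014025037050065086106125131148168191204219231240268,
  015024036051064087107124130149169190205218230241268,
  000027044055069094105114132159168179193218237246269,
  001026045054068095104115133158169178192219236247269,
  002025046053071092107112134157170177195216239244269,
  003024047052070093106113135156171176194217238245269,
  004031040051065090109118128155172183197222233242269,
  005030041050064091108119129154173182196223232243269,
  006029042049067088111116130153174181199220235240269,
  007028043048066089110117131152175180198221234241269,
  008019036063077086097122140151160187201210229254269,
  009018037062076087096123141150161186200211228255269,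
  010017038061079084099120142149162185203208231252269,
  011016039060078085098121143148163184202209230253269,
  012023032059073082101126136147164191205214225250269,
  013022033058072083100127137146165190204215224251269,
  014021034057075080103124138145166189207212227248269,
  015020035056074081102125139144167188206213226249269,
  000025047054078087097120139146164189197220234243270,
  001024046055079086096121138147165188196221235242270,
  002027045052076085099122137144166191199222232241270,
  003026044053077084098123136145167190198223233240270,
  004029043050074083101124143150160185193216238247270,
  005028042051075082100125142151161184192217239246270,
  006031041048072081103126141148162187195218236245270,
  007030040049073080102127140149163186194219237244270,
  008017039062070095105112131154172181205212226251270,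
  009016038063071094104113130155173180204213227250270,
  010019037060068093107114129152174183207214224249270,
  011018036061069092106115128153175182206215225248270,
  012021035058066091109116135158168177201208230255270,
  013020034059067090108117134159169176200209231254270,
  014023033056064089111118133156170179203210228253270,
  015022032057065088110119132157171178202211229252270,
  000028039059074086109113137149174178195223228248271,
  001029038058075087108112136148175179194222229249271,
  002030037057072084111115139151172176193221230250271,
  003031036056073085110114138150173177192220231251271,
  004024035063078082105117141145170182199219224252271,
  005025034062079083104116140144171183198218225253271,
  006026033061076080107119143147168180197217226254271,
  007027032060077081106118142146169181196216227255271,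
  008020047051066094101121129157166186203215236240271,
  009021046050067095100120128156167187202214237241271,
  010022045049064092103123131159164184201213238242271,
  011023044048065093102122130158165185200212239243271,
  012016043055070090097125133153162190207211232244271,
  013017042054071091096124132152163191206210233245271,
  014018041053068088099127135155160188205209234246271,
  015019040052069089098126134154161189204208235247271,
  000001002003004005006007008009010011012013014015272,
  016017018019020021022023024025026027028029030031272,
  032033034035036037038039040041042043044045046047272,
  048049050051052053054055056057058059060061062063272,
  064065066067068069070071072073074075076077078079272,
  080081082083084085086087088089090091092093094095272,
  096097098099100101102103104105106107108109110111272,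
  112113114115116117118119120121122123124125126127272,
  128129130131132133134135136137138139140141142143272,
  144145146147148149150151152153154155156157158159272,
  160161162163164165166167168169170171172173174175272,
  176177178179180181182183184185186187188189190191272,
  192193194195196197198199200201202203204205206207272,
  208209210211212213214215216217218219220221222223272,
  224225226227228229230231232233234235236237238239272,
  240241242243244245246247248249250251252253254255272,
  256257258259260261262263264265266267268269270271272]
  pointRows := [
  000016032048064080096112128144160176192208224240256,
  001017033049065081097113129145161177193209225241256,
  002018034050066082098114130146162178194210226242256,
  003019035051067083099115131147163179195211227243256,
  004020036052068084100116132148164180196212228244256,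
  005021037053069085101117133149165181197213229245256,
  006022038054070086102118134150166182198214230246256,
  007023039055071087103119135151167183199215231247256,
  008024040056072088104120136152168184200216232248256,
  009025041057073089105121137153169185201217233249256,
  010026042058074090106122138154170186202218234250256,
  011027043059075091107123139155171187203219235251256,
  012028044060076092108124140156172188204220236252256,
  013029045061077093109125141157173189205221237253256,
  014030046062078094110126142158174190206222238254256,
  015031047063079095111127143159175191207223239255256,
  000017034051068093101126134159168186199219233252257,
  001016035050069092100127135158169187198218232253257,
  002019032049070095103124132157170184197217235254257,
  003018033048071094102125133156171185196216234255257,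
  004021038055064089097122130155172190195223237248257,
  005020039054065088096123131154173191194222236249257,
  006023036053066091099120128153174188193221239250257,
  007022037052067090098121129152175189192220238251257,
  008025042059076085109118142151160178207211225244257,
  009024043058077084108119143150161179206210224245257,
  010027040057078087111116140149162176205209227246257,
  011026041056079086110117141148163177204208226247257,
  012029046063072081105114138147164182203215229240257,
  013028047062073080104115139146165183202214228241257,
  014031044061074083107112136145166180201213231242257,
  015030045060075082106113137144167181200212230243257,
  000018035049074085104116137150173190203220239247258,
  001019034048075084105117136151172191202221238246258,
  002016033051072087106118139148175188201222237245258,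
  003017032050073086107119138149174189200223236244258,
  004022039053078081108112141146169186207216235243258,
  005023038052079080109113140147168187206217234242258,
  006020037055076083110114143144171184205218233241258,
  007021036054077082111115142145170185204219232240258,
  008026043057066093096124129158165182195212231255258,
  009027042056067092097125128159164183194213230254258,
  010024041059064095098126131156167180193214229253258,
  011025040058065094099127130157166181192215228252258,
  012030047061070089100120133154161178199208227251258,
  013031046060071088101121132155160179198209226250258,
  014028045063068091102122135152163176197210225249258,
  015029044062069090103123134153162177196211224248258,
  000019033050078088109122143153165180204215230251259,
  001018032051079089108123142152164181205214231250259,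
  002017035048076090111120141155167182206213228249259,
  003016034049077091110121140154166183207212229248259,
  004023037054074092105126139157161176200211226255259,
  005022036055075093104127138156160177201210227254259,
  006021039052072094107124137159163178202209224253259,
  007020038053073095106125136158162179203208225252259,
  008027041058070080101114135145173188196223238243259,
  009026040059071081100115134144172189197222239242259,
  010025043056068082103112133147175190198221236241259,
  011024042057069083102113132146174191199220237240259,
  012031045062066084097118131149169184192219234247259,
  013030044063067085096119130148168185193218235246259,
  014029047060064086099116129151171186194217232245259,
  015028046061065087098117128150170187195216233244259,
  000020045057072086103115130156161187207213238250260,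
  001021044056073087102114131157160186206212239251260,
  002022047059074084101113128158163185205215236248260,
  003023046058075085100112129159162184204214237249260,
  004016041061076082099119134152165191203209234254260,
  005017040060077083098118135153164190202208235255260,
  006018043063078080097117132154167189201211232252260,
  007019042062079081096116133155166188200210233253260,
  008028037049064094111123138148169179199221230242260,
  009029036048065095110122139149168178198220231243260,
  010030039051066092109121136150171177197223228240260,
  011031038050067093108120137151170176196222229241260,
  012024033053068090107127142144173183195217226246260,
  013025032052069091106126143145172182194216227247260,
  014026035055070088105125140146175181193219224244260,
  015027034054071089104124141147174180192218225245260,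
  000021047058076091098125132147169177200222231246261,
  001020046059077090099124133146168176201223230247261,
  002023045056078089096127134145171179202220229244261,
  003022044057079088097126135144170178203221228245261,
  004017043062072095102121128151173181204218227242261,
  005016042063073094103120129150172180205219226243261,
  006019041060074093100123130149175183206216225240261,
  007018040061075092101122131148174182207217224241261,
  008029039050068083106117140155161185192214239254261,
  009028038051069082107116141154160184193215238255261,
  010031037048070081104119142153163187194212237252261,
  011030036049071080105118143152162186195213236253261,
  012025035054064087110113136159165189196210235250261,
  013024034055065086111112137158164188197211234251261,
  014027033052066085108115138157167191198208233248261,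
  015026032053067084109114139156166190199209232249261,
  000022046056066083111119139154172181196217225253262,
  001023047057067082110118138155173180197216224252262,
  002020044058064081109117137152174183198219227255262,
  003021045059065080108116136153175182199218226254262,
  004018042060070087107115143158168177192221229249262,
  005019043061071086106114142159169176193220228248262,
  006016040062068085105113141156170179194223231251262,
  007017041063069084104112140157171178195222230250262,
  008030038048074091103127131146164189204209233245262,
  009031039049075090102126130147165188205208232244262,
  010028036050072089101125129144166191206211235247262,
  011029037051073088100124128145167190207210234246262,
  012026034052078095099123135150160185200213237241262,
  013027035053079094098122134151161184201212236240262,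
  014024032054076093097121133148162187202215239243262,
  015025033055077092096120132149163186203214238242262,
  000023044059070094106121141149164191195210232241263,
  001022045058071095107120140148165190194211233240263,
  002021046057068092104123143151166189193208234243263,
  003020047056069093105122142150167188192209235242263,
  004019040063066090110125137145160187199214236245263,
  005018041062067091111124136144161186198215237244263,
  006017042061064088108127139147162185197212238247263,
  007016043060065089109126138146163184196213239246263,
  008031036051078086098113133157172183203218224249263,
  009030037050079087099112132156173182202219225248263,
  010029038049076084096115135159174181201216226251263,
  011028039048077085097114134158175180200217227250263,
  012027032055074082102117129153168179207222228253263,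
  013026033054075083103116128152169178206223229252263,
  014025034053072080100119131155170177205220230255263,
  015024035052073081101118130154171176204221231254263,
  000024038062071092099117138145175178205212235249264,
  001025039063070093098116139144174179204213234248264,
  002026036060069094097119136147173176207214233251264,
  003027037061068095096118137146172177206215232250264,
  004028034058067088103113142149171182201208239253264,
  005029035059066089102112143148170183200209238252264,
  006030032056065090101115140151169180203210237255264,
  007031033057064091100114141150168181202211236254264,
  008016046054079084107125130153167186197220227241264,
  009017047055078085106124131152166187196221226240264,
  010018044052077086105127128155165184199222225243264,
  011019045053076087104126129154164185198223224242264,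
  012020042050075080111121134157163190193216231245264,
  013021043051074081110120135156162191192217230244264,
  014022040048073082109123132159161188195218229247264,
  015023041049072083108122133158160189194219228246264,
  000025036061067081102123140158167184202223226245265,
  001024037060066080103122141159166185203222227244265,
  002027038063065083100121142156165186200221224247265,
  003026039062064082101120143157164187201220225246265,
  004029032057071085098127136154163188206219230241265,
  005028033056070084099126137155162189207218231240265,
  006031034059069087096125138152161190204217228243265,
  007030035058068086097124139153160191205216229242265,
  008017044053075089110115132150175176194215234253265,
  009016045052074088111114133151174177195214235252265,
  010019046055073091108113134148173178192213232255265,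
  011018047054072090109112135149172179193212233254265,
  012021040049079093106119128146171180198211238249265,
  013020041048078092107118129147170181199210239248265,
  014023042051077095104117130144169182196209236251265,
  015022043050076094105116131145168183197208237250265,
  000026037063077089107113131151162188198216228254266,
  001027036062076088106112130150163189199217229255266,
  002024039061079091105115129149160190196218230252266,
  003025038060078090104114128148161191197219231253266,
  004030033059073093111117135147166184194220224250266,
  005031032058072092110116134146167185195221225251266,
  006028035057075095109119133145164186192222226248266,
  007029034056074094108118132144165187193223227249266,
  008018045055069081099121139159170180206208236246266,
  009019044054068080098120138158171181207209237247266,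
  010016047053071083097123137157168182204210238244266,
  011017046052070082096122136156169183205211239245266,
  012022041051065085103125143155174176202212232242266,
  013023040050064084102124142154175177203213233243266,
  014020043049067087101127141153172178200214234240266,
  015021042048066086100126140152173179201215235241266,
  000027039060073084110127133152170182193211237242267,
  001026038061072085111126132153171183192210236243267,
  002025037062075086108125135154168180195209239240267,
  003024036063074087109124134155169181194208238241267,
  004031035056077080106123129156174178197215233246267,
  005030034057076081107122128157175179196214232247267,
  006029033058079082104121131158172176199213235244267,
  007028032059078083105120130159173177198212234245267,
  008019047052065092102119141144162190201219229250267,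
  009018046053064093103118140145163191200218228251267,
  010017045054067094100117143146160188203217231248267,
  011016044055066095101116142147161189202216230249267,
  012023043048069088098115137148166186205223225254267,
  013022042049068089099114136149167187204222224255267,
  014021041050071090096113139150164184207221227252267,
  015020040051070091097112138151165185206220226253267,
  000028043055079090100118136157174185194209229243268,
  001029042054078091101119137156175184195208228242268,
  002030041053077088102116138159172187192211231241268,
  003031040052076089103117139158173186193210230240268,
  004024047051075094096114140153170189198213225247268,
  005025046050074095097115141152171188199212224246268,
  006026045049073092098112142155168191196215227245268,
  007027044048072093099113143154169190197214226244268,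
  008020035063071082108126128149166177202217237251268,
  009021034062070083109127129148167176203216236250268,
  010022033061069080110124130151164179200219239249268,
  011023032060068081111125131150165178201218238248268,
  012016039059067086104122132145162181206221233255268,
  013017038058066087105123133144163180207220232254268,
  014018037057065084106120134147160183204223235253268,
  015019036056064085107121135146161182205222234252268,
  000029041052075087097120142146166179197218236255269,
  001028040053074086096121143147167178196219237254269,
  002031043054073085099122140144164177199216238253269,
  003030042055072084098123141145165176198217239252269,
  004025045048079083101124138150162183193222232251269,
  005024044049078082100125139151163182192223233250269,
  006027047050077081103126136148160181195220234249269,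
  007026046051076080102127137149161180194221235248269,
  008021033060067095105112134154174187205210228247269,
  009020032061066094104113135155175186204211229246269,
  010023035062065093107114132152172185207208230245269,
  011022034063064092106115133153173184206209231244269,
  012017037056071091109116130158170191201214224243269,
  013016036057070090108117131159171190200215225242269,
  014019039058069089111118128156168189203212226241269,
  015018038059068088110119129157169188202213227240269,
  000030040054069095108114129155163183201221234244270,
  001031041055068094109115128154162182200220235245270,
  002028042052071093110112131153161181203223232246270,
  003029043053070092111113130152160180202222233247270,
  004026044050065091104118133159167179205217238240270,
  005027045051064090105119132158166178204216239241270,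
  006024046048067089106116135157165177207219236242270,
  007025047049066088107117134156164176206218237243270,
  008022032062077087100122137147171191193213226252270,
  009023033063076086101123136146170190192212227253270,
  010020034060079085102120139145169189195215224254270,
  011021035061078084103121138144168188194214225255270,
  012018036058073083096126141151175187197209230248270,
  013019037059072082097127140150174186196208231249270,
  014016038056075081098124143149173185199211228250270,
  015017039057074080099125142148172184198210229251270,
  000031042053065082105124135148171189206214227248271,
  001030043052064083104125134149170188207215226249271,
  002029040055067080107126133150169191204212225250271,
  003028041054066081106127132151168190205213224251271,
  004027046049069086109120131144175185202210231252271,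
  005026047048068087108121130145174184203211230253271,
  006025044051071084111122129146173187200208229254271,
  007024045050070085110123128147172186201209228255271,
  008023034061073090097116143156163181198222235240271,
  009022035060072091096117142157162180199223234241271,
  010021032063075088099118141158161183196220233242271,
  011020033062074089098119140159160182197221232243271,
  012019038057077094101112139152167177194218239244271,
  013018039056076095100113138153166176195219238245271,
  014017036059079092103114137154165179192216237246271,
  015016037058078093102115136155164178193217236247271,
  000001002003004005006007008009010011012013014015272,
  016017018019020021022023024025026027028029030031272,
  032033034035036037038039040041042043044045046047272,
  048049050051052053054055056057058059060061062063272,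
  064065066067068069070071072073074075076077078079272,
  080081082083084085086087088089090091092093094095272,
  096097098099100101102103104105106107108109110111272,
  112113114115116117118119120121122123124125126127272,
  128129130131132133134135136137138139140141142143272,
  144145146147148149150151152153154155156157158159272,
  160161162163164165166167168169170171172173174175272,
  176177178179180181182183184185186187188189190191272,
  192193194195196197198199200201202203204205206207272,
  208209210211212213214215216217218219220221222223272,
  224225226227228229230231232233234235236237238239272,
  240241242243244245246247248249250251252253254255272,
  256257258259260261262263264265266267268269270271272]

theorem semifieldB_isPlane : semifieldB.IsPlane := by
  constructor <;> decide +kernel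

/-- Unitals in the plane with table `semifieldB`. -/
noncomputable def semifieldBUnitals : List TableUnital := [
  ⟨semifieldB, semifieldB_isPlane,
    137792868941857431347731519870794078318509844632494901753369854877810295063121,
    548, by decide +kernel⟩,
  ⟨semifieldB, semifieldB_isPlane,
    125545595848372579126218145080948111120038686907778817740515410710518560920976,
    804, by decide +kernel⟩,
  ⟨semifieldB, semifieldB_isPlane,
    115807121923085694753563992372574629245757502656431549509881986315249714233881,
    1281, by decide +kernel⟩,
  ⟨semifieldB, semifieldB_isPlane,
    180295521136904457185339355295036839447933928190508722390716333822104408139252369,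
    3264, by decide +kernel⟩,
  ⟨semifieldB, semifieldB_isPlane,
    948605042012475943030854549422986615358826731153978301283340223122994486437374466,
    3525, by decide +kernel⟩,
  ⟨semifieldB, semifieldB_isPlane,
    137787568373703187199618294794548134057370247940520294085730586258583067299396,
    7394, by decide +kernel⟩,
  ⟨semifieldB, semifieldB_isPlane,
    116244849951367278555251084810068330984321692358014414200057751891137502904576,
    7455, by decide +kernel⟩,
  ⟨semifieldB, semifieldB_isPlane,
    127117751738440736702718530833915761967645200766260102268519741449884442592816,
    7974, by decide +kernel⟩]

/-- Unitals in the plane with table `semifieldB.dual`. -/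
noncomputable def semifieldBDualUnitals : List TableUnital := [
  ⟨semifieldB.dual, semifieldB_isPlane.dual,
    8776609891226137848334480074765062529631529189206421544346715364695983007085101056,
    4895, by decide +kernel⟩,
  ⟨semifieldB.dual, semifieldB_isPlane.dual,
    8100360511785665768985254899175115984983606769796417219106069008338151456998720644,
    5951, by decide +kernel⟩,
  ⟨semifieldB.dual, semifieldB_isPlane.dual,
    4783626777598568373511137419551628556632292781000397132559800393276583795564609568,
    6949, by decide +kernel⟩]

/-- The incidence table of the Hall plane. -/
def hall : IncidenceTable where
  lineRows := [
  000016032048064080096112128144160176192208224240256,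
  001017033049065081097113129145161177193209225241256,
  002018034050066082098114130146162178194210226242256,
  003019035051067083099115131147163179195211227243256,
  004020036052068084100116132148164180196212228244256,
  005021037053069085101117133149165181197213229245256,
  006022038054070086102118134150166182198214230246256,
  007023039055071087103119135151167183199215231247256,
  008024040056072088104120136152168184200216232248256,
  009025041057073089105121137153169185201217233249256,
  010026042058074090106122138154170186202218234250256,
  011027043059075091107123139155171187203219235251256,
  012028044060076092108124140156172188204220236252256,
  013029045061077093109125141157173189205221237253256,
  014030046062078094110126142158174190206222238254256,
  015031047063079095111127143159175191207223239255256,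
  000017034051068085102119136153170187204221238255257,
  001016035050069084103118137152171186205220239254257,
  002019032049070087100117138155168185206223236253257,
  003018033048071086101116139154169184207222237252257,
  004021038055064081098115140157174191200217234251257,
  005020039054065080099114141156175190201216235250257,
  006023036053066083096113142159172189202219232249257,
  007022037052067082097112143158173188203218233248257,
  008025042059076093110127128145162179196213230247257,
  009024043058077092111126129144163178197212231246257,
  010027040057078095108125130147160177198215228245257,
  011026041056079094109124131146161176199214229244257,
  012029046063072089106123132149166183192209226243257,
  013028047062073088107122133148167182193208227242257,
  014031044061074091104121134151164181194211224241257,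
  015030045060075090105120135150165180195210225240257,
  000018044062070084106120143157163177201219229247258,
  001019045063071085107121142156162176200218228246258,
  002016046060068086104122141159161179203217231245258,
  003017047061069087105123140158160178202216230244258,
  004022040058066080110124139153167181205223225243258,
  005023041059067081111125138152166180204222224242258,
  006020042056064082108126137155165183207221227241258,
  007021043057065083109127136154164182206220226240258,
  008026036054078092098112135149171185193211237255258,
  009027037055079093099113134148170184192210236254258,
  010024038052076094096114133151169187195209239253258,
  011025039053077095097115132150168186194208238252258,
  012030032050074088102116131145175189197215233251258,
  013031033051075089103117130144174188196214232250258,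
  014028034048072090100118129147173191199213235249258,
  015029035049073091101119128146172190198212234248258,
  000024046054075083101125140148162186199223233241259,
  001025047055074082100124141149163187198222232240259,
  002026044052073081103127142150160184197221235243259,
  003027045053072080102126143151161185196220234242259,
  004028042050079087097121136144166190195219237245259,
  005029043051078086096120137145167191194218236244259,
  006030040048077085099123138146164188193217239247259,
  007031041049076084098122139147165189192216238246259,
  008016038062067091109117132156170178207215225249259,
  009017039063066090108116133157171179206214224248259,
  010018036060065089111119134158168176205213227251259,
  011019037061064088110118135159169177204212226250259,
  012020034058071095105113128152174182203211229253259,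
  013021035059070094104112129153175183202210228252259,
  014022032056069093107115130154172180201209231255259,
  015023033057068092106114131155173181200208230254259,
  000025033056078087111118133156164189203210234243260,
  001024032057079086110119132157165188202211235242260,
  002027035058076085109116135158166191201208232241260,
  003026034059077084108117134159167190200209233240260,
  004029037060074083107114129152160185207214238247260,
  005028036061075082106115128153161184206215239246260,
  006031039062072081105112131154162187205212236245260,
  007030038063073080104113130155163186204213237244260,
  008017041048070095103126141148172181195218226251260,
  009016040049071094102127140149173180194219227250260,
  010019043050068093101124143150174183193216224249260,
  011018042051069092100125142151175182192217225248260,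
  012021045052066091099122137144168177199222230255260,
  013020044053067090098123136145169176198223231254260,
  014023047054064089097120139146170179197220228253260,
  015022046055065088096121138147171178196221229252260,
  000031043052069090110113141146166185200215227252261,
  001030042053068091111112140147167184201214226253261,
  002029041054071088108115143144164187202213225254261,
  003028040055070089109114142145165186203212224255261,
  004027047048065094106117137150162189204211231248261,
  005026046049064095107116136151163188205210230249261,
  006025045050067092104119139148160191206209229250261,
  007024044051066093105118138149161190207208228251261,
  008023035060077082102121133154174177192223235244261,
  009022034061076083103120132155175176193222234245261,
  010021033062079080100123135152172179194221233246261,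
  011020032063078081101122134153173178195220232247261,
  012019039056073086098125129158170181196219239240261,
  013018038057072087099124128159171180197218238241261,
  014017037058075084096127131156168183198217237242261,
  015016036059074085097126130157169182199216236243261,
  000029042055066095104117131158169180193220235246262,
  001028043054067094105116130159168181192221234247262,
  002031040053064093106119129156171182195222233244262,
  003030041052065092107118128157170183194223232245262,
  004025046051070091108113135154173176197216239242262,
  005024047050071090109112134155172177196217238243262,
  006027044049068089110115133152175178199218237240262,
  007026045048069088111114132153174179198219236241262,
  008021034063074087096125139150161188201212227254262,
  009020035062075086097124138151160189200213226255262,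
  010023032061072085098127137148163190203214225252262,
  011022033060073084099126136149162191202215224253262,
  012017038059078083100121143146165184205208231250262,
  013016039058079082101120142147164185204209230251262,
  014019036057076081102123141144167186207210229248262,
  015018037056077080103122140145166187206211228249262,
  000019040059065082105122132151172191197214237254263,
  001018041058064083104123133150173190196215236255263,
  002017042057067080107120134149174189199212239252263,
  003016043056066081106121135148175188198213238253263,
  004023044063069086109126128147168187193210233250263,
  005022045062068087108127129146169186192211232251263,
  006021046061071084111124130145170185195208235248263,
  007020047060070085110125131144171184194209234249263,
  008027032051073090097114140159164183205222229246263,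
  009026033050072091096115141158165182204223228247263,
  010025034049075088099112142157166181207220231244263,
  011024035048074089098113143156167180206221230245263,
  012031036055077094101118136155160179201218225242263,
  013030037054076095100119137154161178200219224243263,
  014029038053079092103116138153162177203216227240263,
  015028039052078093102117139152163176202217226241263,
  000023045058073094100115134145171188207216226245264,
  001022044059072095101114135144170189206217227244264,
  002021047056075092102113132147169190205218224247264,
  003020046057074093103112133146168191204219225246264,
  004019041062077090096119130149175184203220230241264,
  005018040063076091097118131148174185202221231240264,
  006017043060079088098117128151173186201222228243264,
  007016042061078089099116129150172187200223229242264,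
  008031037050065086108123142153163180199208234253264,
  009030036051064087109122143152162181198209235252264,
  010029039048067084110121140155161182197210232255264,
  011028038049066085111120141154160183196211233254264,
  012027033054069082104127138157167176195212238249264,
  013026032055068083105126139156166177194213239248264,
  014025035052071080106125136159165178193214236251264,
  015024034053070081107124137158164179192215237250264,
  000027036063067088103124129154165190194217230253265,
  001026037062066089102125128155164191195216231252265,
  002025038061065090101126131152167188192219228255265,
  003024039060064091100127130153166189193218229254265,
  004031032059071092099120133158161186198221226249265,
  005030033058070093098121132159160187199220227248265,
  006029034057069094097122135156163184196223224251265,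
  007028035056068095096123134157162185197222225250265,
  008019044055075080111116137146173182202209238245265,
  009018045054074081110117136147172183203208239244265,
  010017046053073082109118139144175180200211236247265,
  011016047052072083108119138145174181201210237246265,
  012023040051079084107112141150169178206213234241265,
  013022041050078085106113140151168179207212235240265,
  014021042049077086105114143148171176204215232243265,
  015020043048076087104115142149170177205214233242265,
  000030035061079081108114139149168182196218231249266,
  001031034060078080109115138148169183197219230248266,
  002028033063077083110112137151170180198216229251266,
  003029032062076082111113136150171181199217228250266,
  004026039057075085104118143145172178192222227253266,
  005027038056074084105119142144173179193223226252266,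
  006024037059073087106116141147174176194220225255266,
  007025036058072086107117140146175177195221224254266,
  008022043053071089100122131157160190204210239241266,
  009023042052070088101123130156161191205211238240266,
  010020041055069091102120129159162188206208237243266,
  011021040054068090103121128158163189207209236242266,
  012018047049067093096126135153164186200214235245266,
  013019046048066092097127134152165187201215234244266,
  014016045051065095098124133155166184202212233247266,
  015017044050064094099125132154167185203213232246266,
  000020038050077089107127135147161181202222236248267,
  001021039051076088106126134146160180203223237249267,
  002022036048079091105125133145163183200220238250267,
  003023037049078090104124132144162182201221239251267,
  004016034054073093111123131151165177206218232252267,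
  005017035055072092110122130150164176207219233253267,
  006018032052075095109121129149167179204216234254267,
  007019033053074094108120128148166178205217235255267,
  008028046058069081099119143155169189194214228240267,
  009029047059068080098118142154168188195215229241267,
  010030044056071083097117141153171191192212230242267,
  011031045057070082096116140152170190193213231243267,
  012024042062065085103115139159173185198210224244267,
  013025043063064084102114138158172184199211225245267,
  014026040060067087101113137157175187196208226246267,
  015027041061066086100112136156174186197209227247267,
  000026047053076086099121130152173183206212225251268,
  001027046052077087098120131153172182207213224250268,
  002024045055078084097123128154175181204214227249268,
  003025044054079085096122129155174180205215226248268,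
  004030043049072082103125134156169179202208229255268,
  005031042048073083102124135157168178203209228254268,
  006028041051074080101127132158171177200210231253268,
  007029040050075081100126133159170176201211230252268,
  008018039061068094107113138144165191198220233243268,
  009019038060069095106112139145164190199221232242268,
  010016037063070092105115136146167189196222235241268,
  011017036062071093104114137147166188197223234240268,
  012022035057064090111117142148161187194216237247268,
  013023034056065091110116143149160186195217236246268,
  014020033059066088109119140150163185192218239245268,
  015021032058067089108118141151162184193219238244268,
  000022039049074092109123137159174184195213228242269,
  001023038048075093108122136158175185194212229243269,
  002020037051072094111121139157172186193215230240269,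
  003021036050073095110120138156173187192214231241269,
  004018035053078088105127141155170188199209224246269,
  005019034052079089104126140154171189198208225247269,
  006016033055076090107125143153168190197211226244269,
  007017032054077091106124142152169191196210227245269,
  008030047057066084101115129151166176203221236250269,
  009031046056067085100114128150167177202220237251269,
  010028045059064086103113131149164178201223238248269,
  011029044058065087102112130148165179200222239249269,
  012026043061070080097119133147162180207217232254269,
  013027042060071081096118132146163181206216233255269,
  014024041063068082099117135145160182205219234252269,
  015025040062069083098116134144161183204218235253269,
  000021041060072093097116142155167178198211239250270,
  001020040061073092096117143154166179199210238251270,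
  002023043062074095099118140153165176196209237248270,
  003022042063075094098119141152164177197208236249270,
  004017045056076089101112138159163182194215235254270,
  005016044057077088100113139158162183195214234255270,
  006019047058078091103114136157161180192213233252270,
  007018046059079090102115137156160181193212232253270,
  008029033052064085105124134147175186206219231242270,
  009028032053065084104125135146174187207218230243270,
  010031035054066087107126132145173184204217229240270,
  011030034055067086106127133144172185205216228241270,
  012025037048068081109120130151171190202223227246270,
  013024036049069080108121131150170191203222226247270,
  014027039050070083111122128149169188200221225244270,
  015026038051071082110123129148168189201220224245270,
  000028037057071091098126138150175179205209232244271,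
  001029036056070090099127139151174178204208233245271,
  002030039059069089096124136148173177207211234246271,
  003031038058068088097125137149172176206210235247271,
  004024033061067095102122142146171183201213236240271,
  005025032060066094103123143147170182200212237241271,
  006026035063065093100120140144169181203215238242271,
  007027034062064092101121141145168180202214239243271,
  008020045049079083106118130158167187197217224252271,
  009021044048078082107119131159166186196216225253271,
  010022047051077081104116128156165185199219226254271,
  011023046050076080105117129157164184198218227255271,
  012016041053075087110114134154163191193221228248271,
  013017040052074086111115135155162190192220229249271,
  014018043055073085108112132152161189195223230250271,
  015019042054072084109113133153160188194222231251271,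
  000001002003004005006007008009010011012013014015272,
  016017018019020021022023024025026027028029030031272,
  032033034035036037038039040041042043044045046047272,
  048049050051052053054055056057058059060061062063272,
  064065066067068069070071072073074075076077078079272,
  080081082083084085086087088089090091092093094095272,
  096097098099100101102103104105106107108109110111272,
  112113114115116117118119120121122123124125126127272,
  128129130131132133134135136137138139140141142143272,
  144145146147148149150151152153154155156157158159272,
  160161162163164165166167168169170171172173174175272,
  176177178179180181182183184185186187188189190191272,
  192193194195196197198199200201202203204205206207272,
  208209210211212213214215216217218219220221222223272,
  224225226227228229230231232233234235236237238239272,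
  240241242243244245246247248249250251252253254255272,
  256257258259260261262263264265266267268269270271272]
  pointRows := [
  000016032048064080096112128144160176192208224240256,
  001017033049065081097113129145161177193209225241256,
  002018034050066082098114130146162178194210226242256,
  003019035051067083099115131147163179195211227243256,
  004020036052068084100116132148164180196212228244256,
  005021037053069085101117133149165181197213229245256,
  006022038054070086102118134150166182198214230246256,
  007023039055071087103119135151167183199215231247256,
  008024040056072088104120136152168184200216232248256,
  009025041057073089105121137153169185201217233249256,
  010026042058074090106122138154170186202218234250256,
  011027043059075091107123139155171187203219235251256,
  012028044060076092108124140156172188204220236252256,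
  013029045061077093109125141157173189205221237253256,
  014030046062078094110126142158174190206222238254256,
  015031047063079095111127143159175191207223239255256,
  000017034056073095109115135155174180202214229252257,
  001016035057072094108114134154175181203215228253257,
  002019032058075093111113133153172182200212231254257,
  003018033059074092110112132152173183201213230255257,
  004021038060077091105119131159170176206210225248257,
  005020039061076090104118130158171177207211224249257,
  006023036062079089107117129157168178204208227250257,
  007022037063078088106116128156169179205209226251257,
  008025042048065087101123143147166188194222237244257,
  009024043049064086100122142146167189195223236245257,
  010027040050067085103121141145164190192220239246257,
  011026041051066084102120140144165191193221238247257,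
  012029046052069083097127139151162184198218233240257,
  013028047053068082096126138150163185199219232241257,
  014031044054071081099125137149160186196216235242257,
  015030045055070080098124136148161187197217234243257,
  000018044062065091106120141148163182207215233245258,
  001019045063064090107121140149162183206214232244258,
  002016046060067089104122143150161180205213235247258,
  003017047061066088105123142151160181204212234246258,
  004022040058069095110124137144167178203211237241258,
  005023041059068094111125136145166179202210236240258,
  006020042056071093108126139146165176201209239243258,
  007021043057070092109127138147164177200208238242258,
  008026036054073083098112133156171190199223225253258,
  009027037055072082099113132157170191198222224252258,
  010024038052075081096114135158169188197221227255258,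
  011025039053074080097115134159168189196220226254258,
  012030032050077087102116129152175186195219229249258,
  013031033051076086103117128153174187194218228248258,
  014028034048079085100118131154173184193217231251258,
  015029035049078084101119130155172185192216230250258,
  000019046054072084103123138159173178197209236249259,
  001018047055073085102122139158172179196208237248259,
  002017044052074086101121136157175176199211238251259,
  003016045053075087100120137156174177198210239250259,
  004023042050076080099127142155169182193213232253259,
  005022043051077081098126143154168183192212233252259,
  006021040048078082097125140153171180195215234255259,
  007020041049079083096124141152170181194214235254259,
  008027038062064092111115130151165186205217228241259,
  009026039063065093110114131150164187204216229240259,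
  010025036060066094109113128149167184207219230243259,
  011024037061067095108112129148166185206218231242259,
  012031034058068088107119134147161190201221224245259,
  013030035059069089106118135146160191200220225244259,
  014029032056070090105117132145163188203223226247259,
  015028033057071091104116133144162189202222227246259,
  000020038059078085098113137147175189204218232247260,
  001021039058079084099112136146174188205219233246260,
  002022036057076087096115139145173191206216234245260,
  003023037056077086097114138144172190207217235244260,
  004016034063074081102117141151171185200222236243260,
  005017035062075080103116140150170184201223237242260,
  006018032061072083100119143149169187202220238241260,
  007019033060073082101118142148168186203221239240260,
  008028046051070093106121129155167181196210224255260,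
  009029047050071092107120128154166180197211225254260,
  010030044049068095104123131153165183198208226253260,
  011031045048069094105122130152164182199209227252260,
  012024042055066089110125133159163177192214228251260,
  013025043054067088111124132158162176193215229250260,
  014026040053064091108127135157161179194212230249260,
  015027041052065090109126134156160178195213231248260,
  000021036051071090111114142152161185198220237251261,
  001020037050070091110115143153160184199221236250261,
  002023038049069088109112140154163187196222239249261,
  003022039048068089108113141155162186197223238248261,
  004017032055067094107118138156165189194216233255261,
  005016033054066095106119139157164188195217232254261,
  006019034053065092105116136158167191192218235253261,
  007018035052064093104117137159166190193219234252261,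
  008029044059079082103122134144169177206212229243261,
  009028045058078083102123135145168176207213228242261,
  010031046057077080101120132146171179204214231241261,
  011030047056076081100121133147170178205215230240261,
  012025040063075086099126130148173181202208225247261,
  013024041062074087098127131149172180203209224246261,
  014027042061073084097124128150175183200210227245261,
  015026043060072085096125129151174182201211226244261,
  000022042053079094104121132151172187195221225242262,
  001023043052078095105120133150173186194220224243262,
  002020040055077092106123134149174185193223227240262,
  003021041054076093107122135148175184192222226241262,
  004018046049075090108125128147168191199217229246262,
  005019047048074091109124129146169190198216228247262,
  006016044051073088110127130145170189197219231244262,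
  007017045050072089111126131144171188196218230245262,
  008030034061071086096113140159164179203213233250262,
  009031035060070087097112141158165178202212232251262,
  010028032063069084098115142157166177201215235248262,
  011029033062068085099114143156167176200214234249262,
  012026038057067082100117136155160183207209237254262,
  013027039056066083101116137154161182206208236255262,
  014024036059065080102119138153162181205211239252262,
  015025037058064081103118139152163180204210238253262,
  000023040061070081101122131156162191201219228254263,
  001022041060071080100123130157163190200218229255263,
  002021042063068083103120129158160189203217230252263,
  003020043062069082102121128159161188202216231253263,
  004019044057066085097126135152166187205223224250263,
  005018045056067084096127134153167186204222225251263,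
  006017046059064087099124133154164185207221226248263,
  007016047058065086098125132155165184206220227249263,
  008031032053078089109114139148170183193211236246263,
  009030033052079088108115138149171182192210237247263,
  010029034055076091111112137150168181195209238244263,
  011028035054077090110113136151169180194208239245263,
  012027036049074093105118143144174179197215232242263,
  013026037048075092104119142145175178196214233243263,
  014025038051072095107116141146172177199213234240263,
  015024039050073094106117140147173176198212235241263,
  000024047060069093099116134145171183194217238250264,
  001025046061068092098117135144170182195216239251264,
  002026045062071095097118132147169181192219236248264,
  003027044063070094096119133146168180193218237249264,
  004028043056065089103112130149175179198221234254264,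
  005029042057064088102113131148174178199220235255264,
  006030041058067091101114128151173177196223232252264,
  007031040059066090100115129150172176197222233253264,
  008016039052077085107124142153163191202209230242264,
  009017038053076084106125143152162190203208231243264,
  010018037054079087105126140155161189200211228240264,
  011019036055078086104127141154160188201210229241264,
  012020035048073081111120138157167187206213226246264,
  013021034049072080110121139156166186207212227247264,
  014022033050075083109122136159165185204215224244264,
  015023032051074082108123137158164184205214225245264,
  000025045052076082110119129154165179200223235246265,
  001024044053077083111118128155164178201222234247265,
  002027047054078080108117131152167177202221233244265,
  003026046055079081109116130153166176203220232245265,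
  004029041048072086106115133158161183204219239242265,
  005028040049073087107114132159160182205218238243265,
  006031043050074084104113135156163181206217237240265,
  007030042051075085105112134157162180207216236241265,
  008017037060068090102127137146173187192215227254265,
  009016036061069091103126136147172186193214226255265,
  010019039062070088100125139144175185194213225252265,
  011018038063071089101124138145174184195212224253265,
  012021033056064094098123141150169191196211231250265,
  013020032057065095099122140151168190197210230251265,
  014023035058066092096121143148171189198209229248265,
  015022034059067093097120142149170188199208228249265,
  000026035050068086105124139149168177205222231255266,
  001027034051069087104125138148169176204223230254266,
  002024033048070084107126137151170179207220229253266,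
  003025032049071085106127136150171178206221228252266,
  004030039054064082109120143145172181201218227251266,
  005031038055065083108121142144173180200219226250266,
  006028037052066080111122141147174183203216225249266,
  007029036053067081110123140146175182202217224248266,
  008018043058076094097116131157160185197214239247266,
  009019042059077095096117130156161184196215238246266,
  010016041056078092099118129159162187199212237245266,
  011017040057079093098119128158163186198213236244266,
  012022047062072090101112135153164189193210235243266,
  013023046063073091100113134152165188192211234242266,
  014020045060074088103114133155166191195208233241266,
  015021044061075089102115132154167190194209232240266,
  000027033058077089100127140158166181199216226243267,
  001026032059076088101126141159167180198217227242267,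
  002025035056079091102125142156164183197218224241267,
  003024034057078090103124143157165182196219225240267,
  004031037062073093096123136154162177195220230247267,
  005030036063072092097122137155163176194221231246267,
  006029039060075095098121138152160179193222228245267,
  007028038061074094099120139153161178192223229244267,
  008019041050069081108119132150174189207208234251267,
  009018040051068080109118133151175188206209235250267,
  010017043048071083110117134148172191205210232249267,
  011016042049070082111116135149173190204211233248267,
  012023045054065085104115128146170185203212238255267,
  013022044055064084105114129147171184202213239254267,
  014021047052067087106113130144168187201214236253267,
  015020046053066086107112131145169186200215237252267,
  000028041055075088097117143146164186206211230253268,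
  001029040054074089096116142147165187207210231252268,
  002030043053073090099119141144166184204209228255268,
  003031042052072091098118140145167185205208229254268,
  004024045051079092101113139150160190202215226249268,
  005025044050078093100112138151161191203214227248268,
  006026047049077094103115137148162188200213224251268,
  007027046048076095102114136149163189201212225250268,
  008020033063067080105125135154172178198219238245268,
  009021032062066081104124134155173179199218239244268,
  010022035061065082107127133152174176196217236247268,
  011023034060064083106126132153175177197216237246268,
  012016037059071084109121131158168182194223234241268,
  013017036058070085108120130159169183195222235240268,
  014018039057069086111123129156170180192221232243268,
  015019038056068087110122128157171181193220233242268,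
  000029043063066087108118136153170190196213227241269,
  001028042062067086109119137152171191197212226240269,
  002031041061064085110116138155168188198215225243269,
  003030040060065084111117139154169189199214224242269,
  004025047059070083104114140157174186192209231245269,
  005024046058071082105115141156175187193208230244269,
  006027045057068081106112142159172184194211229247269,
  007026044056069080107113143158173185195210228246269,
  008021035055074095100126128145162182204221235249269,
  009020034054075094101127129144163183205220234248269,
  010023033053072093102124130147160180206223233251269,
  011022032052073092103125131146161181207222232250269,
  012017039051078091096122132149166178200217239253269,
  013016038050079090097123133148167179201216238252269,
  014019037049076089098120134151164176202219237255269,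
  015018036048077088099121135150165177203218236254269,
  000030037057074083107125130150167188193212239248270,
  001031036056075082106124131151166189192213238249270,
  002028039059072081105127128148165190195214237250270,
  003029038058073080104126129149164191194215236251270,
  004026033061078087111121134146163184197208235252270,
  005027032060079086110120135147162185196209234253270,
  006024035063076085109123132144161186199210233254270,
  007025034062077084108122133145160187198211232255270,
  008022045049066091099117138158175180201220231240270,
  009023044048067090098116139159174181200221230241270,
  010020047051064089097119136156173182203222229242270,
  011021046050065088096118137157172183202223228243270,
  012018041053070095103113142154171176205216227244270,
  013019040052071094102112143155170177204217226245270,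
  014016043055068093101115140152169178207218225246270,
  015017042054069092100114141153168179206219224247270,
  000031039049067092102126133157169184203210234244271,
  001030038048066093103127132156168185202211235245271,
  002029037051065094100124135159171186201208232246271,
  003028036050064095101125134158170187200209233247271,
  004027035053071088098122129153173188207214238240271,
  005026034052070089099123128152172189206215239241271,
  006025033055069090096120131155175190205212236242271,
  007024032054068091097121130154174191204213237243271,
  008023047057075084110118141149161176195218226252271,
  009022046056074085111119140148160177194219227253271,
  010021045059073086108116143151163178193216224254271,
  011020044058072087109117142150162179192217225255271,
  012019043061079080106114137145165180199222230248271,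
  013018042060078081107115136144164181198223231249271,
  014017041063077082104112139147167182197220228250271,
  015016040062076083105113138146166183196221229251271,
  000001002003004005006007008009010011012013014015272,
  016017018019020021022023024025026027028029030031272,
  032033034035036037038039040041042043044045046047272,
  048049050051052053054055056057058059060061062063272,
  064065066067068069070071072073074075076077078079272,
  080081082083084085086087088089090091092093094095272,
  096097098099100101102103104105106107108109110111272,
  112113114115116117118119120121122123124125126127272,
  128129130131132133134135136137138139140141142143272,
  144145146147148149150151152153154155156157158159272,
  160161162163164165166167168169170171172173174175272,
  176177178179180181182183184185186187188189190191272,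
  192193194195196197198199200201202203204205206207272,
  208209210211212213214215216217218219220221222223272,
  224225226227228229230231232233234235236237238239272,
  240241242243244245246247248249250251252253254255272,
  256257258259260261262263264265266267268269270271272]

theorem hall_isPlane : hall.IsPlane := by
  constructor <;> decide +kernel

/-- Unitals in the plane with table `hall`. -/
noncomputable def hallUnitals : List TableUnital := [
  ⟨hall, hall_isPlane,
    222502220681448613580864414551266000223451184010997239314427985848058280421687298,
    361, by decide +kernel⟩,
  ⟨hall, hall_isPlane,
    3794275184714695385563909579461219050935290969512190953855259242428203944857844288,
    3541, by decide +kernel⟩,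
  ⟨hall, hall_isPlane,
    9725670733843701262509065423804928821500950034115888600563932807132597908003749993,
    4590, by decide +kernel⟩,
  ⟨hall, hall_isPlane,
    3794378533763112124550982093083720515871668584803053362707238432966577629488488898,
    4999, by decide +kernel⟩]

/-- Unitals in the plane with table `hall.dual`. -/
noncomputable def hallDualUnitals : List TableUnital := [
  ⟨hall.dual, hall_isPlane.dual,
    4981092107217067591214877194032537347899217648684719394672819265061001344347807744,
    641, by decide +kernel⟩,
  ⟨hall.dual, hall_isPlane.dual,
    12035039099698698466846123512382185381881911760278309706911676022463538044828909568,
    1571, by decide +kernel⟩,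
  ⟨hall.dual, hall_isPlane.dual,
    12340657703881678152428568140419700958637420274146365419167415549118658726384959593,
    2282, by decide +kernel⟩,
  ⟨hall.dual, hall_isPlane.dual,
    7737922156698351948608528257063494463330953994312057091656691532777728164123639913,
    5985, by decide +kernel⟩]

/-- One hundred and sixty-eight unitals with distinct invariants. -/
noncomputable def unitals : List TableUnital :=
  derivedDualHallBUnitals ++ derivedDualHallBDualUnitals ++
    derivedSemifieldBUnitals ++ derivedSemifieldBDualUnitals ++
    derivedSemifieldAUnitals ++ derivedSemifieldADualUnitals ++
    semifieldAUnitals ++ semifieldADualUnitals ++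
    translationPlaneUnitals ++ translationPlaneDualUnitals ++
    derivedDualHallAUnitals ++ derivedDualHallADualUnitals ++
    semifieldBUnitals ++ semifieldBDualUnitals ++
    hallUnitals ++ hallDualUnitals

theorem unitals_nodup : (unitals.map TableUnital.code).Nodup := by
  decide +kernel

theorem mainTheorem1 :
    ∃ D : Fin 168 → Set (Set (Fin 65)),
      (∀ i, IsDesign 2 65 5 1 (D i) ∧ IsEmbeddedUnitalDesign 4 (D i)) ∧
      ∀ i j, i ≠ j → ¬ AreIsomorphic (D i) (D j) :=
  exists_nonisomorphic_unitalDesigns unitals unitals_nodup
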